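/- Let $M$ be a non-empty compact connected topological manifold of dimension $n$, possibly with boundary, with a compatible metric $d$, let $\varphi$ be a continuous flow on $M$, fix $T>0$, and let $\alpha\in H^1(M,\mathbb Z)=[M,\mathbb R/\mathbb Z]$. **Partial cross-sections.** A partial cross-section is a non-empty compact topological submanifold $S\subset M$ of dimension $n-1$ with $\partial S\subset\partial M$ which is topologically transverse to $\varphi$: every $x\in S$ has a neighbourhood $U$ in $S$ and a $t>0$ such that $y\in U$, $|s|\le t$ and $\varphi_s(y)\in U$ imply $s=0$. Its class $[S]$ is the homotopy class of any continuous $f\colon M\to\mathbb R/\mathbb Z$ with $f^{-1}(0)=S$ which crosses $0$ in the positive direction along the flow; $S$ is cohomologous to $\alpha$ if $[S]=\alpha$. An isotopy along the flow from $S$ to $S'$ is a continuous family $\theta_t\colon S\to\mathbb R$, $t\in[0,1]$, with $\theta_0=0$, such that $x\mapsto\varphi_{\theta_t(x)}(x)$ is an embedding of $S$ for every $t$, with image $S'$ for $t=1$. Let $\mathcal{PS}_\varphi(\alpha)$ be the set of partial cross-sections cohomologous to $\alpha$ up to isotopy along the flow. **Pre-Lyapunov maps.** An $(\varepsilon,T)$-pseudo-orbit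 is a finite concatenation of orbit arcs with jumps of size less than $\varepsilon$ between consecutive arcs, all arcs having length at least $T$ except the last one, which only has positive length. Periodic $(\varepsilon,T)$-pseudo-orbits are defined in the same way on a circle, all arcs having length at least $T$. For a continuous $f\colon M\to\mathbb R/\mathbb Z$ let $\widehat M_f=\{(x,t)\in M\times\mathbb R: f(x)\equiv t \bmod 1\}$, with the lifted flow and the metric of $M\times\mathbb R$, and let $\widehat f(x,t)=t$. The map $f$ is pre-Lyapunov if $\widehat f(p)\ge\widehat f(q)$ whenever for every $\varepsilon>0$ there is an $(\varepsilon,T)$-pseudo-orbit from $p$ to $q$ in $\widehat M_f$. The set $\mathrm{Rec}_\alpha$ consists of the points $x\in M$ such that for all $\varepsilon,T'>0$ there is a periodic $(\varepsilon,T')$-pseudo-orbit $\gamma$ through $x$ with $\alpha([\gamma])=0$, where $[\gamma]$ is the homology class of the closed curve obtained by joining each jump by a curve inside a ball of radius $\varepsilon$. Let $X_\alpha$ be the set of continuous maps $f\colon M\to\mathbb R/\mathbb Z$ of class $\alpha$ with $f(\mathrm{Rec}_\alpha)=0$ and with $-f$ pre-Lyapunov, and let $\mathrm{PL}(\alpha)$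 be the set of classes of $X_\alpha$ under homotopy through maps in $X_\alpha$, the class of the constant map $0$ being removed (when $\alpha=0$). **The map $[F]$.** For a partial cross-section $S$ and an $\varepsilon>0$ such that $S\times[-\varepsilon,\varepsilon]\to M$, $(x,t)\mapsto\varphi_t(x)$, is an embedding, define $F_S\colon M\to\mathbb R/\mathbb Z$ by $F_S(\varphi_t(x))=\frac{t+\varepsilon}{2\varepsilon}$ for $x\in S$, $|t|\le\varepsilon$, and $F_S=0$ elsewhere. **Theorem.** For every partial cross-section $S$ cohomologous to $\alpha$ such an $\varepsilon$ exists, and for every such $\varepsilon$ the map $F_S$ is continuous and belongs to $X_\alpha$. Its class in $\mathrm{PL}(\alpha)$ depends neither on $\varepsilon$ nor on the choice of $S$ in its isotopy class along the flow, and the resulting map $[F]\colon\mathcal{PS}_\varphi(\alpha)\to\mathrm{PL}(\alpha)$, $[S]\mapsto[F_S]$, is injective. If moreover every point of $M$ that is not fixed by $\varphi$ has a flow box (that is, lies in the image of an open embedding $V\times(-\delta,\delta)\to M$, $(v,t)\mapsto\varphi_t(\sigma(v))$, with $V$ an open subset of the half-space $\{x\in\mathbb R^{n-1}:x_1\ge0\}$),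 then $[F]$ is a bijection. -/

import Mathlib

open Set Topology

namespace PartialCrossSections

/-! ### Topological manifolds with boundary, flow boxes -/

/-- The closed half-space `{x ∈ ℝᵏ : x₀ ≥ 0}`; it is all of `ℝ⁰` when `k = 0`. -/
def HalfSpace (k : ℕ) : Set (EuclideanSpace ℝ (Fin k)) :=
  {x | ∀ i : Fin k, i.val = 0 → 0 ≤ x i}

/-- `X` is a topological manifold of dimension `k`, possibly with boundary. -/
def IsTopManifold (k : ℕ) (X : Type*) [TopologicalSpace X] : Prop :=
  T2Space X ∧ SecondCountableTopology X ∧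
    ∀ x : X, ∃ e : OpenPartialHomeomorph X (HalfSpace k), x ∈ e.source

/-- The boundary of a `k`-manifold: the points without a neighbourhood homeomorphic to an open
subset of `ℝᵏ`. -/
def topBoundary (k : ℕ) (X : Type*) [TopologicalSpace X] : Set X :=
  {x | ¬ ∃ e : OpenPartialHomeomorph X (EuclideanSpace ℝ (Fin k)), x ∈ e.source}

/-- Every point that is not fixed by the flow has a flow box `V × (-δ, δ)`, where `V` is an open
subset of the half-space of dimension `n - 1`. -/
def HasFlowBoxes {M : Type*} [TopologicalSpace M] (φ : Flow ℝ M) (n : ℕ) : Prop :=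
  ∀ x : M, (∃ t : ℝ, φ t x ≠ x) →
    ∃ d : ℕ, d + 1 = n ∧
      ∃ (V : Set (HalfSpace d)) (σ : V → M) (δ : ℝ), IsOpen V ∧ 0 < δ ∧
        IsOpenEmbedding (fun p : V × Ioo (-δ) δ => φ p.2 (σ p.1)) ∧ ∃ v : V, σ v = x

/-! ### Partial cross-sections and isotopies along the flow -/

section CrossSections

variable {M : Type*} [TopologicalSpace M]

/-- Topological transversality of `S` to the flow. -/
def IsTransverse (φ : Flow ℝ M) (S : Set M) : Prop :=
  ∀ x ∈ S, ∃ t : ℝ, 0 < t ∧ ∃ U : Set M, U ⊆ S ∧ U ∈ 𝓝[S] x ∧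
    ∀ y ∈ U, ∀ s ∈ Icc (-t) t, φ s y ∈ U → s = 0

/-- Partial cross-sections of a flow on an `n`-manifold `M`: non-empty compact topological
submanifolds `S` (with the subspace topology) of codimension one, with `∂S ⊆ ∂M`, that are
topologically transverse to the flow. -/
def IsPartialCrossSection (φ : Flow ℝ M) (n : ℕ) (S : Set M) : Prop :=
  S.Nonempty ∧ IsCompact S ∧
    (∃ d : ℕ, d + 1 = n ∧ IsTopManifold d S ∧
      ∀ x : S, x ∈ topBoundary d S → (x : M) ∈ topBoundary n M) ∧
    IsTransverse φ S

/-- `S₁ = S_{θ_1}` for an isotopy along the flow `S_{θ_t} = {φ_{θ_t(x)}(x) : x ∈ S₀}`, `t ∈ [0,1]`,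
where `θ_0 = 0` and every `S_{θ_t}` is embedded. -/
def IsotopicAlongFlow (φ : Flow ℝ M) (S₀ S₁ : Set M) : Prop :=
  ∃ θ : C(unitInterval × S₀, ℝ), (∀ x, θ (0, x) = 0) ∧
    (∀ t, IsEmbedding (fun x : S₀ => φ (θ (t, x)) (x : M))) ∧
    range (fun x : S₀ => φ (θ (1, x)) (x : M)) = S₁

end CrossSections

/-! ### First cohomology as homotopy classes of circle-valued maps -/

/-- Homotopy of maps to the circle `ℝ/ℤ`, as a setoid. -/
def homotopySetoid (M : Type*) [TopologicalSpace M] : Setoid C(M, UnitAddCircle) :=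
  ⟨ContinuousMap.Homotopic, ContinuousMap.Homotopic.equivalence⟩

/-- `H¹(M, ℤ)`, realised as the set `[M, ℝ/ℤ]` of homotopy classes. -/
def H1 (M : Type*) [TopologicalSpace M] : Type _ := Quotient (homotopySetoid M)

/-- The cohomology class `[f]` of a circle-valued map. -/
def classOf {M : Type*} [TopologicalSpace M] (f : C(M, UnitAddCircle)) : H1 M :=
  Quotient.mk (homotopySetoid M) f

/-- `a` is the total variation of (a continuous real lift of) `f` along the path `c`. For a closed
path it is the integer `[f]([c])`. -/
def HasVariation {M : Type*} [TopologicalSpace M] (f : C(M, UnitAddCircle)) {x y : M}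
    (c : Path x y) (a : ℝ) : Prop :=
  ∃ u : C(unitInterval, ℝ), (∀ s, ((u s : ℝ) : UnitAddCircle) = f (c s)) ∧ u 1 - u 0 = a

/-- The orbit arc of length `t` from `x` to `φ_t(x)`, parametrised by `[0,1]`. -/
def orbitArc {M : Type*} [TopologicalSpace M] (φ : Flow ℝ M) (x : M) (t : ℝ) :
    Path x (φ t x) where
  toFun s := φ (s * t) x
  continuous_toFun := by
    have h : Continuous (fun s : unitInterval => ((s : ℝ) * t, x)) := by fun_prop
    exact φ.cont'.comp h
  source' := by simp
  target' := by simp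

/-- `[S] = α`: some `f` of class `α` has `f⁻¹(0) = S`, and `f` crosses `0` in the positive
direction when `S` is crossed along the flow. -/
def HasClass {M : Type*} [TopologicalSpace M] (φ : Flow ℝ M) (S : Set M) (α : H1 M) : Prop :=
  ∃ f : C(M, UnitAddCircle), classOf f = α ∧ f ⁻¹' {0} = S ∧
    ∀ x ∈ S, ∃ δ : ℝ, 0 < δ ∧
      (∀ s ∈ Ioo 0 δ, ∃ r ∈ Ioo (0 : ℝ) (1 / 2), f (φ s x) = (r : UnitAddCircle)) ∧
      (∀ s ∈ Ioo (-δ) 0, ∃ r ∈ Ioo (-(1 / 2) : ℝ) 0, f (φ s x) = (r : UnitAddCircle))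

/-- Partial cross-sections cohomologous to `α`. -/
def CrossSection {M : Type*} [TopologicalSpace M] (φ : Flow ℝ M) (n : ℕ) (α : H1 M) : Type _ :=
  {S : Set M // IsPartialCrossSection φ n S ∧ HasClass φ S α}

/-- The set of partial cross-sections cohomologous to `α`, up to isotopy along the flow. -/
def PS {M : Type*} [TopologicalSpace M] (φ : Flow ℝ M) (n : ℕ) (α : H1 M) : Type _ :=
  Quot (fun S₀ S₁ : CrossSection φ n α => IsotopicAlongFlow φ S₀.1 S₁.1)

/-- The flow box `φ_{[-ε,ε]}(S)` is embedded. -/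
def IsEmbeddedBox {M : Type*} [TopologicalSpace M] (φ : Flow ℝ M) (S : Set M) (ε : ℝ) : Prop :=
  IsEmbedding (fun p : S × Icc (-ε) ε => φ p.2 (p.1 : M))

/-- `F` is the map `F_S` of the embedded flow box `φ_{[-ε,ε]}(S)`: it equals `(t + ε) / (2ε)` at
`φ_t(x)` for `x ∈ S`, `|t| ≤ ε`, and `0` outside the box. -/
def IsBoxMap {M : Type*} [TopologicalSpace M] (φ : Flow ℝ M) (S : Set M) (ε : ℝ)
    (F : C(M, UnitAddCircle)) : Prop :=
  (∀ x ∈ S, ∀ t ∈ Icc (-ε) ε, F (φ t x) = (((t + ε) / (2 * ε) : ℝ) : UnitAddCircle)) ∧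
    ∀ y, (∀ x ∈ S, ∀ t ∈ Icc (-ε) ε, φ t x ≠ y) → F y = 0

/-! ### Pseudo-orbits, recurrence and pre-Lyapunov maps -/

section Recurrence

variable {M : Type*} [MetricSpace M]

/-- The covering `{(x, t) : f(x) ≡ t mod 1}` of `M`, with the metric induced from `M × ℝ`.
It is a disjoint union of copies (its connected components) of the covering `M̂_α`, `α = [f]`;
when `f` is null-homotopic the components are copies of `M`. -/
abbrev Cover (f : C(M, UnitAddCircle)) : Type _ :=
  {p : M × ℝ // f p.1 = (p.2 : UnitAddCircle)}

/-- `q = φ̂_t(p)` for the lifted flow on the covering. -/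
def LiftedFlow (φ : Flow ℝ M) (f : C(M, UnitAddCircle)) (t : ℝ) (p q : Cover f) : Prop :=
  q.1.1 = φ t p.1.1 ∧ HasVariation f (orbitArc φ p.1.1 t) (q.1.2 - p.1.2)

/-- There is an `(ε, T)`-pseudo-orbit from `p` to `q` in the covering: finitely many orbit arcs of
length at least `T`, each followed by a jump of size smaller than `ε`, and then a last orbit arc
of positive length. -/
def HasPseudoOrbit (φ : Flow ℝ M) (f : C(M, UnitAddCircle)) (ε T : ℝ) (p q : Cover f) : Prop :=
  ∃ r : Cover f,
    Relation.ReflTransGen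
      (fun a b : Cover f => ∃ t : ℝ, T ≤ t ∧ ∃ c : Cover f, LiftedFlow φ f t a c ∧ dist c b < ε)
      p r ∧
    ∃ t : ℝ, 0 < t ∧ LiftedFlow φ f t r q

/-- A circle-valued map `f` is pre-Lyapunov if its lift `(x, t) ↦ t` satisfies `f̂(p) ≥ f̂(q)`
whenever, for every `ε > 0`, there is an `ε`-pseudo-orbit from `p` to `q`. (Any other continuous
lift differs from this one by a constant on each component.) -/
def IsPreLyapunov (φ : Flow ℝ M) (T : ℝ) (f : C(M, UnitAddCircle)) : Prop :=
  ∀ p q : Cover f, (∀ ε : ℝ, 0 < ε → HasPseudoOrbit φ f ε T p q) → q.1.2 ≤ p.1.2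

/-- A periodic `(ε, T)`-pseudo-orbit in `M`: it flows from `pt i` during `time i ≥ T`, then jumps to
`pt (i + 1)`, for `i < k`, and closes up. (Jumps of size zero are allowed, so a genuine periodic
orbit, run through often enough, is one.) -/
structure PeriodicPseudoOrbit (φ : Flow ℝ M) (ε T : ℝ) where
  k : ℕ
  k_pos : 0 < k
  pt : ℕ → M
  time : ℕ → ℝ
  closed : pt k = pt 0
  le_time : ∀ i < k, T ≤ time i
  jump_lt : ∀ i < k, dist (φ (time i) (pt i)) (pt (i + 1)) < ε

/-- The periodic pseudo-orbit `γ` passes through `x`. -/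
def PeriodicPseudoOrbit.PassesThrough {φ : Flow ℝ M} {ε T : ℝ} (γ : PeriodicPseudoOrbit φ ε T)
    (x : M) : Prop :=
  ∃ i < γ.k, ∃ s ∈ Ico 0 (γ.time i), φ s (γ.pt i) = x

/-- `α([γ]) = m`, where `[γ]` is the class of the closed curve obtained from `γ` by joining each jump
with a curve that remains in a ball of radius `ε`. -/
def PeriodicPseudoOrbit.HasPairing {φ : Flow ℝ M} {ε T : ℝ} (γ : PeriodicPseudoOrbit φ ε T)
    (α : H1 M) (m : ℝ) : Prop :=
  ∃ f : C(M, UnitAddCircle), classOf f = α ∧ ∃ a b : ℕ → ℝ,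
    (∀ i < γ.k, HasVariation f (orbitArc φ (γ.pt i) (γ.time i)) (a i)) ∧
    (∀ i < γ.k, ∃ c : Path (φ (γ.time i) (γ.pt i)) (γ.pt (i + 1)),
      (∃ z, range c ⊆ Metric.ball z ε) ∧ HasVariation f c (b i)) ∧
    ∑ i ∈ Finset.range γ.k, (a i + b i) = m

/-- The `α`-recurrent set. (The condition for small `ε` implies it for all larger ones.) -/
def alphaRec (φ : Flow ℝ M) (α : H1 M) : Set M :=
  {x | ∀ ε : ℝ, 0 < ε → ∀ T : ℝ, 0 < T →
    ∃ γ : PeriodicPseudoOrbit φ ε T, γ.PassesThrough x ∧ γ.HasPairing α 0}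

/-- Membership in the set `[(M, Rec_α) : (ℝ/ℤ, 0)]_α`: the map is cohomologous to `α`, vanishes on
the `α`-recurrent set, and its opposite is pre-Lyapunov. -/
def IsPLMap (φ : Flow ℝ M) (T : ℝ) (α : H1 M) (f : C(M, UnitAddCircle)) : Prop :=
  classOf f = α ∧ (∀ x ∈ alphaRec φ α, f x = 0) ∧ IsPreLyapunov φ T (-f)

/-- The set `[(M, Rec_α) : (ℝ/ℤ, 0)]_α`, before passing to homotopy classes. -/
def PLMap (φ : Flow ℝ M) (T : ℝ) (α : H1 M) : Type _ :=
  {f : C(M, UnitAddCircle) // IsPLMap φ T α f}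

/-- Homotopy through maps of the set `[(M, Rec_α) : (ℝ/ℤ, 0)]_α`. -/
def plSetoid (φ : Flow ℝ M) (T : ℝ) (α : H1 M) : Setoid (PLMap φ T α) where
  r f g := ContinuousMap.HomotopicWith f.1 g.1 (IsPLMap φ T α)
  iseqv :=
    { refl := fun f => ContinuousMap.HomotopicWith.refl f.1 f.2
      symm := fun h => h.symm
      trans := fun h₁ h₂ => h₁.trans h₂ }

/-- `PL(α)`: the non-zero homotopy classes, i.e. those that do not contain the constant map `0`
(this removes something only when `α = 0`). -/
def PL (φ : Flow ℝ M) (T : ℝ) (α : H1 M) : Type _ :=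
  {c : Quotient (plSetoid φ T α) // ∀ f : PLMap φ T α, Quotient.mk _ f = c → f.1 ≠ 0}

end Recurrence

end PartialCrossSections

namespace PartialCrossSections

/-! ### Real lifts of circle-valued maps -/

section Lifts

/-! Everything is expressed through real functions. Along an orbit a circle-valued map `f` has a
real variation `orbitVar`. Two maps have the same class iff their difference lifts to a real
function `u` (`classOf_eq_iff`). Two elements of X_α are homotopic in X_α iff `u` can be chosen to
vanish on Rec_α: one direction lifts the homotopy (`exists_real_of_homotopicWith`), the other
interpolates linearly, the pre-Lyapunov inequality being convex (`IsPLMap.homotopicWith`).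

The map is well defined. The lift of a box map rises by one across each box and is constant
elsewhere, so a long orbit arc that starts inside a box regains more than a small jump loses.
Pseudo-orbits therefore cannot descend, and a closed one of zero pairing cannot pass through the
interior of a box (`IsBoxMap.isPLMap`). The trace of an isotopy is a compact local section of a flow
on [0,1] × M, and its box map is a homotopy (`homotopicWith_of_family`).

The map is injective. If two box maps differ by `u` vanishing on Rec_α, the orbit of each point x of
S₀ must satisfy `orbitVar φ F₀ x t + u (φ t x) = 0` for some t. If the variation is unbounded, it
beats the bounded `u`; if it is bounded, the orbit accumulates on Rec_α, where `u` is small. So both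
signs occur (`IsBoxMap.exists_pos`, `IsBoxMap.exists_neg`). The solution t is unique and continuous
in x, and multiplying it by a parameter in [0,1] gives an isotopy onto S₁
(`IsBoxMap.isotopicAlongFlow`). The same sign argument shows that a box map is not homotopic to 0.

With flow boxes, the map is surjective. By compactness, chains with small jumps in the covering of f
lose little height (`IsPreLyapunov.exists_chain_bound`). This gives an absorbing function separating
the levels 0 and 1, in the spirit of Conley. Taking a maximum over past orbit segments, then a mean
over future ones, and adding integer translates yields g = f + u that strictly increases off its
zeros, with `u` zero on Rec_α (`IsPLMap.exists_increasesOffZero`); here recurrent points keep their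
height (`IsPLMap.orbitVar_eq_zero`). The level 1/2 of g is the required section. Flow boxes give its
charts, and the inclusion of its boundary in that of M rests on a no-retraction theorem
(`no_contDiff_retraction`, `false_of_euclidean_chart`). -/

theorem coe_circle_eq_zero_iff {r : ℝ} : (r : UnitAddCircle) = 0 ↔ ∃ n : ℤ, r = n := by
  rw [AddCircle.coe_eq_zero_iff]
  simp [eq_comm]

theorem coe_circle_eq_iff {r s : ℝ} : (r : UnitAddCircle) = s ↔ ∃ n : ℤ, r = s + n := by
  rw [← sub_eq_zero, ← AddCircle.coe_sub, coe_circle_eq_zero_iff]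
  simp [sub_eq_iff_eq_add']

theorem coe_circle_int (n : ℤ) : ((n : ℝ) : UnitAddCircle) = 0 :=
  coe_circle_eq_zero_iff.2 ⟨n, rfl⟩

theorem continuous_coe_circle : Continuous (fun r : ℝ => (r : UnitAddCircle)) :=
  AddCircle.continuous_mk' 1

/-- Two lifts of the same circle-valued map on a preconnected set differ by a constant. -/
theorem lift_sub_eq {X : Type*} [TopologicalSpace X] {s : Set X} (hs : IsPreconnected s)
    {u w : X → ℝ} (hu : ContinuousOn u s) (hw : ContinuousOn w s)
    (h : ∀ x ∈ s, (u x : UnitAddCircle) = w x) {x y : X} (hx : x ∈ s) (hy : y ∈ s) :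
    u x - w x = u y - w y := by
  have hT : DiscreteTopology (range ((↑) : ℤ → ℝ)) :=
    Int.isClosedEmbedding_coe_real.isEmbedding.toHomeomorph.symm.isEmbedding.discreteTopology
  refine hs.constant_of_mapsTo (T := range ((↑) : ℤ → ℝ)) ⟨hT⟩ (hu.sub hw) (fun z hz => ?_) hx hy
  obtain ⟨n, hn⟩ := coe_circle_eq_iff.1 (h z hz)
  exact ⟨n, by simp [hn]⟩

/-- Homotopy lifting for the covering ℝ → ℝ/ℤ. Applied to differences of maps, it turns homotopies
into real functions. -/
theorem exists_lift_of_homotopy {X : Type*} [TopologicalSpace X]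
    (H : C(unitInterval × X, UnitAddCircle)) (h0 : ∀ x, H (0, x) = 0) :
    ∃ K : C(unitInterval × X, ℝ), (∀ p, ((K p : ℝ) : UnitAddCircle) = H p) ∧
      ∀ x, K (0, x) = 0 := by
  have hc := AddCircle.isCoveringMap_coe (1 : ℝ)
  have h0' : ∀ x, H (0, x) = (((ContinuousMap.const X (0 : ℝ)) x : ℝ) : UnitAddCircle) := by
    intro x; simp [h0]
  refine ⟨hc.liftHomotopy H (ContinuousMap.const X 0) h0', fun p => ?_, fun x => ?_⟩
  · exact congrFun (hc.liftHomotopy_lifts H _ h0') p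
  · exact hc.liftHomotopy_zero H _ h0' x

variable {M : Type*} [TopologicalSpace M]

/-- Along a homotopy from f, the difference with f starts at 0 and lifts to ℝ; u is its final value.
Conversely, f + su is a homotopy. -/
theorem classOf_eq_iff {f g : C(M, UnitAddCircle)} :
    classOf f = classOf g ↔ ∃ u : C(M, ℝ), ∀ x, g x = f x + (u x : UnitAddCircle) := by
  constructor
  · intro h
    obtain ⟨H⟩ : ContinuousMap.Homotopic f g := Quotient.exact h
    obtain ⟨K, hK, -⟩ := exists_lift_of_homotopy
      (⟨fun p => H p - f p.2, by fun_prop⟩ : C(unitInterval × M, UnitAddCircle))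
      (fun x => by simp)
    refine ⟨⟨fun x => K (1, x), by fun_prop⟩, fun x => ?_⟩
    have := hK (1, x)
    simp only [ContinuousMap.coe_mk] at this ⊢
    rw [this]; simp
  · rintro ⟨u, hu⟩
    refine Quotient.sound
      ⟨⟨⟨fun p => f p.2 + (((p.1 : ℝ) * u p.2 : ℝ) : UnitAddCircle), ?_⟩, ?_, ?_⟩⟩
    · exact (f.continuous.comp continuous_snd).add
        (continuous_coe_circle.comp (by fun_prop))
    · intro x; simp
    · intro x; simp [hu]

/-- The real map that lifts `τ ↦ f (φ_τ x)`, normalised to vanish at `τ = 0`. -/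
theorem exists_variation (φ : Flow ℝ M) (f : C(M, UnitAddCircle)) :
    ∃ V : C(M × ℝ, ℝ), (∀ x, V (x, 0) = 0) ∧
      ∀ x t, ((V (x, t) : ℝ) : UnitAddCircle) = f (φ t x) - f x := by
  -- Scaling time by the homotopy parameter makes the difference vanish at parameter 0, so f itself
  -- need not have a lift on M.
  have hH : Continuous (fun p : unitInterval × M × ℝ =>
      f (φ ((p.1 : ℝ) * p.2.2) p.2.1) - f p.2.1) := by
    have : Continuous (fun p : unitInterval × M × ℝ => φ ((p.1 : ℝ) * p.2.2) p.2.1) :=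
      φ.continuous (by fun_prop) (by fun_prop)
    fun_prop
  obtain ⟨K, hK, hK0⟩ := exists_lift_of_homotopy ⟨_, hH⟩ (by simp)
  refine ⟨⟨fun p => K (1, p), by fun_prop⟩, fun x => ?_, fun x t => ?_⟩
  · have h2 := lift_sub_eq (isPreconnected_univ (α := unitInterval))
      (u := fun s => K (s, (x, 0))) (w := fun _ => 0)
      (by fun_prop) (by fun_prop) (fun s _ => by
        have := hK (s, (x, 0))
        simp only [this]; simp) (mem_univ 1) (mem_univ 0)
    simpa [hK0] using h2
  · have := hK (1, (x, t))
    simpa using this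

/-- The variation of `f` along the orbit arc of length `t` that starts at `x`. -/
noncomputable def orbitVar (φ : Flow ℝ M) (f : C(M, UnitAddCircle)) (x : M) (t : ℝ) : ℝ :=
  (exists_variation φ f).choose (x, t)

variable (φ : Flow ℝ M) (f : C(M, UnitAddCircle))

theorem continuous_orbitVar : Continuous (fun p : M × ℝ => orbitVar φ f p.1 p.2) :=
  (exists_variation φ f).choose.continuous

theorem continuous_orbitVar_right (x : M) : Continuous (orbitVar φ f x) :=
  (continuous_orbitVar φ f).comp (by fun_prop : Continuous fun t : ℝ => (x, t))

theorem orbitVar_zero (x : M) : orbitVar φ f x 0 = 0 :=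
  (exists_variation φ f).choose_spec.1 x

theorem coe_orbitVar (x : M) (t : ℝ) :
    ((orbitVar φ f x t : ℝ) : UnitAddCircle) = f (φ t x) - f x :=
  (exists_variation φ f).choose_spec.2 x t

theorem flow_orbit_continuous (x : M) : Continuous (fun t : ℝ => φ t x) :=
  φ.continuous continuous_id continuous_const

variable {φ f}

theorem orbitVar_eq_of_lift {x : M} {s : Set ℝ} (hs : IsPreconnected s) (h0 : (0 : ℝ) ∈ s)
    {u : ℝ → ℝ} (hu : ContinuousOn u s) (h : ∀ t ∈ s, (u t : UnitAddCircle) = f (φ t x))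
    {t : ℝ} (ht : t ∈ s) : orbitVar φ f x t = u t - u 0 := by
  have := lift_sub_eq hs (u := orbitVar φ f x) (w := fun t => u t - u 0)
    (continuous_orbitVar_right φ f x).continuousOn (hu.sub continuousOn_const)
    (fun r hr => by rw [coe_orbitVar, AddCircle.coe_sub, h r hr, h 0 h0, φ.map_zero_apply]) ht h0
  simp only [orbitVar_zero, sub_self] at this
  linarith

theorem orbitVar_add (x : M) (s t : ℝ) :
    orbitVar φ f x (s + t) = orbitVar φ f x s + orbitVar φ f (φ s x) t := by
  have h := lift_sub_eq (isPreconnected_univ (α := ℝ)) (u := fun t => orbitVar φ f x (s + t))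
    (w := fun t => orbitVar φ f x s + orbitVar φ f (φ s x) t)
    ((continuous_orbitVar_right φ f x).comp (by fun_prop)).continuousOn
    (continuous_const.add (continuous_orbitVar_right φ f _)).continuousOn
    (fun r _ => by
      rw [AddCircle.coe_add, coe_orbitVar, coe_orbitVar, coe_orbitVar, ← φ.map_add,
        add_comm r s]; abel) (mem_univ t) (mem_univ 0)
  simp only [add_zero, orbitVar_zero, sub_self] at h
  linarith

theorem orbitVar_neg_map (x : M) (t : ℝ) : orbitVar φ (-f) x t = -orbitVar φ f x t := by
  have := lift_sub_eq (isPreconnected_univ (α := ℝ)) (u := orbitVar φ (-f) x)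
    (w := fun t => -orbitVar φ f x t)
    (continuous_orbitVar_right φ _ x).continuousOn
    (continuous_orbitVar_right φ f x).neg.continuousOn
    (fun r _ => by
      rw [AddCircle.coe_neg, coe_orbitVar, coe_orbitVar]; simp; abel) (mem_univ t) (mem_univ 0)
  simp only [orbitVar_zero] at this
  linarith

theorem orbitVar_add_real {g : C(M, UnitAddCircle)} {u : C(M, ℝ)}
    (h : ∀ x, g x = f x + (u x : UnitAddCircle)) (x : M) (t : ℝ) :
    orbitVar φ g x t = orbitVar φ f x t + u (φ t x) - u x := by
  have hc := flow_orbit_continuous φ x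
  have := lift_sub_eq (isPreconnected_univ (α := ℝ)) (u := orbitVar φ g x)
    (w := fun t => orbitVar φ f x t + u (φ t x) - u x)
    (continuous_orbitVar_right φ _ x).continuousOn
    (((continuous_orbitVar_right φ f x).add (u.continuous.comp hc)).sub
      continuous_const).continuousOn
    (fun r _ => by
      rw [AddCircle.coe_sub, AddCircle.coe_add, coe_orbitVar, coe_orbitVar, h, h]; abel)
    (mem_univ t) (mem_univ 0)
  simp only [orbitVar_zero, φ.map_zero_apply] at this
  linarith

theorem hasVariation_unique {x y : M} {c : Path x y} {a b : ℝ} (ha : HasVariation f c a)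
    (hb : HasVariation f c b) : a = b := by
  obtain ⟨u, hu, rfl⟩ := ha
  obtain ⟨w, hw, rfl⟩ := hb
  have := lift_sub_eq (isPreconnected_univ (α := unitInterval)) u.continuous.continuousOn
    w.continuous.continuousOn (fun s _ => by rw [hu, hw]) (mem_univ 1) (mem_univ 0)
  linarith

theorem hasVariation_orbitArc (x : M) (t : ℝ) :
    HasVariation f (orbitArc φ x t) (orbitVar φ f x t) := by
  obtain ⟨r, hr⟩ := QuotientAddGroup.mk_surjective (f x)
  refine ⟨⟨fun s => r + orbitVar φ f x (s * t), ?_⟩, fun s => ?_, ?_⟩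
  · exact continuous_const.add ((continuous_orbitVar_right φ f x).comp (by fun_prop))
  · change ((r + orbitVar φ f x (s * t) : ℝ) : UnitAddCircle) = f (φ (s * t) x)
    rw [AddCircle.coe_add, coe_orbitVar, ← hr]; abel
  · simp [orbitVar_zero]

theorem hasVariation_orbitArc_iff {x : M} {t a : ℝ} :
    HasVariation f (orbitArc φ x t) a ↔ a = orbitVar φ f x t :=
  ⟨fun h => hasVariation_unique h (hasVariation_orbitArc x t),
    fun h => h ▸ hasVariation_orbitArc x t⟩

end Lifts

/-! ### Local sections and box maps -/

section Sections

theorem eventually_abs_lt_of_continuousAt {X : Type*} [TopologicalSpace X] {g : X → ℝ} {x : X}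
    (hg : ContinuousAt g x) (h0 : g x = 0) {r : ℝ} (hr : 0 < r) : ∀ᶠ y in 𝓝 x, |g y| < r := by
  filter_upwards [hg.eventually_mem (Metric.ball_mem_nhds (g x) hr)] with y hy
  simpa [h0] using hy

theorem exists_pos_of_eventually {P : ℝ → Prop} (h : ∀ᶠ s in 𝓝 (0 : ℝ), P s) :
    ∃ r > 0, ∀ s, |s| ≤ r → P s := by
  obtain ⟨r, hr, h⟩ := Metric.nhds_basis_closedBall.eventually_iff.1 h
  exact ⟨r, hr, fun s hs => h (by simpa using hs)⟩

/-- The representative in `[-1/2, 1/2)` of a point of the circle. -/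
noncomputable def signedRep (c : UnitAddCircle) : ℝ := AddCircle.equivIco 1 (-(1 / 2)) c

theorem coe_signedRep (c : UnitAddCircle) : (signedRep c : UnitAddCircle) = c :=
  AddCircle.coe_equivIco

theorem signedRep_mem (c : UnitAddCircle) : signedRep c ∈ Ico (-(1 / 2) : ℝ) (1 / 2) := by
  have := (AddCircle.equivIco 1 (-(1 / 2) : ℝ) c).2
  norm_num at this ⊢
  exact this

theorem signedRep_coe {r : ℝ} (h : r ∈ Ico (-(1 / 2) : ℝ) (1 / 2)) :
    signedRep (r : UnitAddCircle) = r := by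
  unfold signedRep
  rw [AddCircle.equivIco_coe_eq]
  norm_num at h ⊢
  exact h

theorem signedRep_zero : signedRep 0 = 0 := by
  have := signedRep_coe (r := 0) (by norm_num)
  simpa using this

theorem continuousAt_signedRep_zero : ContinuousAt signedRep 0 := by
  refine continuousAt_subtype_val.comp (AddCircle.continuousAt_equivIco 1 _ ?_)
  intro h
  obtain ⟨n, hn⟩ := coe_circle_eq_zero_iff.1 h.symm
  have h1 : (-1 : ℝ) < n := by rw [← hn]; norm_num
  have h2 : (n : ℝ) < 0 := by rw [← hn]; norm_num
  have h1' : -1 < n := by exact_mod_cast h1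
  have h2' : n < 0 := by exact_mod_cast h2
  omega

/-- The representative in `[0, 1)` of a point of the circle. -/
noncomputable def unitRep (c : UnitAddCircle) : ℝ := AddCircle.equivIco 1 0 c

theorem coe_unitRep (c : UnitAddCircle) : (unitRep c : UnitAddCircle) = c :=
  AddCircle.coe_equivIco

theorem unitRep_coe {r : ℝ} (h : r ∈ Ico (0 : ℝ) 1) : unitRep (r : UnitAddCircle) = r := by
  unfold unitRep
  rw [AddCircle.equivIco_coe_eq]
  simpa using h

theorem unitRep_mem (c : UnitAddCircle) : unitRep c ∈ Ico (0 : ℝ) 1 :=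
  have h := (AddCircle.equivIco 1 (0 : ℝ) c).2
  ⟨h.1, h.2.trans_eq (zero_add 1)⟩

theorem unitRep_zero : unitRep 0 = 0 := by
  have := unitRep_coe (r := 0) (by norm_num)
  simpa using this

theorem continuousAt_unitRep {c : UnitAddCircle} (h : c ≠ 0) : ContinuousAt unitRep c :=
  continuousAt_subtype_val.comp (AddCircle.continuousAt_equivIco 1 0 (by simpa using h))

theorem eq_zero_of_abs_lt_one {r : ℝ} (h : (r : UnitAddCircle) = 0) (h1 : |r| < 1) : r = 0 := by
  obtain ⟨n, rfl⟩ := coe_circle_eq_zero_iff.1 h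
  have : |n| < 1 := by exact_mod_cast h1
  simp [Int.abs_lt_one_iff.1 this]

variable {M : Type*} [TopologicalSpace M]

theorem flow_neg_apply (φ : Flow ℝ M) (t : ℝ) (x : M) : φ (-t) (φ t x) = x := by
  rw [← φ.map_add]; simp

/-- No orbit arc of length in `(0, r]` starts and ends in `S`. -/
def NoReturn (φ : Flow ℝ M) (S : Set M) (r : ℝ) : Prop :=
  ∀ x ∈ S, ∀ s : ℝ, |s| ≤ r → φ s x ∈ S → s = 0

/-- Every orbit that comes close to a point of `S` crosses `S` soon. -/
def IsLocalSection (φ : Flow ℝ M) (S : Set M) : Prop :=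
  ∀ x ∈ S, ∀ r > 0, ∀ᶠ y in 𝓝 x, ∃ s : ℝ, |s| < r ∧ φ s y ∈ S

/-- `S` is the zero set of `f`, and `f` increases through zero along the orbits that meet `S`. -/
def CrossesPositively (φ : Flow ℝ M) (S : Set M) (f : C(M, UnitAddCircle)) : Prop :=
  f ⁻¹' {0} = S ∧ ∀ x ∈ S, ∃ δ : ℝ, 0 < δ ∧
      (∀ s ∈ Ioo 0 δ, ∃ r ∈ Ioo (0 : ℝ) (1 / 2), f (φ s x) = (r : UnitAddCircle)) ∧
      (∀ s ∈ Ioo (-δ) 0, ∃ r ∈ Ioo (-(1 / 2) : ℝ) 0, f (φ s x) = (r : UnitAddCircle))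

variable {φ : Flow ℝ M} {S : Set M}

theorem NoReturn.mono {r r' : ℝ} (h : NoReturn φ S r) (hr : r' ≤ r) : NoReturn φ S r' :=
  fun x hx s hs => h x hx s (hs.trans hr)

/-- For small times both ends of an orbit arc lie in one of the neighbourhoods given by
transversality; compactness makes the time uniform. -/
theorem exists_noReturn (hS : IsCompact S) (h : IsTransverse φ S) : ∃ r > 0, NoReturn φ S r := by
  have : ∀ᶠ s in 𝓝 (0 : ℝ), ∀ x ∈ S, x ∈ S → φ s x ∈ S → s = 0 := by
    refine hS.eventually_forall_of_forall_eventually fun x hx => ?_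
    obtain ⟨t, ht, U, hUS, hU, hUt⟩ := h x hx
    obtain ⟨W, hW, hWU⟩ := mem_nhdsWithin_iff_exists_mem_nhds_inter.1 hU
    have h1 : ∀ᶠ z : ℝ × M in 𝓝 (0, x), φ z.1 z.2 ∈ W := by
      have hc : Continuous fun z : ℝ × M => φ z.1 z.2 := φ.continuous continuous_fst continuous_snd
      exact hc.continuousAt.eventually_mem (by simpa using hW)
    have h2 : ∀ᶠ z : ℝ × M in 𝓝 (0, x), z.2 ∈ W := continuousAt_snd.eventually_mem hW
    have h3 : ∀ᶠ z : ℝ × M in 𝓝 (0, x), |z.1| < t :=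
      eventually_abs_lt_of_continuousAt continuousAt_fst rfl ht
    filter_upwards [h1, h2, h3] with z hz1 hz2 hz3 hzS hzS'
    exact hUt z.2 (hWU ⟨hz2, hzS⟩) z.1 (abs_le.1 hz3.le) (hWU ⟨hz1, hzS'⟩)
  obtain ⟨r, hr, h⟩ := exists_pos_of_eventually this
  exact ⟨r, hr, fun x hx s hs => h s hs x hx hx⟩

theorem continuous_box (φ : Flow ℝ M) (S : Set M) (ε : ℝ) :
    Continuous (fun p : S × Icc (-ε) ε => φ p.2 (p.1 : M)) :=
  φ.continuous (by fun_prop) (by fun_prop)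

/-- Two box coordinates of one point differ in time by at most 2ε, so a failure of injectivity is a
return to `S` within that time. Injectivity suffices, the parameter space being compact. -/
theorem isEmbeddedBox_iff [T2Space M] (hS : IsCompact S) {ε : ℝ} :
    IsEmbeddedBox φ S ε ↔ NoReturn φ S (2 * ε) := by
  constructor
  · intro h x hx s hs hsx
    have hs' := abs_le.1 hs
    have := @h.injective (⟨x, hx⟩, ⟨s / 2, by constructor <;> linarith⟩)
      (⟨φ s x, hsx⟩, ⟨-(s / 2), by constructor <;> linarith⟩) (by
        change φ (s / 2) x = φ (-(s / 2)) (φ s x)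
        rw [← φ.map_add]; congr 1; ring)
    have := congrArg (fun p => ((p.2 : Icc (-ε) ε) : ℝ)) this
    simp only at this
    linarith
  · intro h
    have : CompactSpace S := isCompact_iff_compactSpace.1 hS
    refine ((continuous_box φ S ε).isClosedEmbedding ?_).isEmbedding
    rintro ⟨⟨x, hx⟩, ⟨s, hs⟩⟩ ⟨⟨y, hy⟩, ⟨t, ht⟩⟩ hxy
    change φ s x = φ t y at hxy
    have e : φ (s - t) x = y := by
      rw [sub_eq_neg_add, φ.map_add, hxy, flow_neg_apply]
    have h0 := h x hx (s - t) (by rw [abs_le]; constructor <;> linarith [hs.1, hs.2, ht.1, ht.2])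
      (by rw [e]; exact hy)
    have : s = t := by linarith
    subst this
    rw [sub_self, φ.map_zero_apply] at e
    subst e
    rfl

/-- A point near φ_t(x) flows back by t to a point near x, and then meets `S` with a delay below ε -
|t|. -/
theorem IsLocalSection.isOpen_box (h : IsLocalSection φ S) (ε : ℝ) :
    IsOpen {y | ∃ x ∈ S, ∃ t : ℝ, |t| < ε ∧ φ t x = y} := by
  rw [isOpen_iff_mem_nhds]
  rintro y ⟨x, hx, t, ht, rfl⟩
  have h1 := h x hx (ε - |t|) (by linarith)
  have hc : ContinuousAt (φ (-t)) (φ t x) := (φ.continuous_toFun _).continuousAt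
  have h2 : ∀ᶠ y in 𝓝 (φ t x), ∃ s : ℝ, |s| < ε - |t| ∧ φ s (φ (-t) y) ∈ S := by
    refine hc.eventually (p := fun y => ∃ s : ℝ, |s| < ε - |t| ∧ φ s y ∈ S) ?_
    rwa [flow_neg_apply]
  filter_upwards [h2] with y ⟨s, hs, hsy⟩
  refine ⟨_, hsy, t - s, ?_, ?_⟩
  · calc |t - s| ≤ |t| + |s| := abs_sub _ _
      _ < ε := by linarith
  · rw [← φ.map_add, ← φ.map_add]; simp

/-- The box formula on the closed box and the value 0 off the open box are glued over two closed
sets. They agree on the overlap because t = -ε and t = ε give the integers 0 and 1. -/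
theorem exists_boxMap [T2Space M] (hS : IsCompact S) {ε : ℝ} (hε : 0 < ε)
    (hn : NoReturn φ S (2 * ε)) (hl : IsLocalSection φ S) :
    ∃ F : C(M, UnitAddCircle), IsBoxMap φ S ε F := by
  classical
  have he : IsEmbeddedBox φ S ε := (isEmbeddedBox_iff hS).2 hn
  have : CompactSpace S := isCompact_iff_compactSpace.1 hS
  set b := fun p : S × Icc (-ε) ε => φ p.2 (p.1 : M) with hb
  let F : M → UnitAddCircle := fun y => if h : ∃ p, b p = y then
    (((h.choose.2 + ε) / (2 * ε) : ℝ) : UnitAddCircle) else 0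
  have hFb : ∀ p, F (b p) = (((p.2 + ε) / (2 * ε) : ℝ) : UnitAddCircle) := by
    intro p
    have h : ∃ q, b q = b p := ⟨p, rfl⟩
    have hp : h.choose = p := he.injective h.choose_spec
    simp only [F, dif_pos h]
    rw [hp]
  have hF0 : ∀ y, y ∉ range b → F y = 0 := by
    intro y hy
    exact dif_neg hy
  have hcl : IsClosed (range b) := (isCompact_range (continuous_box φ S ε)).isClosed
  have h1 : ContinuousOn F (range b) := by
    rw [continuousOn_iff_continuous_domRestrict]
    have : (range b).domRestrict F = (fun p : S × Icc (-ε) ε =>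
        (((p.2 + ε) / (2 * ε) : ℝ) : UnitAddCircle)) ∘ he.toHomeomorph.symm := by
      funext y
      obtain ⟨p, rfl⟩ := he.toHomeomorph.surjective y
      simp only [Function.comp, Homeomorph.symm_apply_apply]
      exact hFb p
    rw [this]
    exact (continuous_coe_circle.comp (by fun_prop)).comp he.toHomeomorph.symm.continuous
  have h2 : ContinuousOn F {y | ∃ x ∈ S, ∃ t : ℝ, |t| < ε ∧ φ t x = y}ᶜ := by
    refine (continuousOn_const (c := (0 : UnitAddCircle))).congr fun y hy => ?_
    by_cases hyb : y ∈ range b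
    · obtain ⟨⟨⟨x, hx⟩, ⟨t, ht⟩⟩, rfl⟩ := hyb
      have : ¬ |t| < ε := fun h => hy ⟨x, hx, t, h, rfl⟩
      rw [hFb]
      change (((t + ε) / (2 * ε) : ℝ) : UnitAddCircle) = 0
      rcases le_abs.1 (not_lt.1 this) with h | h
      · rw [le_antisymm ht.2 h, coe_circle_eq_zero_iff]
        exact ⟨1, by field_simp; norm_num⟩
      · have : t = -ε := by linarith [ht.1]
        simp [this]
    · exact hF0 y hyb
  have h3 := h1.union_of_isClosed h2 hcl (hl.isOpen_box ε).isClosed_compl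
  have h4 : range b ∪ {y | ∃ x ∈ S, ∃ t : ℝ, |t| < ε ∧ φ t x = y}ᶜ = univ := by
    refine eq_univ_of_forall fun y => ?_
    by_cases hy : y ∈ {y | ∃ x ∈ S, ∃ t : ℝ, |t| < ε ∧ φ t x = y}
    · obtain ⟨x, hx, t, ht, rfl⟩ := hy
      exact Or.inl ⟨(⟨x, hx⟩, ⟨t, abs_le.1 ht.le⟩), rfl⟩
    · exact Or.inr hy
  rw [h4, continuousOn_univ] at h3
  refine ⟨⟨F, h3⟩, fun x hx t ht => hFb (⟨x, hx⟩, ⟨t, ht⟩), fun y hy => hF0 y ?_⟩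
  rintro ⟨⟨⟨x, hx⟩, ⟨t, ht⟩⟩, rfl⟩
  exact hy x hx t ht rfl

/-! ### Maps that cross zero positively along a local section -/

variable {f : C(M, UnitAddCircle)}

theorem CrossesPositively.mem_iff (h : CrossesPositively φ S f) {x : M} : x ∈ S ↔ f x = 0 := by
  rw [← h.1]; rfl

theorem CrossesPositively.exists_orbitVar (h : CrossesPositively φ S f) {x : M} (hx : x ∈ S) :
    ∃ δ > 0, ∀ s, 0 < s → s < δ → 0 < orbitVar φ f x s ∧ orbitVar φ f x (-s) < 0 := by
  obtain ⟨δ, hδ, h1, h2⟩ := h.2 x hx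
  have hc : ContinuousAt (orbitVar φ f x) 0 := (continuous_orbitVar_right φ f x).continuousAt
  have hsm : ∀ᶠ s in 𝓝 (0 : ℝ), |orbitVar φ f x s| < 1 / 2 :=
    eventually_abs_lt_of_continuousAt hc (orbitVar_zero φ f x) (by norm_num)
  obtain ⟨r, hr, hsm⟩ := exists_pos_of_eventually hsm
  have hfx := h.mem_iff.1 hx
  refine ⟨min δ r, lt_min hδ hr, fun s hs0 hs => ⟨?_, ?_⟩⟩
  · obtain ⟨a, ha, hfa⟩ := h1 s ⟨hs0, hs.trans_le (min_le_left _ _)⟩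
    have hV := abs_lt.1 (hsm s (by rw [abs_of_pos hs0]; exact hs.le.trans (min_le_right _ _)))
    have := coe_orbitVar φ f x s
    rw [hfx, hfa, sub_zero] at this
    have := sub_eq_zero.2 this
    rw [← AddCircle.coe_sub] at this
    have := eq_zero_of_abs_lt_one this (by rw [abs_lt]; constructor <;> linarith [ha.1, ha.2])
    linarith [ha.1]
  · obtain ⟨a, ha, hfa⟩ := h2 (-s) ⟨by linarith [hs.trans_le (min_le_left _ _)], by linarith⟩
    have hV := abs_lt.1 (hsm (-s) (by
      rw [abs_neg, abs_of_pos hs0]; exact hs.le.trans (min_le_right _ _)))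
    have := coe_orbitVar φ f x (-s)
    rw [hfx, hfa, sub_zero] at this
    have := sub_eq_zero.2 this
    rw [← AddCircle.coe_sub] at this
    have := eq_zero_of_abs_lt_one this (by rw [abs_lt]; constructor <;> linarith [ha.1, ha.2])
    linarith [ha.2]

/-- The local lift of f is negative shortly before `S` and positive shortly after. Both signs
persist on nearby orbits, which therefore meet the zero set. -/
theorem CrossesPositively.isLocalSection (h : CrossesPositively φ S f) : IsLocalSection φ S := by
  intro x hx r hr
  obtain ⟨δ, hδ, hV⟩ := h.exists_orbitVar hx
  set s := min δ r / 2
  have hmin : 0 < min δ r := lt_min hδ hr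
  have hs0 : 0 < s := by positivity
  have hsδ : s < δ := by have := min_le_left δ r; simp only [s]; linarith
  have hsr : s < r := by have := min_le_right δ r; simp only [s]; linarith
  obtain ⟨hp, hm⟩ := hV s hs0 hsδ
  have hfx := h.mem_iff.1 hx
  have hcont : ∀ t, ContinuousAt (fun y => signedRep (f y) + orbitVar φ f y t) x := by
    intro t
    refine ContinuousAt.add ?_ ?_
    · exact ContinuousAt.comp (g := signedRep) (by rw [hfx]; exact continuousAt_signedRep_zero)
        f.continuous.continuousAt
    · exact ((continuous_orbitVar φ f).comp
        (by fun_prop : Continuous fun y : M => (y, t))).continuousAt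
  have e1 : ∀ᶠ y in 𝓝 x, 0 < signedRep (f y) + orbitVar φ f y s :=
    (hcont s).eventually (lt_mem_nhds (by simpa [hfx, signedRep_zero] using hp))
  have e2 : ∀ᶠ y in 𝓝 x, signedRep (f y) + orbitVar φ f y (-s) < 0 :=
    (hcont (-s)).eventually (gt_mem_nhds (by simpa [hfx, signedRep_zero] using hm))
  filter_upwards [e1, e2] with y h1 h2
  obtain ⟨t, ht, hty⟩ := intermediate_value_Icc (f := fun t => signedRep (f y) + orbitVar φ f y t)
    (a := -s) (b := s) (by linarith)
    (continuous_const.add (continuous_orbitVar_right φ f y)).continuousOn ⟨h2.le, h1.le⟩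
  refine ⟨t, (abs_le.2 ht).trans_lt hsr, h.mem_iff.2 ?_⟩
  have := congrArg (fun r : ℝ => (r : UnitAddCircle)) hty
  simp only [AddCircle.coe_add, coe_signedRep, coe_orbitVar, AddCircle.coe_zero] at this
  simpa using this

/-- The sign is known for very short times; a later change would produce a zero of f, that is, a
forbidden return to `S`. -/
theorem CrossesPositively.orbitVar_pos (h : CrossesPositively φ S f) {r : ℝ}
    (hr : NoReturn φ S r) {x : M} (hx : x ∈ S) {s : ℝ} (hs : 0 < s) (hsr : s ≤ r) :
    0 < orbitVar φ f x s ∧ orbitVar φ f x (-s) < 0 := by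
  obtain ⟨δ, hδ, hV⟩ := h.exists_orbitVar hx
  set a := min δ s / 2 with ha
  have hmin : 0 < min δ s := lt_min hδ hs
  have ha0 : 0 < a := by positivity
  have haδ : a < δ := by have := min_le_left δ s; simp only [a]; linarith
  have has : a ≤ s := by have := min_le_right δ s; simp only [a]; linarith
  obtain ⟨h1, h2⟩ := hV a ha0 haδ
  have key : ∀ t, orbitVar φ f x t = 0 → |t| ≤ r → t = 0 := by
    intro t ht htr
    refine hr x hx t htr (h.mem_iff.2 ?_)
    have := coe_orbitVar φ f x t
    rw [ht, h.mem_iff.1 hx] at this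
    simpa using this.symm
  have hc := continuous_orbitVar_right φ f x
  constructor
  · by_contra hneg
    obtain ⟨t, ht, ht0⟩ := intermediate_value_Icc' has hc.continuousOn
      (show (0 : ℝ) ∈ Icc _ _ from ⟨not_lt.1 hneg, h1.le⟩)
    have := key t ht0 (by rw [abs_of_pos (by linarith [ht.1])]; linarith [ht.2])
    linarith [ht.1]
  · by_contra hneg
    obtain ⟨t, ht, ht0⟩ := intermediate_value_Icc' (neg_le_neg has) hc.continuousOn
      (show (0 : ℝ) ∈ Icc _ _ from ⟨h2.le, not_lt.1 hneg⟩)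
    have := key t ht0 (by rw [abs_of_neg (by linarith [ht.2])]; linarith [ht.1])
    linarith [ht.2]

/-- Two maps that cross zero positively along the same local section differ by a real map. -/
theorem CrossesPositively.exists_real {f' : C(M, UnitAddCircle)} (h : CrossesPositively φ S f)
    (h' : CrossesPositively φ S f') (hS : IsCompact S) {r : ℝ} (hr0 : 0 < r)
    (hr : NoReturn φ S r) :
    ∃ u : C(M, ℝ), (∀ x, f' x = f x + (u x : UnitAddCircle)) ∧ ∀ x, f x = f' x → u x = 0 := by
  -- Each representative in [0,1) jumps across `S`, from near 1 before it to 0 on it, and the jumps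
  -- cancel because both maps cross in the same direction.
  have hcont : Continuous (fun x => unitRep (f' x) - unitRep (f x)) := by
    rw [continuous_iff_continuousAt]
    intro x
    by_cases hx : x ∈ S
    · have hsmall : ∀ g : C(M, UnitAddCircle), ∀ η > 0,
          ∀ᶠ s in 𝓝 (0 : ℝ), ∀ x ∈ S, |orbitVar φ g x s| < η := by
        intro g η hη
        refine hS.eventually_forall_of_forall_eventually fun y hy => ?_
        have hc : ContinuousAt (fun z : ℝ × M => orbitVar φ g z.2 z.1) (0, y) :=
          ((continuous_orbitVar φ g).comp continuous_swap).continuousAt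
        exact eventually_abs_lt_of_continuousAt hc (orbitVar_zero φ g y) hη
      rw [Metric.continuousAt_iff']
      intro η hη
      have hη' : 0 < min (η / 2) (1 / 2) := by positivity
      obtain ⟨ρ, hρ, hV⟩ := exists_pos_of_eventually
        ((hsmall f _ hη').and (hsmall f' _ hη'))
      filter_upwards [h.isLocalSection x hx (min ρ r) (lt_min hρ hr0)] with y ⟨s, hs, hsS⟩
      have hsρ : |-s| ≤ ρ := by rw [abs_neg]; exact hs.le.trans (min_le_left _ _)
      have hsr : |-s| ≤ r := by rw [abs_neg]; exact hs.le.trans (min_le_right _ _)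
      obtain ⟨z, hz, t, htρ, htr, hy⟩ : ∃ z ∈ S, ∃ t, |t| ≤ ρ ∧ |t| ≤ r ∧ y = φ t z :=
        ⟨_, hsS, -s, hsρ, hsr, (flow_neg_apply φ s y).symm⟩
      have v1 := abs_lt.1 (((hV t htρ).1 z hz).trans_le (min_le_right _ _))
      have v1' := abs_lt.1 (((hV t htρ).1 z hz).trans_le (min_le_left _ _))
      have v2 := abs_lt.1 (((hV t htρ).2 z hz).trans_le (min_le_right _ _))
      have v2' := abs_lt.1 (((hV t htρ).2 z hz).trans_le (min_le_left _ _))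
      have c1 : f y = (orbitVar φ f z t : UnitAddCircle) := by
        rw [coe_orbitVar, h.mem_iff.1 hz, hy, sub_zero]
      have c2 : f' y = (orbitVar φ f' z t : UnitAddCircle) := by
        rw [coe_orbitVar, h'.mem_iff.1 hz, hy, sub_zero]
      rw [h.mem_iff.1 hx, h'.mem_iff.1 hx, unitRep_zero, Real.dist_eq, sub_zero, sub_zero,
        abs_lt]
      rcases lt_trichotomy t 0 with ht | ht | ht
      · have p1 := (h.orbitVar_pos hr hz (neg_pos.2 ht) (by rwa [abs_of_neg ht] at htr)).2
        have p2 := (h'.orbitVar_pos hr hz (neg_pos.2 ht) (by rwa [abs_of_neg ht] at htr)).2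
        rw [neg_neg] at p1 p2
        have a1 : f y = ((orbitVar φ f z t + 1 : ℝ) : UnitAddCircle) := by
          rw [c1, coe_circle_eq_iff]; exact ⟨-1, by simp⟩
        have a2 : f' y = ((orbitVar φ f' z t + 1 : ℝ) : UnitAddCircle) := by
          rw [c2, coe_circle_eq_iff]; exact ⟨-1, by simp⟩
        rw [a1, a2, unitRep_coe ⟨by linarith, by linarith⟩, unitRep_coe ⟨by linarith, by linarith⟩]
        constructor <;> linarith
      · rw [c1, c2, ht, orbitVar_zero, orbitVar_zero]
        simpa using hη
      · have p1 := (h.orbitVar_pos hr hz ht (by rwa [abs_of_pos ht] at htr)).1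
        have p2 := (h'.orbitVar_pos hr hz ht (by rwa [abs_of_pos ht] at htr)).1
        rw [c1, c2, unitRep_coe ⟨by linarith, by linarith⟩, unitRep_coe ⟨by linarith, by linarith⟩]
        constructor <;> linarith
    · exact ((continuousAt_unitRep fun e => hx (h'.mem_iff.2 e)).comp
        f'.continuous.continuousAt).sub ((continuousAt_unitRep fun e => hx (h.mem_iff.2 e)).comp
        f.continuous.continuousAt)
  refine ⟨⟨_, hcont⟩, fun x => ?_, fun x hx => ?_⟩
  · simp only [ContinuousMap.coe_mk, AddCircle.coe_sub, coe_unitRep]; abel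
  · simp [hx]

/-- `F - 1/2` crosses zero positively along the middle section of the box of `F`. -/
theorem IsBoxMap.crossesPositively {ε : ℝ} (hε : 0 < ε) {F : C(M, UnitAddCircle)}
    (hF : IsBoxMap φ S ε F) :
    CrossesPositively φ S (F + ContinuousMap.const M ((1 / 2 : ℝ) : UnitAddCircle)) := by
  have hbox : ∀ x ∈ S, ∀ t ∈ Icc (-ε) ε,
      (F + ContinuousMap.const M ((1 / 2 : ℝ) : UnitAddCircle)) (φ t x) =
        ((t / (2 * ε) : ℝ) : UnitAddCircle) := by
    intro x hx t ht
    rw [ContinuousMap.add_apply, hF.1 x hx t ht, ContinuousMap.const_apply, ← AddCircle.coe_add,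
      coe_circle_eq_iff]
    exact ⟨1, by field_simp; push_cast; ring⟩
  refine ⟨?_, fun x hx => ⟨ε, hε, fun s hs => ⟨s / (2 * ε), ⟨?_, ?_⟩, hbox x hx s ?_⟩,
    fun s hs => ⟨s / (2 * ε), ⟨?_, ?_⟩, hbox x hx s ?_⟩⟩⟩
  · ext y
    rw [mem_preimage, mem_singleton_iff]
    constructor
    · intro h
      by_cases hy : ∃ x ∈ S, ∃ t ∈ Icc (-ε) ε, φ t x = y
      · obtain ⟨x, hx, t, ht, rfl⟩ := hy
        rw [hbox x hx t ht] at h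
        have h1 := eq_zero_of_abs_lt_one h (by
          rw [abs_div, abs_of_pos (by positivity : (0 : ℝ) < 2 * ε), div_lt_one (by positivity)]
          linarith [abs_le.2 ht])
        have : t = 0 := by
          rcases div_eq_zero_iff.1 h1 with h | h
          · exact h
          · linarith
        rw [this, φ.map_zero_apply]; exact hx
      · push Not at hy
        rw [ContinuousMap.add_apply, hF.2 y hy, zero_add, ContinuousMap.const_apply] at h
        have := eq_zero_of_abs_lt_one h (by norm_num [abs_lt])
        norm_num at this
    · intro h
      have := hbox y h 0 ⟨by linarith, hε.le⟩
      rw [φ.map_zero_apply] at this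
      rw [this]; simp
  · have := hs.1; positivity
  · rw [div_lt_div_iff₀ (by positivity) (by norm_num)]; linarith [hs.2]
  · exact ⟨by linarith [hs.1], hs.2.le⟩
  · rw [lt_div_iff₀ (by positivity)]; linarith [hs.1]
  · exact div_neg_of_neg_of_pos hs.2 (by positivity)
  · exact ⟨hs.1.le, by linarith [hs.2]⟩

/-- A constant rotation does not change the class of a map. -/
theorem classOf_add_const (f : C(M, UnitAddCircle)) (r : ℝ) :
    classOf (f + ContinuousMap.const M (r : UnitAddCircle)) = classOf f :=
  (classOf_eq_iff.2 ⟨ContinuousMap.const M r, fun x => by simp⟩).symm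

/-- After a half-turn F crosses zero along `S`, as does the map that defines the class of `S`; such
maps differ by a real function. -/
theorem IsBoxMap.classOf_eq {α : H1 M} (hc : HasClass φ S α) (hS : IsCompact S) {ε : ℝ}
    (hε : 0 < ε) (hn : NoReturn φ S (2 * ε)) {F : C(M, UnitAddCircle)} (hF : IsBoxMap φ S ε F) :
    classOf F = α := by
  obtain ⟨f, hf, hcr⟩ := hc
  obtain ⟨u, hu, -⟩ := CrossesPositively.exists_real (f := f) hcr (hF.crossesPositively hε) hS
    (by positivity) hn
  rw [← classOf_add_const F (1 / 2), ← classOf_eq_iff.2 ⟨u, hu⟩, hf]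

end Sections

/-! ### Maps that increase along the flow -/

section Monotone

variable {M : Type*} [TopologicalSpace M] {φ : Flow ℝ M} {f : C(M, UnitAddCircle)}

/-- `f` strictly increases along the flow at the points where it does not vanish. -/
def IncreasesOffZero (φ : Flow ℝ M) (f : C(M, UnitAddCircle)) : Prop :=
  ∀ x, f x ≠ 0 → ∀ δ > 0, ∃ t : ℝ, 0 < t ∧ t < δ ∧ 0 < orbitVar φ f x t

/-- If the lift decreased, it would cross an irrational level downwards. At the last time it is at
least that level f is not 0, so the lift rises just afterwards, a contradiction. -/
theorem IncreasesOffZero.orbitVar_nonneg (h : IncreasesOffZero φ f) (x : M) {t : ℝ} (ht : 0 ≤ t) :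
    0 ≤ orbitVar φ f x t := by
  by_contra hneg
  push Not at hneg
  obtain ⟨w, hw⟩ := QuotientAddGroup.mk_surjective (f x)
  set u : ℝ → ℝ := fun s => w + orbitVar φ f x s with hu
  have huc : Continuous u := continuous_const.add (continuous_orbitVar_right φ f x)
  have hu0 : u 0 = w := by simp [hu, orbitVar_zero]
  obtain ⟨c, hc, hc1, hc2⟩ := exists_irrational_btwn (show u t < u 0 by
    rw [hu0]; simp only [hu]; linarith)
  have hA : IsCompact {s ∈ Icc 0 t | c ≤ u s} :=
    isCompact_Icc.inter_right (isClosed_le continuous_const huc)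
  have hAm := hA.sSup_mem ⟨0, ⟨le_refl _, ht⟩, hc2.le⟩
  set s := sSup {s ∈ Icc 0 t | c ≤ u s} with hs
  have hle : ∀ r, r ∈ Icc 0 t → c ≤ u r → r ≤ s := fun r hr hcr => le_csSup hA.bddAbove ⟨hr, hcr⟩
  obtain ⟨r, hr, hcr⟩ := intermediate_value_Icc' hAm.1.2 huc.continuousOn ⟨hc1.le, hAm.2⟩
  have hrs : r = s := le_antisymm (hle r ⟨hAm.1.1.trans hr.1, hr.2⟩ hcr.ge) hr.1
  rw [hrs] at hcr
  have hst : s < t := by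
    refine lt_of_le_of_ne hAm.1.2 fun e => ?_
    rw [e] at hcr; linarith
  have hne : f (φ s x) ≠ 0 := by
    intro h0
    have h1 := coe_orbitVar φ f x s
    rw [h0, zero_sub, ← hw] at h1
    have h2 : ((u s : ℝ) : UnitAddCircle) = 0 := by
      simp only [hu, AddCircle.coe_add, h1]; exact add_neg_cancel _
    rw [hcr] at h2
    obtain ⟨n, hn⟩ := coe_circle_eq_zero_iff.1 h2
    exact hc ⟨n, by rw [hn]; simp⟩
  obtain ⟨τ, hτ, hτt, hV⟩ := h _ hne (t - s) (by linarith)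
  have hadd := orbitVar_add (φ := φ) (f := f) x s τ
  have := hle (s + τ) ⟨by linarith [hAm.1.1], by linarith⟩ (by
    rw [← hcr]; simp only [hu]; linarith)
  linarith

theorem IncreasesOffZero.orbitVar_mono (h : IncreasesOffZero φ f) (x : M) :
    Monotone (orbitVar φ f x) := by
  intro s t hst
  have := orbitVar_add (φ := φ) (f := f) x s (t - s)
  rw [add_sub_cancel] at this
  have := h.orbitVar_nonneg (φ s x) (sub_nonneg.2 hst)
  linarith

theorem IncreasesOffZero.orbitVar_pos (h : IncreasesOffZero φ f) {x : M} (hx : f x ≠ 0) {t : ℝ}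
    (ht : 0 < t) : 0 < orbitVar φ f x t := by
  obtain ⟨s, hs, hst, hV⟩ := h x hx t ht
  exact hV.trans_le (h.orbitVar_mono x hst.le)

/-- The forward statement is applied at a slightly earlier point of the orbit, where f is still
non-zero by continuity. -/
theorem IncreasesOffZero.orbitVar_neg (h : IncreasesOffZero φ f) {x : M} (hx : f x ≠ 0) {t : ℝ}
    (ht : t < 0) : orbitVar φ f x t < 0 := by
  have hc : ContinuousAt (fun s => f (φ s x)) 0 :=
    (f.continuous.comp (flow_orbit_continuous φ x)).continuousAt
  have h1 : ∀ᶠ s in 𝓝 (0 : ℝ), f (φ s x) ≠ 0 := by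
    refine hc.eventually_ne ?_
    simpa [φ.map_zero_apply] using hx
  obtain ⟨r, hr, hne⟩ := exists_pos_of_eventually h1
  have hs : |max t (-r)| ≤ r := abs_le.2 ⟨le_max_right _ _, max_le (by linarith) (by linarith)⟩
  have hs0 : max t (-r) < 0 := max_lt ht (by linarith)
  have h2 := h.orbitVar_pos (hne _ hs) (neg_pos.2 hs0)
  have h3 := orbitVar_add (φ := φ) (f := f) x (max t (-r)) (-max t (-r))
  rw [add_neg_cancel, orbitVar_zero] at h3
  have := h.orbitVar_mono x (le_max_left t (-r))
  linarith

theorem coe_add_orbitVar (x : M) {w : ℝ} (hw : (w : UnitAddCircle) = f x)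
    (t : ℝ) : ((w + orbitVar φ f x t : ℝ) : UnitAddCircle) = f (φ t x) := by
  rw [AddCircle.coe_add, coe_orbitVar, hw]; abel

variable {S : Set M} {ε : ℝ} {F : C(M, UnitAddCircle)}

theorem IsBoxMap.exists_of_ne_zero (hε : 0 < ε) (hF : IsBoxMap φ S ε F) {x : M} (hx : F x ≠ 0) :
    ∃ y ∈ S, ∃ r ∈ Ioo (-ε) ε, x = φ r y := by
  by_contra hno
  push Not at hno
  apply hx
  by_cases hb : ∃ y ∈ S, ∃ t ∈ Icc (-ε) ε, φ t y = x
  · obtain ⟨y, hy, t, ht, rfl⟩ := hb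
    rw [hF.1 y hy t ht, coe_circle_eq_zero_iff]
    rcases eq_or_lt_of_le ht.1 with h1 | h1
    · exact ⟨0, by simp [← h1]⟩
    · rcases eq_or_lt_of_le ht.2 with h2 | h2
      · exact ⟨1, by rw [h2]; field_simp; norm_num⟩
      · exact absurd rfl (hno y hy t ⟨h1, h2⟩)
  · push Not at hb
    exact hF.2 x hb

theorem IsBoxMap.orbitVar_eq (hF : IsBoxMap φ S ε F) {y : M} (hy : y ∈ S) {r : ℝ}
    (hr : r ∈ Ioo (-ε) ε) {t : ℝ} (ht : t ∈ Icc 0 (ε - r)) :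
    orbitVar φ F (φ r y) t = t / (2 * ε) := by
  have := orbitVar_eq_of_lift (φ := φ) (f := F) (x := φ r y) (s := Icc 0 (ε - r))
    isPreconnected_Icc ⟨le_refl _, by linarith [hr.2]⟩
    (u := fun t => (t + r + ε) / (2 * ε)) (by fun_prop) (fun s hs => by
      rw [← φ.map_add, hF.1 y hy (s + r) ⟨by linarith [hs.1, hr.1], by linarith [hs.2]⟩]) ht
  rw [this]; ring

theorem IsBoxMap.increasesOffZero (hε : 0 < ε) (hF : IsBoxMap φ S ε F) :
    IncreasesOffZero φ F := by
  intro x hx δ hδ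
  obtain ⟨y, hy, r, hr, rfl⟩ := hF.exists_of_ne_zero hε hx
  have h1 : 0 < ε - r := by linarith [hr.2]
  have hm : 0 < min δ (ε - r) := lt_min hδ h1
  have hm1 := min_le_left δ (ε - r)
  have hm2 := min_le_right δ (ε - r)
  refine ⟨min δ (ε - r) / 2, by positivity, by linarith, ?_⟩
  rw [hF.orbitVar_eq hy hr ⟨by positivity, by linarith⟩]
  positivity

/-- Inside the box the map increases at speed `1 / (2ε)`. -/
theorem IsBoxMap.le_lift (hε : 0 < ε) (hF : IsBoxMap φ S ε F) {x : M} {w : ℝ}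
    (hw : (w : UnitAddCircle) = F x) {k : ℤ} (hk : (k : ℝ) < w) {t : ℝ} (ht : 0 ≤ t) :
    min (w + t / (2 * ε)) (k + 1) ≤ w + orbitVar φ F x t := by
  have hinc := hF.increasesOffZero hε
  by_cases hw1 : (k : ℝ) + 1 ≤ w
  · exact (min_le_right _ _).trans (by linarith [hinc.orbitVar_nonneg x ht])
  push Not at hw1
  have hx : F x ≠ 0 := by
    intro h
    rw [h] at hw
    obtain ⟨n, rfl⟩ := coe_circle_eq_zero_iff.1 hw
    have h1 : k < n := by exact_mod_cast hk
    have h2 : n < k + 1 := by exact_mod_cast hw1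
    omega
  obtain ⟨y, hy, r, hr, rfl⟩ := hF.exists_of_ne_zero hε hx
  have hr1 : 0 < ε - r := by linarith [hr.2]
  have hr2 : 0 < ε + r := by linarith [hr.1]
  have hw2 : w - k = (r + ε) / (2 * ε) := by
    have h1 := hF.1 y hy r ⟨hr.1.le, hr.2.le⟩
    rw [← hw] at h1
    have h2 : ((w - k - (r + ε) / (2 * ε) : ℝ) : UnitAddCircle) = 0 := by
      rw [AddCircle.coe_sub, AddCircle.coe_sub, h1, coe_circle_int]; simp
    have h3 : 0 < (r + ε) / (2 * ε) := by apply div_pos <;> linarith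
    have h4 : (r + ε) / (2 * ε) < 1 := by rw [div_lt_one (by positivity)]; linarith
    have := eq_zero_of_abs_lt_one h2 (by rw [abs_lt]; constructor <;> linarith)
    linarith
  by_cases htr : t ≤ ε - r
  · rw [hF.orbitVar_eq hy hr ⟨ht, htr⟩]
    exact min_le_left _ _
  · push Not at htr
    have h1 := hinc.orbitVar_mono (φ r y) htr.le
    rw [hF.orbitVar_eq hy hr ⟨hr1.le, le_refl _⟩] at h1
    refine (min_le_right _ _).trans ?_
    have : (ε - r) / (2 * ε) = 1 - (r + ε) / (2 * ε) := by field_simp; ring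
    linarith

end Monotone

/-! ### Box maps are pre-Lyapunov and vanish on the recurrent set -/

section PreLyapunov

variable {M : Type*} [MetricSpace M] {φ : Flow ℝ M} {f : C(M, UnitAddCircle)}

theorem liftedFlow_iff {t : ℝ} {p q : Cover f} :
    LiftedFlow φ f t p q ↔ q.1.1 = φ t p.1.1 ∧ q.1.2 = p.1.2 + orbitVar φ f p.1.1 t := by
  unfold LiftedFlow
  rw [hasVariation_orbitArc_iff, sub_eq_iff_eq_add']

theorem abs_sub_le_dist_cover (p q : Cover f) : |p.1.2 - q.1.2| ≤ dist p q := by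
  rw [← Real.dist_eq]
  exact le_max_right _ _

theorem HasVariation.coe_sub {x y : M} {c : Path x y} {a : ℝ} (h : HasVariation f c a) :
    (a : UnitAddCircle) = f y - f x := by
  obtain ⟨u, hu, rfl⟩ := h
  rw [AddCircle.coe_sub, hu, hu, c.target, c.source]

/-- A displacement reaching η would take the absolute value η exactly, and up to 1/2 the norm on the
circle is the absolute value. -/
theorem abs_lt_of_norm_coe_lt {u : C(unitInterval, ℝ)} {η : ℝ} (hη : 0 < η) (hη2 : η ≤ 1 / 2)
    (h : ∀ s, ‖((u s - u 0 : ℝ) : UnitAddCircle)‖ < η) : |u 1 - u 0| < η := by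
  by_contra hge
  push Not at hge
  have hc : Continuous fun s => |u s - u 0| := by fun_prop
  obtain ⟨s, hs⟩ := mem_range_of_exists_le_of_exists_ge hc ⟨0, by simpa using hη.le⟩ ⟨1, hge⟩
  have h1 := h s
  have h2 : ‖((u s - u 0 : ℝ) : UnitAddCircle)‖ = |u s - u 0| := by
    refine (AddCircle.norm_coe_eq_abs_iff 1 one_ne_zero).2 ?_
    simp only at hs
    rw [hs]; simpa using hη2
  simp only at hs
  rw [h2, hs] at h1
  exact lt_irrefl _ h1

theorem exists_forall_hasVariation_lt [CompactSpace M] (f : C(M, UnitAddCircle)) {η : ℝ}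
    (hη : 0 < η) (hη2 : η ≤ 1 / 2) :
    ∃ ε > 0, ∀ {x y : M} (c : Path x y) (a : ℝ), (∃ z, range c ⊆ Metric.ball z ε) →
      HasVariation f c a → |a| < η := by
  obtain ⟨δ, hδ, h⟩ := Metric.uniformContinuous_iff.1
    (CompactSpace.uniformContinuous_of_continuous f.continuous) η hη
  refine ⟨δ / 2, by positivity, ?_⟩
  rintro x y c a ⟨z, hz⟩ ⟨u, hu, rfl⟩
  refine abs_lt_of_norm_coe_lt hη hη2 fun s => ?_
  rw [AddCircle.coe_sub, hu, hu, ← dist_eq_norm]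
  refine h ((dist_triangle_right _ _ z).trans_lt ?_)
  have h1 : dist (c s) z < δ / 2 := hz ⟨s, rfl⟩
  have h2 : dist (c 0) z < δ / 2 := hz ⟨0, rfl⟩
  linarith

/-- Replacing f by f + u adds differences of values of u, which telescope to 0 around the closed
pseudo-orbit. So the pairing can be computed with any representative. -/
theorem PeriodicPseudoOrbit.HasPairing.exists_of_classOf {ε T : ℝ}
    {γ : PeriodicPseudoOrbit φ ε T} {α : H1 M} {m : ℝ} (h : γ.HasPairing α m)
    {F : C(M, UnitAddCircle)} (hF : classOf F = α) :
    ∃ b : ℕ → ℝ,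
      (∀ i < γ.k, ∃ c : Path (φ (γ.time i) (γ.pt i)) (γ.pt (i + 1)),
        (∃ z, range c ⊆ Metric.ball z ε) ∧ HasVariation F c (b i)) ∧
      ∑ i ∈ Finset.range γ.k, (orbitVar φ F (γ.pt i) (γ.time i) + b i) = m := by
  obtain ⟨f, hf, a, b, ha, hb, hsum⟩ := h
  obtain ⟨u, hu⟩ := classOf_eq_iff.1 (hf.trans hF.symm)
  refine ⟨fun i => b i + (u (γ.pt (i + 1)) - u (φ (γ.time i) (γ.pt i))), fun i hi => ?_, ?_⟩
  · obtain ⟨c, hc, w, hw, hwb⟩ := hb i hi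
    refine ⟨c, hc, ⟨fun s => w s + u (c s), by fun_prop⟩, fun s => ?_, ?_⟩
    · simp [hw, hu]
    · simp only [ContinuousMap.coe_mk, c.target, c.source]
      linarith
  · have h1 : ∀ i ∈ Finset.range γ.k, orbitVar φ F (γ.pt i) (γ.time i) +
        (b i + (u (γ.pt (i + 1)) - u (φ (γ.time i) (γ.pt i)))) =
        (a i + b i) + (u (γ.pt (i + 1)) - u (γ.pt i)) := by
      intro i hi
      rw [orbitVar_add_real hu, hasVariation_orbitArc_iff.1 (ha i (Finset.mem_range.1 hi))]
      ring
    rw [Finset.sum_congr rfl h1, Finset.sum_add_distrib, hsum,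
      Finset.sum_range_sub (fun i => u (γ.pt i)), γ.closed]
    ring

variable {S : Set M} {ε : ℝ} {F : C(M, UnitAddCircle)}

/-- Let w be the initial height of the lift of F. A chain stays above w - η: before each jump, an
arc of length at least T has brought the height back to at least w, and the jump costs less than η.
-/
theorem IsBoxMap.isPreLyapunov_neg (hε : 0 < ε) (hF : IsBoxMap φ S ε F) {T : ℝ} (hT : 0 < T) :
    IsPreLyapunov φ T (-F) := by
  intro p q hpq
  have hinc := hF.increasesOffZero hε
  have hlift : ∀ r : Cover (-F), ((-r.1.2 : ℝ) : UnitAddCircle) = F r.1.1 := by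
    intro r
    rw [AddCircle.coe_neg, ← r.2]; simp
  by_contra hlt
  push Not at hlt
  set w := -p.1.2 with hw
  -- The strict inequality k < w is needed even when w is an integer, hence not the floor.
  set k : ℤ := ⌈w⌉ - 1 with hk
  have hk1 : (k : ℝ) < w := by
    have := Int.ceil_lt_add_one w
    simp only [hk]; push_cast; linarith
  have hk2 : w ≤ k + 1 := by
    have := Int.le_ceil w
    simp only [hk]; push_cast; linarith
  obtain ⟨η, hη, hη1, hη2, hη3⟩ : ∃ η > 0, η < T / (2 * ε) ∧ η < w - k ∧ η < q.1.2 - p.1.2 := by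
    have : 0 < min (T / (2 * ε)) (min (w - k) (q.1.2 - p.1.2)) := by
      refine lt_min (by positivity) (lt_min (by linarith) (by linarith))
    obtain ⟨η, h1, h2⟩ := exists_between this
    exact ⟨η, h1, h2.trans_le (min_le_left _ _),
      h2.trans_le ((min_le_right _ _).trans (min_le_left _ _)),
      h2.trans_le ((min_le_right _ _).trans (min_le_right _ _))⟩
  obtain ⟨r, hr, t, ht, hrq⟩ := hpq η hη
  have hr' : w - η ≤ -r.1.2 := by
    clear hrq
    induction hr with
    | refl => linarith
    | tail _ hstep ih =>
      obtain ⟨s, hs, c, hac, hcb⟩ := hstep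
      rename_i a b _
      have h1 := (liftedFlow_iff.1 hac).2
      rw [orbitVar_neg_map] at h1
      have h2 := hF.le_lift hε (hlift a) (k := k) (by linarith) (t := s) (by linarith)
      have h3 := (abs_sub_le_dist_cover c b).trans_lt hcb
      have h4 : T / (2 * ε) ≤ s / (2 * ε) := by gcongr
      have h5 : w ≤ min (-a.1.2 + s / (2 * ε)) (k + 1) := le_min (by linarith) hk2
      linarith [(abs_lt.1 h3).1]
  have h1 := (liftedFlow_iff.1 hrq).2
  rw [orbitVar_neg_map] at h1
  have := hinc.orbitVar_nonneg r.1.1 ht.le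
  linarith

/-- The lift along a closed pseudo-orbit of zero pairing is periodic. Starting at θ in (0,1), it is
above 1 - η > θ after one full arc and jump, and stays so at all later vertices, so it cannot come
back to θ. -/
theorem IsBoxMap.eq_zero_of_mem_alphaRec [CompactSpace M] (hε : 0 < ε) (hF : IsBoxMap φ S ε F)
    {x : M} (hx : x ∈ alphaRec φ (classOf F)) : F x = 0 := by
  by_contra hne
  have hinc := hF.increasesOffZero hε
  set θ := unitRep (F x) with hθ
  have hθc : (θ : UnitAddCircle) = F x := coe_unitRep _
  have hθ0 : 0 < θ := by
    refine lt_of_le_of_ne (unitRep_mem (F x)).1 fun h => hne ?_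
    rw [← hθc, ← h]; simp
  have hθ1 : θ < 1 := (unitRep_mem (F x)).2
  obtain ⟨η, hη, hη1, hη2, hη3⟩ : ∃ η > 0, η ≤ 1 / 2 ∧ η < θ ∧ η < 1 - θ := by
    have : 0 < min (1 / 2) (min θ (1 - θ)) :=
      lt_min (by norm_num) (lt_min hθ0 (by linarith))
    obtain ⟨η, h1, h2⟩ := exists_between this
    exact ⟨η, h1, (h2.trans_le (min_le_left _ _)).le,
      h2.trans_le ((min_le_right _ _).trans (min_le_left _ _)),
      h2.trans_le ((min_le_right _ _).trans (min_le_right _ _))⟩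
  obtain ⟨ρ, hρ, hvar⟩ := exists_forall_hasVariation_lt F hη hη1
  -- In time 2ε an orbit leaves any box in which it starts, so a full arc lifts every height above 0
  -- to at least 1.
  obtain ⟨γ, ⟨i, hi, s, hs, hsx⟩, hpair⟩ := hx ρ hρ (2 * ε) (by positivity)
  obtain ⟨b, hb, hsum⟩ := hpair.exists_of_classOf rfl
  have hbη : ∀ j < γ.k, |b j| < η := fun j hj => by
    obtain ⟨c, hc, hcv⟩ := hb j hj
    exact hvar c _ hc hcv
  -- the lift along the pseudo-orbit, normalised to equal `θ` at `x`
  let W : ℕ → ℝ := fun j => θ - orbitVar φ F (γ.pt i) s +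
    (∑ l ∈ Finset.range j, (orbitVar φ F (γ.pt l) (γ.time l) + b l) -
      ∑ l ∈ Finset.range i, (orbitVar φ F (γ.pt l) (γ.time l) + b l))
  have hWi : W i + orbitVar φ F (γ.pt i) s = θ := by simp [W]
  have hWs : ∀ j, W (j + 1) = W j + orbitVar φ F (γ.pt j) (γ.time j) + b j := by
    intro j; simp only [W, Finset.sum_range_succ]; ring
  have hWk : W γ.k = W 0 := by simp only [W, hsum]; simp
  have hWc' : ∀ j < γ.k, ((W (j + 1) : ℝ) : UnitAddCircle) - F (γ.pt (j + 1)) =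
      (W j : UnitAddCircle) - F (γ.pt j) := by
    intro j hj
    obtain ⟨c, -, hcv⟩ := hb j hj
    rw [hWs, AddCircle.coe_add, AddCircle.coe_add, hcv.coe_sub, coe_orbitVar]; abel
  have hW0 : ∀ j ≤ γ.k, ((W j : ℝ) : UnitAddCircle) - F (γ.pt j) =
      (W 0 : UnitAddCircle) - F (γ.pt 0) := by
    intro j
    induction j with
    | zero => simp
    | succ j ih => exact fun hj => (hWc' j hj).trans (ih (by omega))
  have hWic : ((W i : ℝ) : UnitAddCircle) - F (γ.pt i) = 0 := by
    have h1 : W i = θ - orbitVar φ F (γ.pt i) s := by linarith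
    rw [h1, AddCircle.coe_sub, coe_orbitVar, hsx, hθc]; abel
  have hWc : ∀ j ≤ γ.k, ((W j : ℝ) : UnitAddCircle) = F (γ.pt j) := by
    intro j hj
    rw [← sub_eq_zero, hW0 j hj, ← hW0 i hi.le, hWic]
  have hstep : ∀ j < γ.k, θ - η ≤ W j → 1 - η ≤ W (j + 1) := by
    intro j hj hWj
    have h1 := hF.le_lift hε (hWc j hj.le) (k := 0) (by simpa using by linarith)
      (t := γ.time j) (by linarith [γ.le_time j hj])
    have h2 : 1 ≤ γ.time j / (2 * ε) := by
      rw [le_div_iff₀ (by positivity)]; linarith [γ.le_time j hj]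
    have h3 : (1 : ℝ) ≤ min (W j + γ.time j / (2 * ε)) ((0 : ℤ) + 1) :=
      le_min (by linarith) (by simp)
    have := (abs_lt.1 (hbη j hj)).1
    rw [hWs]; linarith
  have hfirst : θ - η ≤ W (i + 1) := by
    have h1 := hinc.orbitVar_mono (γ.pt i) hs.2.le
    have := (abs_lt.1 (hbη i hi)).1
    rw [hWs]; linarith
  have hlast : θ - η ≤ W γ.k := by
    have : ∀ j, i + 1 ≤ j → j ≤ γ.k → θ - η ≤ W j := by
      intro j hj
      induction j, hj using Nat.le_induction with
      | base => exact fun _ => hfirst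
      | succ j hj ih => exact fun hjk => by linarith [hstep j hjk (ih (by omega))]
    exact this _ hi le_rfl
  have hall : ∀ j ≤ γ.k, θ - η ≤ W j := by
    intro j
    induction j with
    | zero => exact fun _ => hWk ▸ hlast
    | succ j ih => exact fun hjk => by linarith [hstep j hjk (ih (by omega))]
  have hall' : 1 - η ≤ W i := by
    rcases Nat.eq_zero_or_pos i with h0 | h0
    · have := hstep (γ.k - 1) (by omega) (hall _ (by omega))
      rwa [Nat.sub_add_cancel γ.k_pos, hWk, ← h0] at this
    · have := hstep (i - 1) (by omega) (hall _ (by omega))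
      rwa [Nat.sub_add_cancel h0] at this
  have := hinc.orbitVar_nonneg (γ.pt i) hs.1
  linarith

theorem IsBoxMap.isPLMap [CompactSpace M] (hε : 0 < ε) (hF : IsBoxMap φ S ε F) {T : ℝ}
    (hT : 0 < T) {α : H1 M} (hα : classOf F = α) : IsPLMap φ T α F :=
  ⟨hα, fun _ hx => hF.eq_zero_of_mem_alphaRec hε (hα ▸ hx), hF.isPreLyapunov_neg hε hT⟩

/-- The point of the covering of `f + u` that corresponds to a point of the covering of `f`. -/
def Cover.shift {f g : C(M, UnitAddCircle)} {u : C(M, ℝ)}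
    (h : ∀ x, g x = f x + (u x : UnitAddCircle)) (p : Cover f) : Cover g :=
  ⟨(p.1.1, p.1.2 + u p.1.1), by rw [h, p.2, AddCircle.coe_add]⟩

/-- Adding u to the height conjugates the lifted flows, and uniform continuity of u keeps jumps
small. Thus maps of the same class are tested on the same pairs of points. -/
theorem HasPseudoOrbit.shift [CompactSpace M] {f g : C(M, UnitAddCircle)} {u : C(M, ℝ)}
    (h : ∀ x, g x = f x + (u x : UnitAddCircle)) {T : ℝ} {p q : Cover f}
    (hpq : ∀ ε : ℝ, 0 < ε → HasPseudoOrbit φ f ε T p q) (ε : ℝ) (hε : 0 < ε) :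
    HasPseudoOrbit φ g ε T (p.shift h) (q.shift h) := by
  obtain ⟨δ, hδ, hu⟩ := Metric.uniformContinuous_iff.1
    (CompactSpace.uniformContinuous_of_continuous u.continuous) (ε / 2) (by positivity)
  have hflow : ∀ (t : ℝ) (a b : Cover f), LiftedFlow φ f t a b →
      LiftedFlow φ g t (a.shift h) (b.shift h) := by
    intro t a b hab
    rw [liftedFlow_iff] at hab ⊢
    refine ⟨hab.1, ?_⟩
    simp only [Cover.shift, orbitVar_add_real h]
    rw [hab.1, hab.2]; ring
  obtain ⟨r, hr, t, ht, hrq⟩ := hpq (min δ (ε / 2)) (by positivity)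
  refine ⟨r.shift h, ?_, t, ht, hflow _ _ _ hrq⟩
  refine hr.lift (Cover.shift h) ?_
  rintro a b ⟨s, hs, c, hac, hcb⟩
  refine ⟨s, hs, c.shift h, hflow _ _ _ hac, ?_⟩
  have h1 : dist c.1.1 b.1.1 ≤ dist c b := le_max_left _ _
  have h2 := abs_sub_le_dist_cover c b
  have h3 := hu (h1.trans_lt (hcb.trans_le (min_le_left _ _)))
  have h4 := hcb.trans_le (min_le_right δ (ε / 2))
  change max (dist c.1.1 b.1.1) (dist (c.1.2 + u c.1.1) (b.1.2 + u b.1.1)) < ε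
  refine max_lt (by linarith) ?_
  calc dist (c.1.2 + u c.1.1) (b.1.2 + u b.1.1) ≤ dist c.1.2 b.1.2 + dist (u c.1.1) (u b.1.1) :=
        dist_add_add_le _ _ _ _
    _ < ε := by rw [Real.dist_eq c.1.2]; linarith

/-- Linear interpolation between two pre-Lyapunov maps that agree on the recurrent set. -/
theorem IsPLMap.homotopicWith [CompactSpace M] {T : ℝ} {α : H1 M} {f g : C(M, UnitAddCircle)}
    (hf : IsPLMap φ T α f) (hg : IsPLMap φ T α g) {u : C(M, ℝ)}
    (h : ∀ x, g x = f x + (u x : UnitAddCircle)) (hu : ∀ x ∈ alphaRec φ α, u x = 0) :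
    ContinuousMap.HomotopicWith f g (IsPLMap φ T α) := by
  have hc : Continuous fun p : unitInterval × M =>
      f p.2 + (((p.1 : ℝ) * u p.2 : ℝ) : UnitAddCircle) :=
    (f.continuous.comp continuous_snd).add (continuous_coe_circle.comp (by fun_prop))
  refine ⟨⟨⟨⟨_, hc⟩, fun x => by simp, fun x => by simp [h]⟩, fun s => ?_⟩⟩
  refine ⟨?_, fun x hx => ?_, ?_⟩
  · rw [← hf.1]
    exact (classOf_eq_iff.2 ⟨⟨fun x => (s : ℝ) * u x, by fun_prop⟩, fun x => rfl⟩).symm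
  · change f x + (((s : ℝ) * u x : ℝ) : UnitAddCircle) = 0
    rw [hf.2.1 x hx, hu x hx]; simp
  · set k : C(M, UnitAddCircle) := -_ with hk
    have hkx : ∀ x, k x = -(f x + (((s : ℝ) * u x : ℝ) : UnitAddCircle)) := fun x => rfl
    intro p q hpq
    have h1 : ∀ x, (-f) x = k x +
        (((⟨fun x => (s : ℝ) * u x, by fun_prop⟩ : C(M, ℝ)) x : ℝ) : UnitAddCircle) := by
      intro x; rw [hkx]; simp
    have h2 : ∀ x, (-g) x = k x +
        (((⟨fun x => -((1 - s : ℝ) * u x), by fun_prop⟩ : C(M, ℝ)) x : ℝ) : UnitAddCircle) := by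
      intro x
      have : u x = (s : ℝ) * u x + (1 - s : ℝ) * u x := by ring
      change -g x = k x + ((-((1 - s : ℝ) * u x) : ℝ) : UnitAddCircle)
      rw [hkx, h]
      nth_rewrite 1 [this]
      rw [AddCircle.coe_add, AddCircle.coe_neg]; abel
    -- The required inequality is the average, with weights 1 - s and s, of those for f and g.
    have a1 := hf.2.2 _ _ (HasPseudoOrbit.shift h1 hpq)
    have a2 := hg.2.2 _ _ (HasPseudoOrbit.shift h2 hpq)
    simp only [Cover.shift, ContinuousMap.coe_mk] at a1 a2
    have hs0 := s.2.1
    have hs1 := s.2.2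
    have b1 := mul_le_mul_of_nonneg_left a1 (sub_nonneg.2 hs1)
    have b2 := mul_le_mul_of_nonneg_left a2 hs0
    linarith

end PreLyapunov

/-! ### Homotopies between box maps -/

section BoxHomotopy

/-- The flow on `[0,1] × M` that follows `φ` at speed `e t` in the slice of `t`. -/
def slicedFlow {M : Type*} [TopologicalSpace M] (φ : Flow ℝ M) (e : C(unitInterval, ℝ)) :
    Flow ℝ (unitInterval × M) where
  toFun τ p := (p.1, φ (e p.1 * τ) p.2)
  cont' := by
    have : Continuous fun z : ℝ × unitInterval × M => φ (e z.2.1 * z.1) z.2.2 :=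
      φ.continuous (by fun_prop) (by fun_prop)
    exact (by fun_prop : Continuous fun z : ℝ × unitInterval × M => z.2.1).prodMk this
  map_add' s t p := by simp [mul_add, φ.map_add]
  map_zero' p := by simp

section Topological

variable {M : Type*} [TopologicalSpace M] {φ : Flow ℝ M}

@[simp] theorem slicedFlow_apply (e : C(unitInterval, ℝ)) (τ : ℝ) (t : unitInterval) (x : M) :
    slicedFlow φ e τ (t, x) = (t, φ (e t * τ) x) := rfl

theorem IsBoxMap.unique {S : Set M} {ε : ℝ} {F F' : C(M, UnitAddCircle)} (h : IsBoxMap φ S ε F)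
    (h' : IsBoxMap φ S ε F') : F = F' := by
  ext y
  by_cases hy : ∃ x ∈ S, ∃ t ∈ Icc (-ε) ε, φ t x = y
  · obtain ⟨x, hx, t, ht, rfl⟩ := hy
    rw [h.1 x hx t ht, h'.1 x hx t ht]
  · push Not at hy
    rw [h.2 y hy, h'.2 y hy]

/-- Box maps of a continuous family of local sections. -/
theorem exists_boxMap_family [T2Space M] {St : Set (unitInterval × M)} (hc : IsCompact St)
    {e : C(unitInterval, ℝ)} (he : ∀ t, 0 < e t)
    (hn : ∀ t, NoReturn φ {x | (t, x) ∈ St} (2 * e t))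
    (hl : IsLocalSection (slicedFlow φ e) St) :
    ∃ F : C(unitInterval × M, UnitAddCircle), ∀ t,
      IsBoxMap φ {x | (t, x) ∈ St} (e t) (F.comp ⟨fun x => (t, x), by fun_prop⟩) := by
  -- A box of half-width 1 for the sliced flow has half-width e t in the slice of t, so a single box
  -- map covers all widths.
  have hn' : NoReturn (slicedFlow φ e) St (2 * 1) := by
    rintro ⟨t, x⟩ hx s hs hsx
    have := hn t x hx (e t * s) (by
      rw [abs_mul, abs_of_pos (he t), mul_comm]; exact mul_le_mul_of_nonneg_right
        (by linarith) (he t).le) hsx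
    exact (mul_eq_zero.1 this).resolve_left (he t).ne'
  obtain ⟨F, hF⟩ := exists_boxMap hc one_pos hn' hl
  refine ⟨F, fun t => ⟨fun x hx r hr => ?_, fun y hy => ?_⟩⟩
  · have h0 := he t
    have h := hF.1 (t, x) hx (r / e t) ⟨by rw [le_div_iff₀ h0]; linarith [hr.1],
      by rw [div_le_iff₀ h0]; linarith [hr.2]⟩
    rw [slicedFlow_apply, mul_div_cancel₀ _ h0.ne'] at h
    change F (t, φ r x) = _
    rw [h]
    congr 1
    field_simp
  · refine hF.2 (t, y) ?_
    rintro ⟨t', x⟩ hx s hs hsx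
    simp only [slicedFlow_apply, Prod.mk.injEq] at hsx
    obtain ⟨rfl, hsx⟩ := hsx
    refine hy x hx _ ?_ hsx
    have h0 := (he t').le
    constructor <;> nlinarith [hs.1, hs.2]

/-- The trace in `[0,1] × M` of an isotopy along the flow. -/
def isotopyTrace (φ : Flow ℝ M) {S : Set M} (θ : C(unitInterval × S, ℝ)) :
    Set (unitInterval × M) :=
  range fun p : unitInterval × S => (p.1, φ (θ p) (p.2 : M))

theorem mem_isotopyTrace_iff {S : Set M} {θ : C(unitInterval × S, ℝ)} {t : unitInterval} {y : M} :
    (t, y) ∈ isotopyTrace φ θ ↔ ∃ x : S, φ (θ (t, x)) (x : M) = y := by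
  constructor
  · rintro ⟨⟨t', x⟩, h⟩
    obtain ⟨h1, h2⟩ := Prod.mk.inj h
    simp only at h1 h2
    exact ⟨x, by rw [← h1, h2]⟩
  · rintro ⟨x, h⟩
    exact ⟨(t, x), by simp [h]⟩

theorem isCompact_isotopyTrace {S : Set M} (hS : IsCompact S) (θ : C(unitInterval × S, ℝ)) :
    IsCompact (isotopyTrace φ θ) := by
  have : CompactSpace S := isCompact_iff_compactSpace.1 hS
  have h : Continuous fun p : unitInterval × S => φ (θ p) (p.2 : M) :=
    φ.continuous (by fun_prop) (by fun_prop)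
  exact isCompact_range (continuous_fst.prodMk h)

/-- Near a trace point over x₀, flow back by θ₀ and then to `S` in a short time σ, reaching some x
near x₀. The trace point over x lies on the same orbit, at delay θ(t,x) - θ₀ + σ, small by
continuity of θ. -/
theorem isLocalSection_isotopyTrace {S : Set M} (hl : IsLocalSection φ S)
    (θ : C(unitInterval × S, ℝ)) {ε : ℝ} (hε : 0 < ε) :
    IsLocalSection (slicedFlow φ (ContinuousMap.const _ ε)) (isotopyTrace φ θ) := by
  rintro _ ⟨⟨t₀, x₀⟩, rfl⟩ r hr
  set θ₀ := θ (t₀, x₀)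
  have hrε : 0 < r * ε / 2 := by positivity
  have h1 : ∀ᶠ p in 𝓝 (t₀, x₀), |θ p - θ₀| < r * ε / 2 :=
    eventually_abs_lt_of_continuousAt (g := fun p => θ p - θ₀) (by fun_prop) (sub_self θ₀) hrε
  rw [nhds_prod_eq] at h1
  obtain ⟨U, hU, W', hW', h1⟩ := Filter.mem_prod_iff.1 h1
  obtain ⟨W, hW, hWW⟩ := mem_nhds_subtype _ _ _ |>.1 hW'
  have h2 : Continuous fun z : ℝ × M => φ z.1 (φ (-θ₀) z.2) :=
    φ.continuous (by fun_prop) ((φ.continuous_toFun _).comp continuous_snd)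
  have h3 : ∀ᶠ z in 𝓝 ((0 : ℝ), φ θ₀ (x₀ : M)), φ z.1 (φ (-θ₀) z.2) ∈ W := by
    refine h2.continuousAt.eventually_mem ?_
    simpa [flow_neg_apply] using hW
  rw [nhds_prod_eq] at h3
  obtain ⟨A, hA, B, hB, h3⟩ := Filter.mem_prod_iff.1 h3
  obtain ⟨ρ, hρ, hρA⟩ := exists_pos_of_eventually hA
  have h4 : ∀ᶠ y in 𝓝 (φ θ₀ (x₀ : M)), ∃ s, |s| < min ρ (r * ε / 2) ∧ φ s (φ (-θ₀) y) ∈ S := by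
    have hc : ContinuousAt (φ (-θ₀)) (φ θ₀ (x₀ : M)) := (φ.continuous_toFun _).continuousAt
    refine hc.eventually
      (p := fun y => ∃ s : ℝ, |s| < min ρ (r * ε / 2) ∧ φ s y ∈ S) ?_
    rw [flow_neg_apply]
    exact hl _ x₀.2 _ (lt_min hρ hrε)
  have h5 : ∀ᶠ p in 𝓝 (t₀, φ θ₀ (x₀ : M)), p.1 ∈ U ∧ p.2 ∈ B ∧
      ∃ s, |s| < min ρ (r * ε / 2) ∧ φ s (φ (-θ₀) p.2) ∈ S :=
    (continuousAt_fst.eventually_mem hU).and ((continuousAt_snd.eventually_mem hB).and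
      (continuousAt_snd.eventually (p := fun y => ∃ s : ℝ, |s| < min ρ (r * ε / 2) ∧
        φ s (φ (-θ₀) y) ∈ S) h4))
  filter_upwards [h5] with ⟨t, y⟩ ⟨htU, hyB, σ, hσ, hσS⟩
  have hxW : φ σ (φ (-θ₀) y) ∈ W :=
    h3 (mk_mem_prod (hρA σ (hσ.le.trans (min_le_left _ _))) hyB)
  have hθ : |θ (t, ⟨_, hσS⟩) - θ₀| < r * ε / 2 := h1 (mk_mem_prod htU (hWW hxW))
  refine ⟨(θ (t, ⟨_, hσS⟩) - θ₀ + σ) / ε, ?_, ?_⟩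
  · rw [abs_div, abs_of_pos hε, div_lt_iff₀ hε]
    refine (abs_add_le _ _).trans_lt ?_
    have := hσ.trans_le (min_le_right _ _)
    linarith
  · rw [slicedFlow_apply, mem_isotopyTrace_iff]
    refine ⟨⟨_, hσS⟩, ?_⟩
    rw [ContinuousMap.const_apply, mul_div_cancel₀ _ hε.ne']
    change φ _ (φ σ (φ (-θ₀) y)) = _
    rw [← φ.map_add, ← φ.map_add]
    congr 1; ring

/-- Compactness is applied to triples (t, x, y). If the displaced points of x and y differ, they
stay apart for short times. If they agree, then x = y, and close to such a triple a return of the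
trace gives a return of `S` itself. -/
theorem exists_noReturn_isotopyTrace [T2Space M] {S : Set M} (hS : IsCompact S) {r : ℝ}
    (hr : 0 < r) (hn : NoReturn φ S r) {θ : C(unitInterval × S, ℝ)}
    (hθ : ∀ t, Function.Injective (fun x : S => φ (θ (t, x)) (x : M))) :
    ∃ ρ > 0, ∀ t, NoReturn φ {x | (t, x) ∈ isotopyTrace φ θ} ρ := by
  have : CompactSpace S := isCompact_iff_compactSpace.1 hS
  have key : ∀ᶠ s in 𝓝 (0 : ℝ), ∀ z ∈ (univ : Set (unitInterval × S × S)),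
      φ (s + θ (z.1, z.2.1)) (z.2.1 : M) = φ (θ (z.1, z.2.2)) (z.2.2 : M) → s = 0 := by
    refine isCompact_univ.eventually_forall_of_forall_eventually ?_
    rintro ⟨t₀, x₀, x₁⟩ -
    by_cases he : φ (θ (t₀, x₀)) (x₀ : M) = φ (θ (t₀, x₁)) (x₁ : M)
    · have hx : x₀ = x₁ := hθ t₀ he
      subst hx
      have h1 : ∀ᶠ z in 𝓝 ((0 : ℝ), (t₀, x₀, x₀)),
          |z.1 + θ (z.2.1, z.2.2.1) - θ (z.2.1, z.2.2.2)| < r :=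
        eventually_abs_lt_of_continuousAt (by fun_prop) (by simp) hr
      filter_upwards [h1] with ⟨s, t, x, y⟩ hz hxy
      simp only at hz hxy
      have e : φ (s + θ (t, x) - θ (t, y)) (x : M) = y := by
        rw [sub_eq_neg_add, φ.map_add, hxy, flow_neg_apply]
      have h0 := hn x x.2 _ hz.le (by rw [e]; exact y.2)
      rw [h0, φ.map_zero_apply] at e
      have : x = y := Subtype.ext e
      subst this
      linarith
    · have c1 : Continuous fun z : ℝ × unitInterval × S × S =>
          φ (z.1 + θ (z.2.1, z.2.2.1)) (z.2.2.1 : M) := φ.continuous (by fun_prop) (by fun_prop)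
      have c2 : Continuous fun z : ℝ × unitInterval × S × S =>
          φ (θ (z.2.1, z.2.2.2)) (z.2.2.2 : M) := φ.continuous (by fun_prop) (by fun_prop)
      have := (isOpen_ne_fun c1 c2).mem_nhds
        (show ((0 : ℝ), (t₀, x₀, x₁)) ∈ _ by simpa using he)
      filter_upwards [this] with z hz hz'
      exact absurd hz' hz
  obtain ⟨ρ, hρ, h⟩ := exists_pos_of_eventually key
  refine ⟨ρ, hρ, fun t y hy s hs hsy => ?_⟩
  obtain ⟨x, rfl⟩ := mem_isotopyTrace_iff.1 hy
  obtain ⟨x', hx'⟩ := mem_isotopyTrace_iff.1 hsy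
  exact h s hs (t, x, x') (mem_univ _) (by rw [φ.map_add]; exact hx'.symm)

end Topological

variable {M : Type*} [MetricSpace M] [CompactSpace M] {φ : Flow ℝ M}

theorem homotopicWith_of_family {St : Set (unitInterval × M)} (hc : IsCompact St)
    {e : C(unitInterval, ℝ)} (he : ∀ t, 0 < e t)
    (hn : ∀ t, NoReturn φ {x | (t, x) ∈ St} (2 * e t))
    (hl : IsLocalSection (slicedFlow φ e) St) {T : ℝ} (hT : 0 < T) {F₀ F₁ : C(M, UnitAddCircle)}
    (h₀ : IsBoxMap φ {x | (0, x) ∈ St} (e 0) F₀) (h₁ : IsBoxMap φ {x | (1, x) ∈ St} (e 1) F₁) :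
    ContinuousMap.HomotopicWith F₀ F₁ (IsPLMap φ T (classOf F₀)) := by
  obtain ⟨F, hF⟩ := exists_boxMap_family hc he hn hl
  have e₀ : ∀ x, F (0, x) = F₀ x := fun x => congrArg (fun g => g x) ((hF 0).unique h₀)
  have e₁ : ∀ x, F (1, x) = F₁ x := fun x => congrArg (fun g => g x) ((hF 1).unique h₁)
  refine ⟨⟨⟨F, e₀, e₁⟩, fun t => (hF t).isPLMap (he t) hT ?_⟩⟩
  -- The class is constant in the family: the part of the homotopy up to parameter t, rescaled,
  -- joins the first map to the map at t.
  refine (Quotient.sound ?_ : classOf F₀ = classOf _).symm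
  refine ⟨⟨⟨fun p => F (p.1 * t, p.2), by fun_prop⟩, fun x => ?_, fun x => ?_⟩⟩
  · simp [e₀]
  · simp

theorem IsBoxMap.homotopicWith {S : Set M} (hS : IsCompact S) (hl : IsLocalSection φ S)
    {ε₀ ε₁ : ℝ} (hε₀ : 0 < ε₀) (hε₁ : 0 < ε₁) (hn₀ : NoReturn φ S (2 * ε₀))
    (hn₁ : NoReturn φ S (2 * ε₁)) {F₀ F₁ : C(M, UnitAddCircle)} (h₀ : IsBoxMap φ S ε₀ F₀)
    (h₁ : IsBoxMap φ S ε₁ F₁) {T : ℝ} (hT : 0 < T) :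
    ContinuousMap.HomotopicWith F₀ F₁ (IsPLMap φ T (classOf F₀)) := by
  -- The section is fixed and the width interpolates; no intermediate width exceeds the larger one,
  -- which is already embedded.
  let e : C(unitInterval, ℝ) := ⟨fun t => (1 - t) * ε₀ + t * ε₁, by fun_prop⟩
  have het : ∀ t, e t = (1 - t) * ε₀ + t * ε₁ := fun t => rfl
  have hmin : ∀ t, min ε₀ ε₁ ≤ e t := fun t => by
    have := mul_le_mul_of_nonneg_left (min_le_left ε₀ ε₁) (sub_nonneg.2 t.2.2)
    have := mul_le_mul_of_nonneg_left (min_le_right ε₀ ε₁) t.2.1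
    rw [het]; linarith
  have hmax : ∀ t, e t ≤ max ε₀ ε₁ := fun t => by
    have := mul_le_mul_of_nonneg_left (le_max_left ε₀ ε₁) (sub_nonneg.2 t.2.2)
    have := mul_le_mul_of_nonneg_left (le_max_right ε₀ ε₁) t.2.1
    rw [het]; linarith
  have hm : 0 < min ε₀ ε₁ := lt_min hε₀ hε₁
  have hslice : ∀ t, {x | ((t : unitInterval), x) ∈ (univ ×ˢ S : Set (unitInterval × M))} = S := by
    intro t; ext; simp
  refine homotopicWith_of_family (St := univ ×ˢ S) (e := e) (isCompact_univ.prod hS)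
    (fun t => hm.trans_le (hmin t)) (fun t => ?_) ?_ hT ?_ ?_
  · rw [hslice]
    rcases max_choice ε₀ ε₁ with h | h
    · exact hn₀.mono (by have := hmax t; rw [h] at this; linarith)
    · exact hn₁.mono (by have := hmax t; rw [h] at this; linarith)
  · rintro ⟨t, x⟩ ⟨-, hx⟩ r hr
    have h1 := (continuousAt_snd (p := (t, x))).eventually
      (p := fun y => ∃ s : ℝ, |s| < r * min ε₀ ε₁ ∧ φ s y ∈ S) (hl x hx _ (by positivity))
    filter_upwards [h1] with ⟨t', y⟩ ⟨s, hs, hsy⟩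
    have h0 := hm.trans_le (hmin t')
    refine ⟨s / e t', ?_, ?_⟩
    · rw [abs_div, abs_of_pos h0, div_lt_iff₀ h0]
      exact hs.trans_le (mul_le_mul_of_nonneg_left (hmin t') hr.le)
    · rw [slicedFlow_apply, mul_div_cancel₀ _ h0.ne']
      exact ⟨mem_univ _, hsy⟩
  · rw [hslice]; simpa [het] using h₀
  · rw [hslice]; simpa [het] using h₁

theorem IsotopicAlongFlow.exists_homotopicWith {S₀ S₁ : Set M} (h : IsotopicAlongFlow φ S₀ S₁)
    (hS : IsCompact S₀) (hl : IsLocalSection φ S₀) {r : ℝ} (hr : 0 < r) (hn : NoReturn φ S₀ r)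
    {T : ℝ} (hT : 0 < T) :
    ∃ ε > 0, NoReturn φ S₀ (2 * ε) ∧ NoReturn φ S₁ (2 * ε) ∧ ∃ F₀ F₁ : C(M, UnitAddCircle),
      IsBoxMap φ S₀ ε F₀ ∧ IsBoxMap φ S₁ ε F₁ ∧
      ContinuousMap.HomotopicWith F₀ F₁ (IsPLMap φ T (classOf F₀)) := by
  obtain ⟨θ, hθ0, hθ, hθ1⟩ := h
  obtain ⟨ρ, hρ, hnr⟩ := exists_noReturn_isotopyTrace hS hr hn (fun t => (hθ t).injective)
  have s0 : {x | ((0 : unitInterval), x) ∈ isotopyTrace φ θ} = S₀ := by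
    ext y
    rw [mem_ofPred_eq, mem_isotopyTrace_iff]
    simp only [hθ0, φ.map_zero_apply]
    exact ⟨fun ⟨x, hx⟩ => hx ▸ x.2, fun hy => ⟨⟨y, hy⟩, rfl⟩⟩
  have s1 : {x | ((1 : unitInterval), x) ∈ isotopyTrace φ θ} = S₁ := by
    ext y
    rw [mem_ofPred_eq, mem_isotopyTrace_iff, ← hθ1]; rfl
  have hε : 0 < ρ / 2 := by positivity
  have hnr' : ∀ t, NoReturn φ {x | (t, x) ∈ isotopyTrace φ θ} (2 * (ρ / 2)) :=
    fun t => (hnr t).mono (by linarith)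
  have hc := isCompact_isotopyTrace (φ := φ) hS θ
  have hls := isLocalSection_isotopyTrace hl θ hε
  obtain ⟨F, hF⟩ := exists_boxMap_family hc (e := ContinuousMap.const _ (ρ / 2)) (fun _ => hε)
    hnr' hls
  refine ⟨ρ / 2, hε, s0 ▸ hnr' 0, s1 ▸ hnr' 1, _, _, s0 ▸ hF 0, s1 ▸ hF 1, ?_⟩
  exact homotopicWith_of_family hc (fun _ => hε) hnr' hls hT (hF 0) (hF 1)

end BoxHomotopy

/-! ### Limit points of orbits and the recurrent set -/

section LimitSets

theorem locallyPathConnectedSpace_halfSpace (k : ℕ) :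
    LocallyPathConnectedSpace (HalfSpace k) := by
  refine Convex.locallyPathConnectedSpace (E := EuclideanSpace ℝ (Fin k)) (S := HalfSpace k) ?_
  intro x hx y hy a b ha hb _ i hi
  have h1 := hx i hi
  have h2 := hy i hi
  simp only [PiLp.add_apply, PiLp.smul_apply, smul_eq_mul]
  positivity

/-- This supplies the small paths that close up the jumps of the pseudo-orbits constructed below. -/
theorem IsTopManifold.locallyPathConnectedSpace {n : ℕ} {X : Type*} [TopologicalSpace X]
    (h : IsTopManifold n X) : LocallyPathConnectedSpace X := by
  have := locallyPathConnectedSpace_halfSpace n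
  let _ : ChartedSpace (HalfSpace n) X :=
    { atlas := univ
      chartAt := fun x => (h.2.2 x).choose
      mem_chart_source := fun x => (h.2.2 x).choose_spec
      chart_mem_atlas := fun _ => mem_univ _ }
  exact ChartedSpace.locallyPathConnectedSpace (HalfSpace n) X

theorem continuousAt_signedRep {c : UnitAddCircle} (h : ‖c‖ < 1 / 2) :
    ContinuousAt signedRep c := by
  refine continuousAt_subtype_val.comp (AddCircle.continuousAt_equivIco 1 _ ?_)
  rintro rfl
  rw [(AddCircle.norm_coe_eq_abs_iff 1 one_ne_zero).2 (by norm_num [abs_div])] at h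
  norm_num [abs_div] at h

theorem hasVariation_zero_of_norm_lt {M : Type*} [TopologicalSpace M] {f : C(M, UnitAddCircle)}
    {x y : M} (c : Path x y) (h : ∀ s, ‖f (c s)‖ < 1 / 2) (hx : f x = 0) (hy : f y = 0) :
    HasVariation f c 0 := by
  refine ⟨⟨fun s => signedRep (f (c s)), ?_⟩, fun s => coe_signedRep _, ?_⟩
  · rw [continuous_iff_continuousAt]
    exact fun s => ContinuousAt.comp (g := signedRep) (continuousAt_signedRep (h s))
      (f.continuous.comp c.continuous).continuousAt
  · simp [hx, hy]

variable {M : Type*} [MetricSpace M] {φ : Flow ℝ M}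

/-- A point is `α`-recurrent if orbit arcs of arbitrary length along which `f` vanishes start and
end near it. -/
theorem mem_alphaRec_of_forall_nhds [LocallyPathConnectedSpace M] {f : C(M, UnitAddCircle)} {y : M}
    (h : ∀ W ∈ 𝓝 y, ∀ L : ℝ, ∃ z ∈ W, ∃ t ≥ L, φ t z ∈ W ∧
      ∀ s ∈ Icc 0 t, f (φ s z) = 0 ∧ orbitVar φ f z s = 0) :
    y ∈ alphaRec φ (classOf f) := by
  intro ε hε T hT
  have hcT : Continuous (φ T) := φ.continuous_toFun T
  have hV : Continuous fun z => orbitVar φ f z T :=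
    (continuous_orbitVar φ f).comp (by fun_prop : Continuous fun z : M => (z, T))
  obtain ⟨h0, h1, h2⟩ : f y = 0 ∧ f (φ T y) = 0 ∧ orbitVar φ f y T = 0 := by
    have hcl : IsClosed {z | f z = 0 ∧ f (φ T z) = 0 ∧ orbitVar φ f z T = 0} :=
      (isClosed_eq f.continuous continuous_const).inter
        ((isClosed_eq (f.continuous.comp hcT) continuous_const).inter
          (isClosed_eq hV continuous_const))
    refine hcl.closure_subset (mem_closure_iff_nhds.2 fun W hW => ?_)
    obtain ⟨z, hz, t, ht, -, hs⟩ := h W hW T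
    have hz0 := (hs 0 ⟨le_rfl, hT.le.trans ht⟩).1
    rw [φ.map_zero_apply] at hz0
    exact ⟨z, hz, hz0, (hs T ⟨hT.le, ht⟩).1, (hs T ⟨hT.le, ht⟩).2⟩
  have hA : Metric.ball y ε ∩ φ T ⁻¹' Metric.ball (φ T y) ε ∩
      ({z | ‖f z‖ < 1 / 2} ∩ {z | ‖f (φ T z)‖ < 1 / 2}) ∈ 𝓝 y := by
    refine Filter.inter_mem (Filter.inter_mem (Metric.ball_mem_nhds y hε)
      (hcT.continuousAt (Metric.ball_mem_nhds _ hε))) (Filter.inter_mem ?_ ?_)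
    · exact (isOpen_lt (by fun_prop) continuous_const).mem_nhds (by simp [h0])
    · exact (isOpen_lt ((f.continuous.comp hcT).norm) continuous_const).mem_nhds (by simp [h1])
  obtain ⟨W, ⟨hW, hWc⟩, hWA⟩ := (path_connected_basis y).mem_iff.1 hA
  obtain ⟨z, hz, t, ht, htW, hs⟩ := h W hW (2 * T)
  have hyW : y ∈ W := mem_of_mem_nhds hW
  have j1 := hWc.joinedIn y hyW z hz
  have j2 := hWc.joinedIn _ htW y hyW
  have hTt : T ≤ t := by linarith
  have hfz := hs T ⟨hT.le, hTt⟩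
  have hft := hs t ⟨by linarith, le_rfl⟩
  have hzT : φ (t - T) (φ T z) = φ t z := by rw [← φ.map_add]; simp
  -- The pseudo-orbit follows y for time T, jumps to φ_T(z), follows z until time t, and jumps back
  -- to y. Starting at y itself makes it pass through y, and t ≥ 2T makes both arcs long enough.
  let γ : PeriodicPseudoOrbit φ ε T :=
    { k := 2
      k_pos := two_pos
      pt := fun i => if i = 1 then φ T z else y
      time := fun i => if i = 1 then t - T else T
      closed := by simp
      le_time := fun i _ => by split_ifs <;> linarith
      jump_lt := fun i hi => by
        interval_cases i
        · simpa [dist_comm] using (hWA hz).1.2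
        · simpa [hzT] using (hWA htW).1.1 }
  refine ⟨γ, ⟨0, two_pos, 0, ⟨le_rfl, by simpa [γ] using hT⟩, by simp [γ]⟩, f, rfl,
    fun _ => 0, fun _ => 0, fun i hi => ?_, fun i hi => ?_, by simp⟩
  · rw [hasVariation_orbitArc_iff]
    change i < 2 at hi
    interval_cases i
    · simp [γ, h2]
    · have := orbitVar_add (φ := φ) (f := f) z T (t - T)
      rw [add_sub_cancel, hft.2, hfz.2] at this
      simpa [γ] using this
  · change i < 2 at hi
    interval_cases i
    · refine ⟨(j1.somePath.map hcT).cast (by simp [γ]) (by simp [γ]), ⟨φ T y, ?_⟩,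
        hasVariation_zero_of_norm_lt _ (fun s => ?_) (by simpa [γ] using h1)
        (by simpa [γ] using hfz.1)⟩
      · rintro _ ⟨s, rfl⟩
        exact (hWA (j1.somePath_mem s)).1.2
      · exact (hWA (j1.somePath_mem s)).2.2
    · refine ⟨j2.somePath.cast (by simp [γ, hzT]) (by simp [γ]), ⟨y, ?_⟩,
        hasVariation_zero_of_norm_lt _ (fun s => ?_) (by simpa [γ, hzT] using hft.1)
        (by simpa [γ] using h0)⟩
      · rintro _ ⟨s, rfl⟩
        exact (hWA (j2.somePath_mem s)).1.1
      · exact (hWA (j2.somePath_mem s)).2.1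

variable {S : Set M} {ε : ℝ} {F : C(M, UnitAddCircle)}

/-- With k the largest integer strictly below the supremum of the lift, once the lift passes k it
reaches k + 1 within time 2ε. As k + 1 bounds the supremum, the lift stays there. -/
theorem IsBoxMap.eventually_const_atTop (hε : 0 < ε) (hF : IsBoxMap φ S ε F) {x : M}
    (hb : BddAbove (range (orbitVar φ F x))) :
    ∃ s, ∀ t ≥ s, orbitVar φ F x t = orbitVar φ F x s ∧ F (φ t x) = 0 := by
  have hinc := hF.increasesOffZero hε
  obtain ⟨w, hw⟩ := QuotientAddGroup.mk_surjective (F x)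
  set m := ⨆ t, orbitVar φ F x t with hm
  set k : ℤ := ⌈w + m⌉ - 1 with hk
  have hk1 : (k : ℝ) - w < m := by
    have := Int.ceil_lt_add_one (w + m)
    simp only [hk]; push_cast; linarith
  have hk2 : w + m ≤ k + 1 := by
    have := Int.le_ceil (w + m)
    simp only [hk]; push_cast; linarith
  obtain ⟨s, hs⟩ := exists_lt_of_lt_ciSup hk1
  have h1 : ∀ t ≥ s + 2 * ε, w + orbitVar φ F x t = k + 1 := by
    intro t ht
    refine le_antisymm (by have := le_ciSup hb t; linarith) ?_
    have h2 := hF.le_lift hε (coe_add_orbitVar x hw s) (k := k) (by linarith) (t := t - s)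
      (by linarith)
    rw [add_assoc w _ (orbitVar _ _ _ _), ← orbitVar_add, add_sub_cancel] at h2
    refine le_trans (le_min ?_ le_rfl) h2
    have : 1 ≤ (t - s) / (2 * ε) := by rw [le_div_iff₀ (by positivity)]; linarith
    linarith
  refine ⟨s + 2 * ε, fun t ht => ⟨by linarith [h1 t ht, h1 _ le_rfl], ?_⟩⟩
  rw [← coe_add_orbitVar x hw t, h1 t ht]
  exact_mod_cast coe_circle_int (k + 1)

/-- If k is the floor of the infimum and the lift is below k + 1 at time s, then it equals k before
s - 2ε: otherwise it would have reached k + 1 by time s. -/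
theorem IsBoxMap.eventually_const_atBot (hε : 0 < ε) (hF : IsBoxMap φ S ε F) {x : M}
    (hb : BddBelow (range (orbitVar φ F x))) :
    ∃ s, ∀ t ≤ s, orbitVar φ F x t = orbitVar φ F x s ∧ F (φ t x) = 0 := by
  have hinc := hF.increasesOffZero hε
  obtain ⟨w, hw⟩ := QuotientAddGroup.mk_surjective (F x)
  set m := ⨅ t, orbitVar φ F x t with hm
  set k : ℤ := ⌊w + m⌋ with hk
  have hk1 : m < k + 1 - w := by
    have := Int.lt_floor_add_one (w + m)
    linarith
  have hk2 : (k : ℝ) ≤ w + m := Int.floor_le (w + m)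
  obtain ⟨s, hs⟩ := exists_lt_of_ciInf_lt hk1
  have h1 : ∀ t ≤ s - 2 * ε, w + orbitVar φ F x t = k := by
    intro t ht
    refine le_antisymm ?_ (by have := ciInf_le hb t; linarith)
    by_contra hlt
    push Not at hlt
    have h2 := hF.le_lift hε (coe_add_orbitVar x hw t) (k := k) hlt (t := s - t)
      (by linarith)
    rw [add_assoc w _ (orbitVar _ _ _ _), ← orbitVar_add, add_sub_cancel] at h2
    have : 1 ≤ (s - t) / (2 * ε) := by rw [le_div_iff₀ (by positivity)]; linarith
    have := le_trans (le_min (by linarith) le_rfl) h2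
    linarith
  refine ⟨s - 2 * ε, fun t ht => ⟨by linarith [h1 t ht, h1 _ le_rfl], ?_⟩⟩
  rw [← coe_add_orbitVar x hw t, h1 t ht]
  exact_mod_cast coe_circle_int k

variable [CompactSpace M] [LocallyPathConnectedSpace M]

/-- A real map that vanishes on the recurrent set cannot compensate a positive variation. -/
theorem IsBoxMap.exists_pos (hε : 0 < ε) (hF : IsBoxMap φ S ε F) {h : C(M, ℝ)}
    (hh : ∀ y ∈ alphaRec φ (classOf F), h y = 0) {x : M} {t₁ : ℝ}
    (ht₁ : 0 < orbitVar φ F x t₁) : ∃ t, 0 < orbitVar φ F x t + h (φ t x) := by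
  have hinc := hF.increasesOffZero hε
  by_cases hb : BddAbove (range (orbitVar φ F x))
  · obtain ⟨s, hs⟩ := hF.eventually_const_atTop hε hb
    -- The late part of the orbit returns near y along arcs on which F vanishes identically, so y is
    -- recurrent and h is small near it.
    obtain ⟨y, hy⟩ := exists_clusterPt_of_compactSpace (Filter.map (fun t => φ t x) Filter.atTop)
    have hfr := mapClusterPt_iff_frequently.1 hy
    have hyR : y ∈ alphaRec φ (classOf F) := by
      refine mem_alphaRec_of_forall_nhds fun W hW L => ?_
      obtain ⟨a, has, haW⟩ := Filter.frequently_atTop.1 (hfr W hW) s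
      obtain ⟨b, hba, hbW⟩ := Filter.frequently_atTop.1 (hfr W hW) (a + max L 0)
      have hL := le_max_left L 0
      have hL0 := le_max_right L 0
      refine ⟨φ a x, haW, b - a, by linarith, ?_, fun r hr => ⟨?_, ?_⟩⟩
      · rw [← φ.map_add]; simpa using hbW
      · rw [← φ.map_add]; exact (hs _ (by linarith [hr.1])).2
      · have := orbitVar_add (φ := φ) (f := F) x a r
        rw [(hs (a + r) (by linarith [hr.1])).1, (hs a has).1] at this
        linarith
    have hsmall : ∀ᶠ z in 𝓝 y, |h z| < orbitVar φ F x t₁ :=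
      eventually_abs_lt_of_continuousAt h.continuous.continuousAt (hh y hyR) ht₁
    obtain ⟨t, ht, htW⟩ := Filter.frequently_atTop.1 (hfr _ hsmall) t₁
    have := hinc.orbitVar_mono x ht
    have h3 : |h (φ t x)| < orbitVar φ F x t₁ := htW
    exact ⟨t, by linarith [(abs_lt.1 h3).1]⟩
  · rw [not_bddAbove_iff] at hb
    obtain ⟨_, ⟨t, rfl⟩, ht⟩ := hb ‖h‖
    have := (abs_le.1 ((Real.norm_eq_abs _).symm.le.trans (h.norm_coe_le_norm (φ t x)))).1
    exact ⟨t, by linarith⟩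

theorem IsBoxMap.exists_neg (hε : 0 < ε) (hF : IsBoxMap φ S ε F) {h : C(M, ℝ)}
    (hh : ∀ y ∈ alphaRec φ (classOf F), h y = 0) {x : M} {t₁ : ℝ}
    (ht₁ : orbitVar φ F x t₁ < 0) : ∃ t, orbitVar φ F x t + h (φ t x) < 0 := by
  have hinc := hF.increasesOffZero hε
  by_cases hb : BddBelow (range (orbitVar φ F x))
  · obtain ⟨s, hs⟩ := hF.eventually_const_atBot hε hb
    obtain ⟨y, hy⟩ := exists_clusterPt_of_compactSpace (Filter.map (fun t => φ t x) Filter.atBot)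
    have hfr := mapClusterPt_iff_frequently.1 hy
    have hyR : y ∈ alphaRec φ (classOf F) := by
      refine mem_alphaRec_of_forall_nhds fun W hW L => ?_
      obtain ⟨b, hbs, hbW⟩ := Filter.frequently_atBot.1 (hfr W hW) s
      obtain ⟨a, hab, haW⟩ := Filter.frequently_atBot.1 (hfr W hW) (b - max L 0)
      have hL := le_max_left L 0
      have hL0 := le_max_right L 0
      refine ⟨φ a x, haW, b - a, by linarith, ?_, fun r hr => ⟨?_, ?_⟩⟩
      · rw [← φ.map_add]; simpa using hbW
      · rw [← φ.map_add]; exact (hs _ (by linarith [hr.2])).2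
      · have := orbitVar_add (φ := φ) (f := F) x a r
        rw [(hs (a + r) (by linarith [hr.2])).1, (hs a (by linarith)).1] at this
        linarith
    have hsmall : ∀ᶠ z in 𝓝 y, |h z| < -orbitVar φ F x t₁ :=
      eventually_abs_lt_of_continuousAt h.continuous.continuousAt (hh y hyR) (neg_pos.2 ht₁)
    obtain ⟨t, ht, htW⟩ := Filter.frequently_atBot.1 (hfr _ hsmall) t₁
    have := hinc.orbitVar_mono x ht
    have h3 : |h (φ t x)| < -orbitVar φ F x t₁ := htW
    exact ⟨t, by linarith [(abs_lt.1 h3).2]⟩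
  · rw [not_bddBelow_iff] at hb
    obtain ⟨_, ⟨t, rfl⟩, ht⟩ := hb (-‖h‖)
    have := (abs_le.1 ((Real.norm_eq_abs _).symm.le.trans (h.norm_coe_le_norm (φ t x)))).2
    exact ⟨t, by linarith⟩

end LimitSets

/-! ### Homotopies through pre-Lyapunov maps and isotopies along the flow -/

section Isotopy

/-- At a recurrent point all maps of the homotopy take the value 0, so the lift of the difference
keeps its initial value 0. -/
theorem exists_real_of_homotopicWith {M : Type*} [MetricSpace M] {φ : Flow ℝ M} {T : ℝ} {α : H1 M}
    {f g : C(M, UnitAddCircle)} (h : ContinuousMap.HomotopicWith f g (IsPLMap φ T α)) :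
    ∃ u : C(M, ℝ), (∀ x, g x = f x + (u x : UnitAddCircle)) ∧ ∀ x ∈ alphaRec φ α, u x = 0 := by
  obtain ⟨H⟩ := h
  obtain ⟨K, hK, hK0⟩ := exists_lift_of_homotopy
    (⟨fun p => H p - f p.2, by fun_prop⟩ : C(unitInterval × M, UnitAddCircle)) (fun x => by simp)
  refine ⟨⟨fun x => K (1, x), by fun_prop⟩, fun x => ?_, fun x hx => ?_⟩
  · simp [hK]
  · have hH : ∀ t, H (t, x) = 0 := fun t => (H.prop t).2.1 x hx
    have hf : f x = 0 := by simpa using hH 0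
    have := lift_sub_eq (isPreconnected_univ (α := unitInterval)) (u := fun t => K (t, x))
      (w := fun _ => 0) (by fun_prop) (by fun_prop) (fun t _ => by simp [hK, hH, hf])
      (mem_univ 1) (mem_univ 0)
    simpa [hK0] using this

/-- The position of the sign change of a continuous family of functions is continuous. -/
theorem continuous_of_sign_change {X : Type*} [TopologicalSpace X] {g : X × ℝ → ℝ}
    (hg : Continuous g) {θ : X → ℝ} (h0 : ∀ x, g (x, θ x) = 0)
    (hneg : ∀ x t, t < θ x → g (x, t) < 0) (hpos : ∀ x t, θ x < t → 0 < g (x, t)) :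
    Continuous θ := by
  rw [continuous_iff_continuousAt]
  intro x
  have hc : ∀ t, ContinuousAt (fun y => g (y, t)) x := fun t =>
    (hg.comp (by fun_prop : Continuous fun y : X => (y, t))).continuousAt
  refine tendsto_order.2 ⟨fun t ht => ?_, fun t ht => ?_⟩
  · filter_upwards [(hc t).eventually (gt_mem_nhds (hneg x t ht))] with y hy
    by_contra hle
    rcases (not_lt.1 hle).eq_or_lt with h | h
    · rw [← h, h0] at hy; exact lt_irrefl _ hy
    · exact lt_asymm hy (hpos y t h)
  · filter_upwards [(hc t).eventually (lt_mem_nhds (hpos x t ht))] with y hy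
    by_contra hle
    rcases (not_lt.1 hle).eq_or_lt with h | h
    · rw [h, h0] at hy; exact lt_irrefl _ hy
    · exact lt_asymm hy (hneg y t h)

theorem IsBoxMap.mem_iff {M : Type*} [TopologicalSpace M] {φ : Flow ℝ M} {S : Set M} {ε : ℝ}
    {F : C(M, UnitAddCircle)} (hε : 0 < ε) (hF : IsBoxMap φ S ε F) {x : M} :
    x ∈ S ↔ F x = ((1 / 2 : ℝ) : UnitAddCircle) := by
  rw [(hF.crossesPositively hε).mem_iff]
  change F x + ((1 / 2 : ℝ) : UnitAddCircle) = 0 ↔ _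
  have : (((1 / 2 : ℝ) : UnitAddCircle)) = -((1 / 2 : ℝ) : UnitAddCircle) := by
    rw [← AddCircle.coe_neg, coe_circle_eq_iff]
    exact ⟨1, by norm_num⟩
  rw [add_eq_zero_iff_eq_neg, ← this]

theorem half_ne_zero_circle : ((1 / 2 : ℝ) : UnitAddCircle) ≠ 0 := by
  intro h
  have := eq_zero_of_abs_lt_one h (by norm_num [abs_lt])
  norm_num at this

variable {M : Type*} [MetricSpace M] [CompactSpace M] [LocallyPathConnectedSpace M]
  {φ : Flow ℝ M} {S : Set M} {ε : ℝ} {F : C(M, UnitAddCircle)}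

theorem IsBoxMap.exists_orbitVar_add_eq_zero (hε : 0 < ε) (hF : IsBoxMap φ S ε F) {h : C(M, ℝ)}
    (hh : ∀ y ∈ alphaRec φ (classOf F), h y = 0) {x : M} (hx : x ∈ S) :
    ∃ t, orbitVar φ F x t + h (φ t x) = 0 := by
  have hinc := hF.increasesOffZero hε
  have hFx : F x ≠ 0 := by rw [(hF.mem_iff hε).1 hx]; exact half_ne_zero_circle
  obtain ⟨a, ha⟩ := hF.exists_pos hε hh (hinc.orbitVar_pos hFx one_pos)
  obtain ⟨b, hb⟩ := hF.exists_neg hε hh (hinc.orbitVar_neg hFx neg_one_lt_zero)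
  have hc : Continuous fun t => orbitVar φ F x t + h (φ t x) :=
    (continuous_orbitVar_right φ F x).add (h.continuous.comp (flow_orbit_continuous φ x))
  exact mem_range_of_exists_le_of_exists_ge hc ⟨b, hb.le⟩ ⟨a, ha.le⟩

/-- A box map is not homotopic to zero through pre-Lyapunov maps. -/
theorem IsBoxMap.not_homotopicWith_zero (hε : 0 < ε) (hF : IsBoxMap φ S ε F) (hS : S.Nonempty)
    {T : ℝ} : ¬ ContinuousMap.HomotopicWith F 0 (IsPLMap φ T (classOf F)) := by
  intro hom
  obtain ⟨u, hu, hu0⟩ := exists_real_of_homotopicWith hom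
  obtain ⟨x, hx⟩ := hS
  have hinc := hF.increasesOffZero hε
  have hFx : F x ≠ 0 := by rw [(hF.mem_iff hε).1 hx]; exact half_ne_zero_circle
  have hzero : ∀ t, orbitVar φ (0 : C(M, UnitAddCircle)) x t = 0 := fun t => by
    have := orbitVar_eq_of_lift (φ := φ) (f := (0 : C(M, UnitAddCircle))) (x := x)
      isPreconnected_univ (mem_univ 0) (u := fun _ => 0) continuousOn_const (by simp) (mem_univ t)
    simpa using this
  -- The constant map has no variation, so this quantity is constant on the orbit and cannot take
  -- both signs.
  have hconst : ∀ t, orbitVar φ F x t + u (φ t x) = u x := fun t => by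
    have := orbitVar_add_real (φ := φ) hu x t
    rw [hzero] at this
    linarith
  obtain ⟨a, ha⟩ := hF.exists_pos hε hu0 (hinc.orbitVar_pos hFx one_pos)
  obtain ⟨b, hb⟩ := hF.exists_neg hε hu0 (hinc.orbitVar_neg hFx neg_one_lt_zero)
  rw [hconst] at ha hb
  exact lt_asymm ha hb

theorem IsBoxMap.isotopicAlongFlow {S₀ S₁ : Set M} (hS₀ : IsCompact S₀) {ε₀ ε₁ : ℝ}
    (hε₀ : 0 < ε₀) (hε₁ : 0 < ε₁) {F₀ F₁ : C(M, UnitAddCircle)} (hF₀ : IsBoxMap φ S₀ ε₀ F₀)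
    (hF₁ : IsBoxMap φ S₁ ε₁ F₁) {T : ℝ}
    (hom : ContinuousMap.HomotopicWith F₀ F₁ (IsPLMap φ T (classOf F₀))) :
    IsotopicAlongFlow φ S₀ S₁ := by
  obtain ⟨u, hu, hu0⟩ := exists_real_of_homotopicWith hom
  have hcl : classOf F₀ = classOf F₁ := classOf_eq_iff.2 ⟨u, hu⟩
  have hinc₀ := hF₀.increasesOffZero hε₀
  have hinc₁ := hF₁.increasesOffZero hε₁
  have hV : ∀ x t, orbitVar φ F₀ x t + u (φ t x) = orbitVar φ F₁ x t + u x := fun x t => by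
    rw [orbitVar_add_real hu]; ring
  choose θ hθ using fun x : S₀ => hF₀.exists_orbitVar_add_eq_zero hε₀ hu0 x.2
  -- the endpoint of the orbit arc lies on the second section
  have hend : ∀ (x : M) (t : ℝ), x ∈ S₀ → orbitVar φ F₀ x t + u (φ t x) = 0 → φ t x ∈ S₁ := by
    intro x t hx ht
    rw [hF₁.mem_iff hε₁, hu, ← (hF₀.mem_iff hε₀).1 hx]
    have h1 := coe_orbitVar φ F₀ x t
    have h2 : (u (φ t x) : UnitAddCircle) = -(orbitVar φ F₀ x t : UnitAddCircle) := by
      rw [← AddCircle.coe_neg]; congr 1; linarith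
    rw [h2, h1]; abel
  -- Measured from a zero s, the function is the variation of F₁ from a point of S₁, hence has a
  -- strict sign on either side. This gives uniqueness and continuity of the hitting time.
  have hsign : ∀ (x : M) (s t : ℝ), x ∈ S₀ → orbitVar φ F₀ x s + u (φ s x) = 0 →
      orbitVar φ F₀ x t + u (φ t x) = orbitVar φ F₁ (φ s x) (t - s) := by
    intro x s t hx hs
    have h1 := orbitVar_add (φ := φ) (f := F₁) x s (t - s)
    rw [add_sub_cancel] at h1
    have h2 := hV x s
    rw [hV, h1]; linarith
  have hne : ∀ (x : M) (s : ℝ), x ∈ S₀ → orbitVar φ F₀ x s + u (φ s x) = 0 →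
      F₁ (φ s x) ≠ 0 := by
    intro x s hx hs
    rw [(hF₁.mem_iff hε₁).1 (hend x s hx hs)]; exact half_ne_zero_circle
  have hpos : ∀ (x : S₀) (t : ℝ), θ x < t → 0 < orbitVar φ F₀ x t + u (φ t x) := by
    intro x t ht
    rw [hsign x (θ x) t x.2 (hθ x)]
    exact hinc₁.orbitVar_pos (hne x _ x.2 (hθ x)) (sub_pos.2 ht)
  have hneg : ∀ (x : S₀) (t : ℝ), t < θ x → orbitVar φ F₀ x t + u (φ t x) < 0 := by
    intro x t ht
    rw [hsign x (θ x) t x.2 (hθ x)]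
    exact hinc₁.orbitVar_neg (hne x _ x.2 (hθ x)) (sub_neg.2 ht)
  have hθc : Continuous θ := by
    refine continuous_of_sign_change
      (g := fun p : S₀ × ℝ => orbitVar φ F₀ p.1 p.2 + u (φ p.2 p.1)) ?_ hθ hneg hpos
    refine ((continuous_orbitVar φ F₀).comp
      (by fun_prop : Continuous fun p : S₀ × ℝ => ((p.1 : M), p.2))).add (u.continuous.comp ?_)
    exact φ.continuous (by fun_prop) (by fun_prop)
  -- Points of S₀ on one orbit have images on S₁ in the same order, since F₀ strictly rises between
  -- them.
  have hmono : ∀ (x y : S₀) (s : ℝ), 0 < s → φ s (x : M) = y → θ x < s + θ y := by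
    intro x y s hs hxy
    by_contra hle
    have h1 : orbitVar φ F₀ x (s + θ y) + u (φ (s + θ y) x) ≤ 0 := by
      rcases (not_lt.1 hle).eq_or_lt with h | h
      · rw [h, hθ x]
      · exact (hneg x _ h).le
    rw [orbitVar_add, add_comm s, φ.map_add, hxy] at h1
    have h2 := hθ y
    have h3 : 0 < orbitVar φ F₀ x s := hinc₀.orbitVar_pos
      (by rw [(hF₀.mem_iff hε₀).1 x.2]; exact half_ne_zero_circle) hs
    linarith
  have : CompactSpace S₀ := isCompact_iff_compactSpace.1 hS₀
  refine ⟨⟨fun p => (p.1 : ℝ) * θ p.2, by fun_prop⟩, fun x => by simp, fun t => ?_, ?_⟩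
  · refine (Continuous.isClosedEmbedding (φ.continuous (by fun_prop) (by fun_prop)) ?_).isEmbedding
    -- If the displaced points coincided with tθ(x) > tθ(y), then y would be later than x by that
    -- difference, and the preserved order would give (1 - t)(θ(x) - θ(y)) < 0.
    have hle : ∀ x y : S₀, φ ((t : ℝ) * θ x) (x : M) = φ ((t : ℝ) * θ y) (y : M) →
        (t : ℝ) * θ x - t * θ y ≤ 0 := by
      intro x y hxy
      by_contra hs
      push Not at hs
      have e : φ ((t : ℝ) * θ x - t * θ y) (x : M) = y := by
        rw [sub_eq_neg_add, φ.map_add, hxy, flow_neg_apply]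
      have h1 := hmono x y _ hs e
      have ht0 := t.2.1
      have ht1 := t.2.2
      have hD : 0 < θ x - θ y := by
        by_contra hD
        nlinarith [mul_nonneg ht0 (sub_nonneg.2 (sub_nonpos.1 (not_lt.1 hD)))]
      nlinarith [mul_nonneg (sub_nonneg.2 ht1) hD.le]
    intro x y hxy
    change φ ((t : ℝ) * θ x) (x : M) = φ ((t : ℝ) * θ y) (y : M) at hxy
    have h1 := hle x y hxy
    have h2 := hle y x hxy.symm
    have h3 : (t : ℝ) * θ x = t * θ y := by linarith
    rw [h3] at hxy
    exact Subtype.ext ((φ.toHomeomorph _).injective hxy)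
  · ext y
    have hone : ∀ x : S₀, ((1 : unitInterval) : ℝ) * θ x = θ x := fun x => one_mul _
    simp only [ContinuousMap.coe_mk, hone, mem_range]
    constructor
    · rintro ⟨x, rfl⟩
      exact hend x _ x.2 (hθ x)
    · intro hy
      -- Surjectivity comes from exchanging the two box maps, which replaces u by -u; uniqueness
      -- identifies the resulting time with -θ.
      obtain ⟨t, ht⟩ := hF₁.exists_orbitVar_add_eq_zero hε₁ (h := -u)
        (fun z hz => by simp [hu0 z (hcl ▸ hz)]) hy
      have ht' : orbitVar φ F₁ y t = u (φ t y) := by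
        have : orbitVar φ F₁ y t + -u (φ t y) = 0 := ht
        linarith
      have hx : φ t y ∈ S₀ := by
        rw [hF₀.mem_iff hε₀, ← (hF₁.mem_iff hε₁).1 hy]
        have h1 := coe_orbitVar φ F₁ y t
        rw [ht', hu (φ t y)] at h1
        have h2 : F₀ (φ t y) =
            F₁ y + (u (φ t y) : UnitAddCircle) - (u (φ t y) : UnitAddCircle) := by
          nth_rewrite 1 [h1]; abel
        rw [h2]; abel
      have hz : orbitVar φ F₀ (φ t y) (-t) + u (φ (-t) (φ t y)) = 0 := by
        have := orbitVar_add (φ := φ) (f := F₁) y t (-t)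
        rw [add_neg_cancel, orbitVar_zero] at this
        rw [hV]; linarith
      have hθt : θ ⟨φ t y, hx⟩ = -t := by
        rcases lt_trichotomy (θ ⟨φ t y, hx⟩) (-t) with h | h | h
        · exact absurd hz (hpos ⟨φ t y, hx⟩ _ h).ne'
        · exact h
        · exact absurd hz (hneg ⟨φ t y, hx⟩ _ h).ne
      exact ⟨⟨φ t y, hx⟩, by rw [hθt]; exact flow_neg_apply φ t y⟩

end Isotopy

/-! ### The no-retraction theorem -/

section NoRetraction

open MeasureTheory

/-- Lagrange extrapolation from nodes in [0, t₀) to 1. It carries an identity known only for small t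
over to t = 1 with a fixed finite combination, which commutes with integration. -/
theorem exists_interpolation_weights (d : ℕ) {t₀ : ℝ} (ht₀ : 0 < t₀) :
    ∃ v c : ℕ → ℝ, (∀ i ∈ Finset.range (d + 1), 0 ≤ v i ∧ v i < t₀) ∧
      ∑ i ∈ Finset.range (d + 1), c i = 1 ∧
      ∀ p : Polynomial ℝ, p.natDegree ≤ d →
        p.eval 1 = ∑ i ∈ Finset.range (d + 1), c i * p.eval (v i) := by
  set v : ℕ → ℝ := fun i => t₀ * (i / (d + 1)) with hv
  have hinj : InjOn v (Finset.range (d + 1)) := by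
    intro i _ j _ hij
    simp only [hv] at hij
    have hd : (d : ℝ) + 1 ≠ 0 := by positivity
    field_simp at hij
    exact_mod_cast hij
  refine ⟨v, fun i => (Lagrange.basis (Finset.range (d + 1)) v i).eval 1, fun i hi => ⟨?_, ?_⟩,
    ?_, fun p hp => ?_⟩
  · simp only [hv]; positivity
  · have : (i : ℝ) < d + 1 := by exact_mod_cast Finset.mem_range.1 hi
    simp only [hv]
    exact mul_lt_of_lt_one_right ht₀ ((div_lt_one (by positivity)).2 this)
  · rw [← Polynomial.eval_finsetSum, Lagrange.sum_basis hinj ⟨0, by simp⟩, Polynomial.eval_one]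
  · have h := Lagrange.eq_interpolate hinj (f := p) (by
      rw [Finset.card_range]
      exact (Polynomial.degree_le_of_natDegree_le hp).trans_lt
        (by exact_mod_cast Nat.lt_succ_self d))
    conv_lhs => rw [h]
    rw [Lagrange.interpolate_apply, Polynomial.eval_finsetSum]
    refine Finset.sum_congr rfl fun i _ => ?_
    simp [mul_comm]

variable {E : Type*} [NormedAddCommGroup E] [InnerProductSpace ℝ E] [FiniteDimensional ℝ E]

theorem exists_polynomial_det_one_add_smul (A : E →L[ℝ] E) :
    ∃ p : Polynomial ℝ, p.natDegree ≤ Module.finrank ℝ E ∧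
      ∀ t : ℝ, p.eval t = (ContinuousLinearMap.id ℝ E + t • A).det := by
  let b := Module.finBasis ℝ E
  let B := LinearMap.toMatrix b b (A : E →ₗ[ℝ] E)
  refine ⟨Matrix.det ((Polynomial.X : Polynomial ℝ) • B.map Polynomial.C +
    (1 : Matrix _ _ ℝ).map Polynomial.C), ?_, fun t => ?_⟩
  · simpa using Polynomial.natDegree_det_X_add_C_le B 1
  · rw [← Polynomial.coe_evalRingHom, RingHom.map_det]
    change _ = LinearMap.det ((ContinuousLinearMap.id ℝ E + t • A : E →L[ℝ] E) : E →ₗ[ℝ] E)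
    rw [← LinearMap.det_toMatrix b]
    congr 1
    ext i j
    simp [B, LinearMap.toMatrix_apply, Matrix.one_apply, Finsupp.single_apply, eq_comm]
    split_ifs <;> simp [mul_comm, add_comm]

theorem det_eq_zero_of_range_ne_top {A : E →L[ℝ] E} (h : (A : E →ₗ[ℝ] E).range ≠ ⊤) :
    A.det = 0 := by
  by_contra hne
  refine h (LinearMap.range_eq_top.2 (LinearMap.injective_iff_surjective.1 ?_))
  exact (LinearEquiv.ofIsUnitDet (f := (A : E →ₗ[ℝ] E)) (v := Module.finBasis ℝ E)
    (v' := Module.finBasis ℝ E) (by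
      rw [LinearMap.det_toMatrix]; exact isUnit_iff_ne_zero.2 hne)).injective

/-- The determinant is 1 at parameter 0 and cannot vanish on the way: a kernel vector x would
satisfy ‖x‖ = s‖Ax‖ < ‖x‖. -/
theorem det_pos_of_norm_smul_lt {A : E →L[ℝ] E} {t : ℝ} (ht : 0 ≤ t) (h : t * ‖A‖ < 1) :
    0 < (ContinuousLinearMap.id ℝ E + t • A).det := by
  have hne : ∀ s ∈ Icc 0 t, (ContinuousLinearMap.id ℝ E + s • A).det ≠ 0 := by
    intro s hs h0
    change LinearMap.det ((ContinuousLinearMap.id ℝ E + s • A : E →L[ℝ] E) : E →ₗ[ℝ] E) = 0 at h0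
    obtain ⟨x, hx, hx0⟩ := (Submodule.ne_bot_iff _).1 (LinearMap.bot_lt_ker_of_det_eq_zero h0).ne'
    have h1 : x + s • A x = 0 := by simpa using hx
    have h2 : ‖x‖ = s * ‖A x‖ := by
      conv_lhs => rw [eq_neg_of_add_eq_zero_left h1]
      rw [norm_neg, norm_smul, Real.norm_of_nonneg hs.1]
    have h3 := A.le_opNorm x
    have h4 : 0 < ‖x‖ := norm_pos_iff.2 hx0
    have h5 : s * ‖A x‖ ≤ t * ‖A‖ * ‖x‖ := by
      calc s * ‖A x‖ ≤ t * (‖A‖ * ‖x‖) := by gcongr; exact hs.2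
        _ = _ := by ring
    nlinarith
  by_contra hle
  have hc : Continuous fun s : ℝ => (ContinuousLinearMap.id ℝ E + s • A).det :=
    ContinuousLinearMap.continuous_det.comp (by fun_prop)
  obtain ⟨s, hs, hs0⟩ := intermediate_value_Icc' ht hc.continuousOn
    (show (0 : ℝ) ∈ Icc _ _ from ⟨not_lt.1 hle, by simp [ContinuousLinearMap.det]⟩)
  exact hne s hs hs0

variable [MeasurableSpace E] [BorelSpace E]

/-- There is no continuously differentiable retraction of a ball onto its boundary sphere. -/
theorem no_contDiff_retraction {R : ℝ} (hR : 0 < R) {r : E → E} (hr : ContDiff ℝ 1 r)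
    (hn : ∀ x, ‖r x‖ = R) (hs : ∀ x, ‖x‖ = R → r x = x) : False := by
  set g : E → E := fun x => r x - x with hg
  have hgd : ContDiff ℝ 1 g := hr.sub contDiff_id
  have hgD : Differentiable ℝ g := hgd.differentiable one_ne_zero
  have hDc : Continuous (fderiv ℝ g) := hgd.continuous_fderiv one_ne_zero
  obtain ⟨C, hC⟩ := (isCompact_closedBall (0 : E) R).exists_bound_of_continuousOn hDc.continuousOn
  have hC0 : 0 ≤ C := (norm_nonneg _).trans (hC 0 (by simp [hR.le]))
  set t₀ := 1 / (C + 1) with ht₀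
  have ht₀0 : 0 < t₀ := by positivity
  have ht₀1 : t₀ ≤ 1 := by rw [ht₀, div_le_one (by positivity)]; linarith
  have htC : ∀ t, 0 ≤ t → t < t₀ → t * C < 1 := by
    intro t ht htt
    have : t * (C + 1) < 1 := by rwa [ht₀, lt_div_iff₀ (by positivity)] at htt
    nlinarith
  have hlip : ∀ x ∈ Metric.closedBall (0 : E) R, ∀ y ∈ Metric.closedBall (0 : E) R,
      ‖g y - g x‖ ≤ C * ‖y - x‖ := fun x hx y hy =>
    (convex_closedBall 0 R).norm_image_sub_le_of_norm_fderiv_le (𝕜 := ℝ)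
      (fun z _ => hgD z) hC hx hy
  have hder : ∀ (t : ℝ) (x : E), HasStrictFDerivAt (fun x => x + t • g x)
      (ContinuousLinearMap.id ℝ E + t • fderiv ℝ g x) x := fun t x =>
    (hasStrictFDerivAt_id x).add
      (((hgd.contDiffAt.hasStrictFDerivAt one_ne_zero)).const_smul t)
  -- For small t the map (1 - t)id + tr is a diffeomorphism of the open ball onto itself. The
  -- integrated determinant is a polynomial in t that equals the volume for small t, yet at t = 1
  -- the integrand is det Dr = 0.
  have hvol : ∀ t, 0 ≤ t → t < t₀ → ∫ x in Metric.ball (0 : E) R,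
      (ContinuousLinearMap.id ℝ E + t • fderiv ℝ g x).det =
        volume.real (Metric.ball (0 : E) R) := by
    intro t ht htt
    have ht1 : t < 1 := htt.trans_le ht₀1
    have hdet : ∀ x ∈ Metric.closedBall (0 : E) R,
        0 < (ContinuousLinearMap.id ℝ E + t • fderiv ℝ g x).det := fun x hx =>
      det_pos_of_norm_smul_lt ht
        ((mul_le_mul_of_nonneg_left (hC x hx) ht).trans_lt (htC t ht htt))
    have hinj : InjOn (fun x => x + t • g x) (Metric.closedBall (0 : E) R) := by
      intro x hx y hy hxy
      by_contra hne
      have h1 : y - x = t • (g x - g y) := by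
        have h0 : x + t • g x = y + t • g y := hxy
        rw [smul_sub, sub_eq_sub_iff_add_eq_add, ← h0, add_comm]
      have h2 : ‖y - x‖ = t * ‖g x - g y‖ := by
        rw [h1, norm_smul, Real.norm_of_nonneg ht]
      have h3 := hlip y hy x hx
      rw [norm_sub_rev x y] at h3
      have h4 : 0 < ‖y - x‖ := norm_pos_iff.2 (sub_ne_zero.2 (Ne.symm hne))
      have h5 := mul_le_mul_of_nonneg_left h3 ht
      have := htC t ht htt
      nlinarith
    have hconv : ∀ x, x + t • g x = (1 - t) • x + t • r x := by
      intro x; simp only [hg]; module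
    have hmaps : ∀ x ∈ Metric.ball (0 : E) R, x + t • g x ∈ Metric.ball (0 : E) R := by
      intro x hx
      rw [mem_ball_zero_iff] at hx ⊢
      rw [hconv]
      calc ‖(1 - t) • x + t • r x‖ ≤ ‖(1 - t) • x‖ + ‖t • r x‖ := norm_add_le _ _
        _ = (1 - t) * ‖x‖ + t * R := by
          rw [norm_smul, norm_smul, hn, Real.norm_of_nonneg ht,
            Real.norm_of_nonneg (by linarith)]
        _ < R := by nlinarith
    have himg : (fun x => x + t • g x) '' Metric.ball (0 : E) R = Metric.ball (0 : E) R := by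
      refine Subset.antisymm (image_subset_iff.2 hmaps) ?_
      -- The image is open since the derivative is onto. It is closed in the ball since a limit
      -- point comes from the closed ball, whose boundary is fixed.
      refine (convex_ball (0 : E) R).isPreconnected.subset_of_closure_inter_subset ?_ ?_ ?_
      · rw [isOpen_iff_mem_nhds]
        rintro _ ⟨x, hx, rfl⟩
        have hd := hdet x (Metric.ball_subset_closedBall hx)
        have hsurj : (ContinuousLinearMap.id ℝ E + t • fderiv ℝ g x).range = ⊤ := by
          by_contra hne
          exact hd.ne' (det_eq_zero_of_range_ne_top hne)
        rw [← (hder t x).map_nhds_eq_of_surj hsurj]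
        exact Filter.image_mem_map (Metric.isOpen_ball.mem_nhds hx)
      · exact ⟨_, hmaps 0 (by simpa using hR), 0, by simpa using hR, rfl⟩
      · rintro y ⟨hy, hyb⟩
        have hc : IsCompact ((fun x => x + t • g x) '' Metric.closedBall (0 : E) R) :=
          (isCompact_closedBall 0 R).image (by fun_prop)
        obtain ⟨x, hx, rfl⟩ := closure_minimal (image_mono Metric.ball_subset_closedBall)
          hc.isClosed hy
        refine ⟨x, ?_, rfl⟩
        rw [mem_closedBall_zero_iff] at hx
        rw [mem_ball_zero_iff]
        refine lt_of_le_of_ne hx fun hxR => ?_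
        have : x + t • g x = x := by simp [hg, hs x hxR]
        simp only at hyb
        rw [this, mem_ball_zero_iff, hxR] at hyb
        exact lt_irrefl _ hyb
    have h := integral_image_eq_integral_abs_det_fderiv_smul volume measurableSet_ball
      (fun x _ => (hder t x).hasFDerivAt.hasFDerivWithinAt)
      (hinj.mono Metric.ball_subset_closedBall) (fun _ => (1 : ℝ))
    rw [himg] at h
    simp only [smul_eq_mul, mul_one, integral_const, measureReal_restrict_apply_univ] at h
    rw [h]
    refine setIntegral_congr_fun measurableSet_ball fun x hx => ?_
    exact (abs_of_pos (hdet x (Metric.ball_subset_closedBall hx))).symm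
  obtain ⟨v, c, hv, hc, hpoly⟩ := exists_interpolation_weights (Module.finrank ℝ E) ht₀0
  have hsum : ∀ x, ∑ i ∈ Finset.range (Module.finrank ℝ E + 1),
      c i * (ContinuousLinearMap.id ℝ E + v i • fderiv ℝ g x).det = 0 := by
    intro x
    obtain ⟨p, hp, hpe⟩ := exists_polynomial_det_one_add_smul (fderiv ℝ g x)
    have h1 := hpoly p hp
    simp only [hpe] at h1
    rw [← h1, one_smul]
    have hrD : HasFDerivAt r (fderiv ℝ r x) x := (hr.differentiable one_ne_zero x).hasFDerivAt
    have hgx : fderiv ℝ g x = fderiv ℝ r x - ContinuousLinearMap.id ℝ E :=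
      (hrD.sub (hasFDerivAt_id x)).fderiv
    rw [hgx, add_sub_cancel]
    -- Differentiating the constant ‖r‖² shows that the derivative of r misses the direction r(x),
    -- so it is singular.
    have horth : ∀ w, inner ℝ (r x) (fderiv ℝ r x w) = 0 := by
      intro w
      have h2 := (hrD.norm_sq).unique (f := fun y => ‖r y‖ ^ 2) (f₁' := 0) (by
        simp only [hn]; exact hasFDerivAt_const _ _)
      have h3 := congrArg (fun L : E →L[ℝ] ℝ => L w) h2
      simpa using h3
    refine det_eq_zero_of_range_ne_top fun htop => ?_
    obtain ⟨w, hw⟩ := LinearMap.range_eq_top.1 htop (r x)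
    have := horth w
    change fderiv ℝ r x w = r x at hw
    rw [hw, real_inner_self_eq_norm_sq, hn] at this
    exact (pow_pos hR 2).ne' this
  have hint : ∀ t : ℝ, IntegrableOn
      (fun x => (ContinuousLinearMap.id ℝ E + t • fderiv ℝ g x).det) (Metric.ball (0 : E) R) :=
    fun t => (ContinuousOn.integrableOn_compact (isCompact_closedBall 0 R)
      (ContinuousLinearMap.continuous_det.comp (by fun_prop)).continuousOn).mono_set
      Metric.ball_subset_closedBall
  have h0 : ∫ x in Metric.ball (0 : E) R, ∑ i ∈ Finset.range (Module.finrank ℝ E + 1),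
      c i * (ContinuousLinearMap.id ℝ E + v i • fderiv ℝ g x).det = 0 := by
    simp only [hsum, integral_zero]
  rw [integral_finsetSum _ (fun i _ => (hint (v i)).const_mul (c i))] at h0
  simp only [integral_const_mul] at h0
  rw [Finset.sum_congr rfl (fun i hi => by rw [hvol (v i) (hv i hi).1 (hv i hi).2]),
    ← Finset.sum_mul, hc, one_mul] at h0
  have : 0 < volume.real (Metric.ball (0 : E) R) :=
    ENNReal.toReal_pos (Metric.measure_ball_pos volume 0 hR).ne' measure_ball_lt_top.ne
  exact this.ne' h0

omit [MeasurableSpace E] [BorelSpace E] in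
/-- A continuous map of a Euclidean space that is the identity outside a ball has a zero. -/
theorem exists_zero_of_eq_id_outside_ball {ρ : ℝ} (hρ : 0 < ρ) {k : E → E} (hk : Continuous k)
    (hid : ∀ x, ρ ≤ ‖x‖ → k x = x) : ∃ x, k x = 0 := by
  by_contra hne
  push Not at hne
  borelize E
  obtain ⟨c, hc, hck⟩ : ∃ c > 0, ∀ x, c ≤ ‖k x‖ := by
    obtain ⟨x₀, -, hx₀⟩ := (isCompact_closedBall (0 : E) ρ).exists_isMinOn ⟨0, by simp [hρ.le]⟩
      (hk.norm.continuousOn)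
    refine ⟨min ‖k x₀‖ ρ, lt_min (norm_pos_iff.2 (hne _)) hρ, fun x => ?_⟩
    rcases le_total ‖x‖ ρ with h | h
    · exact (min_le_left _ _).trans (hx₀ (by simpa using h))
    · rw [hid x h]; exact (min_le_right _ _).trans h
  set l : E → E := fun x => k x - x with hl
  have hlc : Continuous l := hk.sub continuous_id
  have hl0 : ∀ x, ρ ≤ ‖x‖ → l x = 0 := fun x hx => by simp [hl, hid x hx]
  have hsupp : HasCompactSupport l := by
    refine HasCompactSupport.intro (isCompact_closedBall (0 : E) ρ) fun x hx => hl0 x ?_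
    rw [mem_closedBall_zero_iff, not_le] at hx
    exact hx.le
  have hunif := hsupp.uniformContinuous_of_continuous hlc
  obtain ⟨δ, hδ, hlδ⟩ := Metric.uniformContinuous_iff.1 hunif (c / 2) (by positivity)
  have hm : 0 < min δ ρ := lt_min hδ hρ
  let b : ContDiffBump (0 : E) := ⟨min δ ρ / 2, min δ ρ, by positivity, by linarith⟩
  -- Mollifying the compactly supported part k - id at radius at most ρ moves it by at most c/2, so
  -- the smooth map still has no zero; it is the identity from radius 2ρ on and normalises to a
  -- retraction.
  set q : E → E := MeasureTheory.convolution (b.normed volume) l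
    (ContinuousLinearMap.lsmul ℝ ℝ) volume with hq
  have hqd : ContDiff ℝ 1 q := b.hasCompactSupport_normed.contDiff_convolution_left _
    b.contDiff_normed (hlc.locallyIntegrable)
  have hql : ∀ x, dist (q x) (l x) ≤ c / 2 := fun x =>
    ContDiffBump.dist_normed_convolution_le hlc.aestronglyMeasurable fun y hy =>
      (hlδ (lt_of_lt_of_le hy (min_le_left _ _))).le
  have hq0 : ∀ x, 2 * ρ ≤ ‖x‖ → q x = 0 := by
    intro x hx
    have hlx : l x = 0 := hl0 x (by linarith)
    have h1 : dist (q x) (l x) ≤ 0 :=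
      ContDiffBump.dist_normed_convolution_le hlc.aestronglyMeasurable fun y hy => by
        have h2 : dist y x < ρ := lt_of_lt_of_le hy (min_le_right _ _)
        rw [hlx, hl0 y (by
          have := norm_sub_norm_le x y
          rw [← dist_eq_norm, dist_comm] at this
          linarith), dist_self]
    rw [← hlx]; exact dist_le_zero.1 h1
  have hQ : ∀ x, x + q x ≠ 0 := by
    intro x h0
    have h1 := hql x
    have h2 : q x - l x = -k x := by
      rw [eq_neg_of_add_eq_zero_right h0]; simp only [hl]; abel
    rw [dist_eq_norm, h2, norm_neg] at h1
    linarith [hck x]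
  have hQd : ContDiff ℝ 1 fun x => x + q x := contDiff_id.add hqd
  refine no_contDiff_retraction (R := 2 * ρ) (by positivity)
    (r := fun x => (2 * ρ / ‖x + q x‖) • (x + q x)) ?_ (fun x => ?_) (fun x hx => ?_)
  · exact (contDiff_const.div (hQd.norm ℝ hQ) (fun x => norm_ne_zero_iff.2 (hQ x))).smul hQd
  · have := norm_pos_iff.2 (hQ x)
    rw [norm_smul, Real.norm_of_nonneg (by positivity)]
    field_simp
  · simp only [hq0 x hx.ge, add_zero, hx]
    rw [div_self (by positivity), one_smul]

omit [MeasurableSpace E] [BorelSpace E] in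
/-- The identity of a closed ball cannot be deformed away from the centre without passing through
the centre at a positive time. -/
theorem false_of_deformation_off_center {ρ : ℝ} (hρ : 0 < ρ) {K : ℝ × E → E}
    (hK : ContinuousOn K (Icc 0 1 ×ˢ Metric.closedBall 0 ρ))
    (h0 : ∀ z ∈ Metric.closedBall (0 : E) ρ, K (0, z) = z)
    (hne : ∀ s ∈ Icc (0 : ℝ) 1, ∀ z ∈ Metric.closedBall (0 : E) ρ, K (s, z) = 0 → s = 0) :
    False := by
  classical
  -- The deformation time runs from 1 at the centre to 0 on the sphere, where it matches the
  -- identity. A zero then lies inside the ball and has positive time.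
  set k : E → E := fun x => if ‖x‖ ≤ ρ then K (1 - ‖x‖ / ρ, x) else x with hk
  have hout : ∀ x, ρ ≤ ‖x‖ → k x = x := by
    intro x hx
    by_cases h : ‖x‖ ≤ ρ
    · have : ‖x‖ = ρ := le_antisymm h hx
      simp only [hk, if_pos h]
      rw [this, div_self hρ.ne', sub_self, h0 x (by simpa using h)]
    · simp only [hk, if_neg h]
  have hin : ∀ x ∈ Metric.closedBall (0 : E) ρ, 1 - ‖x‖ / ρ ∈ Icc (0 : ℝ) 1 := by
    intro x hx
    rw [mem_closedBall_zero_iff] at hx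
    have h1 : ‖x‖ / ρ ≤ 1 := (div_le_one hρ).2 hx
    have h2 : 0 ≤ ‖x‖ / ρ := by positivity
    constructor <;> linarith
  have hkc : Continuous k := by
    have c1 : ContinuousOn k (Metric.closedBall (0 : E) ρ) := by
      have hc : ContinuousOn (fun x : E => (1 - ‖x‖ / ρ, x)) (Metric.closedBall (0 : E) ρ) :=
        (by fun_prop : Continuous fun x : E => (1 - ‖x‖ / ρ, x)).continuousOn
      refine (hK.comp hc fun x hx => ⟨hin x hx, hx⟩).congr fun x hx => ?_
      rw [mem_closedBall_zero_iff] at hx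
      simp only [hk, if_pos hx, Function.comp]
    have c2 : ContinuousOn k {x | ρ ≤ ‖x‖} := continuousOn_id.congr hout
    have := c1.union_of_isClosed c2 Metric.isClosed_closedBall
      (isClosed_le continuous_const continuous_norm)
    rwa [show Metric.closedBall (0 : E) ρ ∪ {x | ρ ≤ ‖x‖} = univ from
      eq_univ_of_forall fun x => (le_total ‖x‖ ρ).imp (by simp) id, continuousOn_univ] at this
  obtain ⟨x, hx⟩ := exists_zero_of_eq_id_outside_ball hρ hkc hout
  have hxρ : ‖x‖ < ρ := by
    by_contra h
    have := hout x (not_lt.1 h)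
    rw [hx] at this
    rw [← this, norm_zero] at h
    exact h hρ
  have hxb : x ∈ Metric.closedBall (0 : E) ρ := by simpa using hxρ.le
  have h1 : K (1 - ‖x‖ / ρ, x) = 0 := by
    simpa only [hk, if_pos hxρ.le] using hx
  have h2 := hne _ (hin x hxb) x hxb h1
  have h3 : ‖x‖ / ρ < 1 := (div_lt_one hρ).2 hxρ
  linarith

end NoRetraction

/-! ### Boundary points of half-spaces -/

section HalfSpaceBoundary

/-- Translation of the half-space by `max s 0` in the inward direction. -/
noncomputable def pushInside {d : ℕ} (i : Fin d) (s : ℝ) (v : HalfSpace d) : HalfSpace d :=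
  ⟨(v : EuclideanSpace ℝ (Fin d)) + max s 0 • EuclideanSpace.single i 1, fun j hj => by
    have h1 := v.2 j hj
    have h2 : (0 : ℝ) ≤ (EuclideanSpace.single i (1 : ℝ) : EuclideanSpace ℝ (Fin d)) j := by
      simp only [PiLp.single_apply]
      split_ifs <;> norm_num
    have h3 := le_max_right s 0
    simp only [PiLp.add_apply, PiLp.smul_apply, smul_eq_mul]
    positivity⟩

theorem pushInside_zero {d : ℕ} (i : Fin d) (v : HalfSpace d) : pushInside i 0 v = v :=
  Subtype.ext (by simp [pushInside])

theorem pushInside_apply {d : ℕ} (i : Fin d) {s : ℝ} (hs : 0 ≤ s) (v : HalfSpace d) :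
    (pushInside i s v : EuclideanSpace ℝ (Fin d)) i =
      (v : EuclideanSpace ℝ (Fin d)) i + s := by
  simp [pushInside, hs]

theorem continuous_pushInside {d : ℕ} (i : Fin d) :
    Continuous fun p : ℝ × HalfSpace d => pushInside i p.1 p.2 :=
  Continuous.subtype_mk (by fun_prop) _

/-- A boundary point of `HalfSpace d × ℝ` has no Euclidean neighbourhood. -/
theorem false_of_euclidean_chart {E : Type*} [NormedAddCommGroup E] [InnerProductSpace ℝ E]
    [FiniteDimensional ℝ E] {d : ℕ} (χ : OpenPartialHomeomorph (HalfSpace d × ℝ) E)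
    {p₀ : HalfSpace d × ℝ} (hp : p₀ ∈ χ.source) {i : Fin d} (hi : i.val = 0)
    (h0 : (p₀.1 : EuclideanSpace ℝ (Fin d)) i = 0) : False := by
  set z₀ := χ p₀
  set P : ℝ × E → HalfSpace d × ℝ := fun q =>
    (pushInside i q.1 (χ.symm (q.2 + z₀)).1, (χ.symm (q.2 + z₀)).2) with hP
  have hsymm : ContinuousOn (fun q : ℝ × E => χ.symm (q.2 + z₀)) {q | q.2 + z₀ ∈ χ.target} :=
    χ.continuousOn_symm.comp (by fun_prop) fun q hq => hq
  have hPc : ContinuousOn P {q | q.2 + z₀ ∈ χ.target} :=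
    ((continuous_pushInside i).comp_continuousOn
      (continuousOn_fst.prodMk (continuous_fst.comp_continuousOn hsymm))).prodMk
      (continuous_snd.comp_continuousOn hsymm)
  have hopen : IsOpen {q : ℝ × E | q.2 + z₀ ∈ χ.target} :=
    χ.open_target.preimage (by fun_prop)
  have h00 : ((0 : ℝ), (0 : E)) ∈ {q : ℝ × E | q.2 + z₀ ∈ χ.target} := by
    simpa [z₀] using χ.map_source hp
  have hP0 : P (0, 0) = p₀ := by
    simp [hP, z₀, pushInside_zero, χ.left_inv hp]
  have hev : ∀ᶠ q in 𝓝 ((0 : ℝ), (0 : E)), q.2 + z₀ ∈ χ.target ∧ P q ∈ χ.source :=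
    Filter.Eventually.and (hopen.mem_nhds h00)
      ((hPc.continuousAt (hopen.mem_nhds h00)).eventually_mem
        (by rw [hP0]; exact χ.open_source.mem_nhds hp))
  obtain ⟨ρ, hρ, hev⟩ := Metric.nhds_basis_closedBall.eventually_iff.1 hev
  have hball : ∀ s ∈ Icc (0 : ℝ) 1, ∀ z ∈ Metric.closedBall (0 : E) ρ,
      z + z₀ ∈ χ.target ∧ P (ρ * s, z) ∈ χ.source := by
    intro s hs z hz
    refine @hev (ρ * s, z) ?_
    rw [Metric.mem_closedBall, Prod.dist_eq]
    refine max_le ?_ hz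
    rw [Real.dist_eq, sub_zero, abs_of_nonneg (mul_nonneg hρ.le hs.1)]
    exact mul_le_of_le_one_right hρ.le hs.2
  refine false_of_deformation_off_center (E := E) hρ (K := fun q => χ (P (ρ * q.1, q.2)) - z₀)
    ?_ (fun z hz => ?_) (fun s hs z hz hK => ?_)
  · refine ContinuousOn.sub (χ.continuousOn.comp (hPc.comp (by fun_prop) ?_) ?_)
      continuousOn_const
    · exact fun q hq => (hball q.1 hq.1 q.2 hq.2).1
    · exact fun q hq => (hball q.1 hq.1 q.2 hq.2).2
  · have := (hball 0 (by simp) z hz).1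
    simp [hP, pushInside_zero, χ.right_inv this]
  -- A pushed point has i-th coordinate at least ρs, so it meets p₀, whose coordinate is 0, only
  -- when s = 0.
  · have h1 := χ.injOn (hball s hs z hz).2 hp (sub_eq_zero.1 hK)
    have h2 := congrArg (fun p : HalfSpace d × ℝ => (p.1 : EuclideanSpace ℝ (Fin d)) i) h1
    simp only [hP] at h2
    rw [pushInside_apply i (mul_nonneg hρ.le hs.1), h0] at h2
    have h3 := (χ.symm (z + z₀)).1.2 i hi
    have h4 := mul_nonneg hρ.le hs.1
    have h5 : ρ * s = 0 := by linarith
    exact (mul_eq_zero.1 h5).resolve_left hρ.ne'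

end HalfSpaceBoundary

/-! ### Chains in the covering -/

section Chains

variable {M : Type*} [MetricSpace M]

/-- The flow on `M × ℝ` that lifts `φ` and adds to the second coordinate the variation of `f`. -/
noncomputable def liftFlow (φ : Flow ℝ M) (f : C(M, UnitAddCircle)) : Flow ℝ (M × ℝ) where
  toFun t p := (φ t p.1, p.2 + orbitVar φ f p.1 t)
  cont' := by
    have h1 : Continuous fun z : ℝ × M × ℝ => φ z.1 z.2.1 :=
      φ.continuous (by fun_prop) (by fun_prop)
    have h2 : Continuous fun z : ℝ × M × ℝ => orbitVar φ f z.2.1 z.1 :=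
      (continuous_orbitVar φ f).comp (by fun_prop : Continuous fun z : ℝ × M × ℝ => (z.2.1, z.1))
    exact h1.prodMk ((by fun_prop : Continuous fun z : ℝ × M × ℝ => z.2.2).add h2)
  map_add' s t p := by
    refine Prod.ext (φ.map_add s t p.1) ?_
    change p.2 + orbitVar φ f p.1 (s + t) = p.2 + orbitVar φ f p.1 t + orbitVar φ f (φ t p.1) s
    rw [add_comm s t, orbitVar_add, add_assoc]
  map_zero' p := by simp [orbitVar_zero]

/-- The pairs `(x, v)` such that `v` is a lift of `f x`. -/
def liftSet (f : C(M, UnitAddCircle)) : Set (M × ℝ) := {p | (p.2 : UnitAddCircle) = f p.1}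

/-- An orbit arc of length at least `T` in the covering, followed by a jump smaller than `ε`. -/
def ChainStep (φ : Flow ℝ M) (f : C(M, UnitAddCircle)) (T ε : ℝ) (a b : M × ℝ) : Prop :=
  b ∈ liftSet f ∧ ∃ t ≥ T, dist (liftFlow φ f t a) b < ε

variable {φ : Flow ℝ M} {f : C(M, UnitAddCircle)} {T ε : ℝ}

theorem liftFlow_apply (t : ℝ) (p : M × ℝ) :
    liftFlow φ f t p = (φ t p.1, p.2 + orbitVar φ f p.1 t) := rfl

theorem liftFlow_mem {p : M × ℝ} (hp : p ∈ liftSet f) (t : ℝ) : liftFlow φ f t p ∈ liftSet f :=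
  coe_add_orbitVar p.1 hp t

theorem isClosed_liftSet : IsClosed (liftSet f) :=
  isClosed_eq (continuous_coe_circle.comp continuous_snd) (f.continuous.comp continuous_fst)

/-- Translation of the covering by an integer. -/
def shiftLift (n : ℤ) (p : M × ℝ) : M × ℝ := (p.1, p.2 + n)

theorem shiftLift_mem {p : M × ℝ} (hp : p ∈ liftSet f) (n : ℤ) : shiftLift n p ∈ liftSet f := by
  change ((p.2 + n : ℝ) : UnitAddCircle) = f p.1
  rw [AddCircle.coe_add, coe_circle_int, add_zero]; exact hp

theorem liftFlow_shiftLift (n : ℤ) (t : ℝ) (p : M × ℝ) :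
    liftFlow φ f t (shiftLift n p) = shiftLift n (liftFlow φ f t p) := by
  simp only [liftFlow_apply, shiftLift]
  rw [add_right_comm]

theorem dist_shiftLift (n : ℤ) (p q : M × ℝ) : dist (shiftLift n p) (shiftLift n q) = dist p q := by
  simp [shiftLift, Prod.dist_eq]

theorem ChainStep.shift (n : ℤ) {a b : M × ℝ} (h : ChainStep φ f T ε a b) :
    ChainStep φ f T ε (shiftLift n a) (shiftLift n b) := by
  obtain ⟨hb, t, ht, hd⟩ := h
  exact ⟨shiftLift_mem hb n, t, ht, by rwa [liftFlow_shiftLift, dist_shiftLift]⟩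

theorem ChainStep.mono {ε' : ℝ} (hε : ε ≤ ε') {a b : M × ℝ} (h : ChainStep φ f T ε a b) :
    ChainStep φ f T ε' a b := by
  obtain ⟨hb, t, ht, hd⟩ := h
  exact ⟨hb, t, ht, hd.trans_le hε⟩

theorem reflTransGen_chain_mono {ε' : ℝ} (hε : ε ≤ ε') {a b : M × ℝ}
    (h : Relation.ReflTransGen (ChainStep φ f T ε) a b) :
    Relation.ReflTransGen (ChainStep φ f T ε') a b :=
  h.lift id fun _ _ h => h.mono hε

theorem transGen_chain_mono {ε' : ℝ} (hε : ε ≤ ε') {a b : M × ℝ}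
    (h : Relation.TransGen (ChainStep φ f T ε) a b) :
    Relation.TransGen (ChainStep φ f T ε') a b :=
  h.lift id fun _ _ h => h.mono hε

theorem chain_mem {p q : M × ℝ} (hp : p ∈ liftSet f)
    (h : Relation.ReflTransGen (ChainStep φ f T ε) p q) : q ∈ liftSet f := by
  cases h with
  | refl => exact hp
  | tail _ hs => exact hs.1

theorem abs_sub_snd_le (p q : M × ℝ) : |p.2 - q.2| ≤ dist p q := by
  rw [← Real.dist_eq]; exact le_max_right _ _

/-- The point of the covering of `-f` that corresponds to a point of `liftSet f`. -/
def negCover (p : M × ℝ) (hp : p ∈ liftSet f) : Cover (-f) :=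
  ⟨(p.1, -p.2), by
    rw [AddCircle.coe_neg, (hp : (p.2 : UnitAddCircle) = f p.1)]; rfl⟩

theorem IsPreLyapunov.le_of_chain (h : IsPreLyapunov φ T (-f)) {p q : M × ℝ} (hp : p ∈ liftSet f)
    (hpq : ∀ ε > 0, ∃ r, Relation.ReflTransGen (ChainStep φ f T ε) p r ∧
      ∃ t > 0, liftFlow φ f t r = q) : p.2 ≤ q.2 := by
  have hq : q ∈ liftSet f := by
    obtain ⟨r, hr, t, -, rfl⟩ := hpq 1 one_pos
    exact liftFlow_mem (chain_mem hp hr) t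
  have hflow : ∀ (a b : M × ℝ) (ha : a ∈ liftSet f) (hb : b ∈ liftSet f) (t : ℝ),
      liftFlow φ f t a = b → LiftedFlow φ (-f) t (negCover a ha) (negCover b hb) := by
    rintro a b ha hb t rfl
    rw [liftedFlow_iff, orbitVar_neg_map]
    refine ⟨rfl, ?_⟩
    simp only [negCover, liftFlow_apply]; ring
  have key := h (negCover p hp) (negCover q hq) fun ε hε => by
    obtain ⟨r, hr, t, ht, hrq⟩ := hpq ε hε
    have : ∃ hr' : r ∈ liftSet f, Relation.ReflTransGen
        (fun a b : Cover (-f) => ∃ t : ℝ, T ≤ t ∧ ∃ c : Cover (-f),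
          LiftedFlow φ (-f) t a c ∧ dist c b < ε) (negCover p hp) (negCover r hr') := by
      clear hrq
      induction hr with
      | refl => exact ⟨hp, .refl⟩
      | tail _ hs ih =>
        obtain ⟨ha, ih⟩ := ih
        obtain ⟨hb, s, hs, hd⟩ := hs
        refine ⟨hb, ih.tail ⟨s, hs, negCover _ (liftFlow_mem ha s), hflow _ _ _ _ _ rfl, ?_⟩⟩
        rw [Prod.dist_eq] at hd
        change max _ _ < ε
        simpa only [negCover, dist_neg_neg] using hd
    obtain ⟨hr', hchain⟩ := this
    exact ⟨_, hchain, t, ht, hflow _ _ _ _ _ hrq⟩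
  exact neg_le_neg_iff.1 key

theorem IsPreLyapunov.orbitVar_nonneg (h : IsPreLyapunov φ T (-f)) (x : M) {t : ℝ} (ht : 0 ≤ t) :
    0 ≤ orbitVar φ f x t := by
  rcases ht.eq_or_lt with rfl | ht
  · rw [orbitVar_zero]
  obtain ⟨w, hw⟩ := QuotientAddGroup.mk_surjective (f x)
  -- A single orbit arc is a pseudo-orbit without jumps, however short it is.
  have := h.le_of_chain (p := (x, w)) (q := liftFlow φ f t (x, w)) hw
    fun ε _ => ⟨(x, w), .refl, t, ht, rfl⟩
  simp only [liftFlow_apply] at this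
  linarith

theorem IsPreLyapunov.snd_mono (h : IsPreLyapunov φ T (-f)) (p : M × ℝ) {s t : ℝ} (hst : s ≤ t) :
    (liftFlow φ f s p).2 ≤ (liftFlow φ f t p).2 := by
  have := h.orbitVar_nonneg (φ s p.1) (sub_nonneg.2 hst)
  have h2 := orbitVar_add (φ := φ) (f := f) p.1 s (t - s)
  rw [add_sub_cancel] at h2
  simp only [liftFlow_apply]
  linarith

theorem transGen_change_end {p q r : M × ℝ} {η : ℝ} (hη : 0 < η) (hr : r ∈ liftSet f)
    (hd : dist q r < η) (h : Relation.TransGen (ChainStep φ f T ε) p q) :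
    Relation.TransGen (ChainStep φ f T (ε + η)) p r := by
  obtain ⟨m, hm, -, t, ht, hmd⟩ := Relation.TransGen.tail'_iff.1 h
  refine Relation.TransGen.tail'_iff.2 ⟨m, ?_, hr, t, ht, ?_⟩
  · exact reflTransGen_chain_mono (by linarith) hm
  · exact (dist_triangle _ q _).trans_lt (add_lt_add hmd hd)

/-- The first arc may be arbitrarily long, while orbits are compared only up to time 2T. A longer
arc is therefore cut at time T, leaving a second arc of length at least T. -/
theorem transGen_change_start {p q r : M × ℝ} {η : ℝ} (hη : 0 < η) (hT : 0 < T) (hε : 0 < ε)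
    (hp : p ∈ liftSet f)
    (hd : ∀ s ∈ Icc T (2 * T), dist (liftFlow φ f s q) (liftFlow φ f s p) < η)
    (h : Relation.TransGen (ChainStep φ f T ε) p r) :
    Relation.TransGen (ChainStep φ f T (ε + η)) q r := by
  obtain ⟨m, ⟨hm, t, ht, htm⟩, hmr⟩ := Relation.TransGen.head'_iff.1 h
  have hmr' : Relation.ReflTransGen (ChainStep φ f T (ε + η)) m r :=
    reflTransGen_chain_mono (by linarith) hmr
  rcases le_or_gt t (2 * T) with h2 | h2
  · refine Relation.TransGen.head'_iff.2 ⟨m, ⟨hm, t, ht, ?_⟩, hmr'⟩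
    refine (dist_triangle _ (liftFlow φ f t p) _).trans_lt ?_
    linarith [hd t ⟨ht, h2⟩]
  · refine Relation.TransGen.head (b := liftFlow φ f T p)
      ⟨liftFlow_mem hp T, T, le_rfl, (hd T ⟨le_rfl, by linarith⟩).trans (by linarith)⟩ ?_
    refine Relation.TransGen.head'_iff.2 ⟨m, ⟨hm, t - T, by linarith, ?_⟩, hmr'⟩
    rw [← (liftFlow φ f).map_add, sub_add_cancel]
    linarith

/-- Arcs never descend, so the step that takes the chain below the level a loses less than ε, and
its endpoint is close to a. -/
theorem IsPreLyapunov.truncate_end (h : IsPreLyapunov φ T (-f)) (hT : 0 < T) {a : ℝ}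
    {p q : M × ℝ} (hpq : Relation.ReflTransGen (ChainStep φ f T ε) p q) (hpa : a ≤ p.2)
    (hqa : q.2 < a) :
    ∃ q', Relation.ReflTransGen (ChainStep φ f T ε) p q' ∧ q'.2 < a ∧ a - ε ≤ q'.2 := by
  induction hpq with
  | refl => exact absurd hqa (not_lt.2 hpa)
  | @tail m q hpm hmq ih =>
    rcases lt_or_ge m.2 a with hm | hm
    · exact ih hm
    · refine ⟨q, hpm.tail hmq, hqa, ?_⟩
      obtain ⟨-, t, ht, hd⟩ := hmq
      have h1 := h.snd_mono m (hT.le.trans ht)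
      rw [(liftFlow φ f).map_zero_apply] at h1
      have h2 := (abs_lt.1 ((abs_sub_snd_le _ _).trans_lt hd)).2
      linarith

theorem IsPreLyapunov.truncate_start (h : IsPreLyapunov φ T (-f)) (hT : 0 < T) {a : ℝ}
    {p q : M × ℝ} (hp : p ∈ liftSet f) (hpq : Relation.ReflTransGen (ChainStep φ f T ε) p q)
    (hpa : a ≤ p.2) (hqa : q.2 < a) :
    ∃ p' ∈ liftSet f, Relation.ReflTransGen (ChainStep φ f T ε) p' q ∧ a ≤ p'.2 ∧
      p'.2 ≤ a + ε := by
  induction hpq using Relation.ReflTransGen.head_induction_on with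
  | refl => exact absurd hqa (not_lt.2 hpa)
  | @head p m hpm hmq ih =>
    rcases le_or_gt a m.2 with hm | hm
    · exact ih hpm.1 hm
    · refine ⟨p, hp, hmq.head hpm, hpa, ?_⟩
      obtain ⟨-, t, ht, hd⟩ := hpm
      have h1 := h.snd_mono p (hT.le.trans ht)
      rw [(liftFlow φ f).map_zero_apply] at h1
      have h2 := (abs_lt.1 ((abs_sub_snd_le _ _).trans_lt hd)).2
      linarith

variable [CompactSpace M]

/-- Chains with small jumps in the covering of a pre-Lyapunov map lose little height. -/
theorem IsPreLyapunov.exists_chain_bound (h : IsPreLyapunov φ T (-f)) (hT : 0 < T) {δ : ℝ}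
    (hδ : 0 < δ) : ∃ ε > 0, ∀ p ∈ liftSet f, ∀ q,
      Relation.ReflTransGen (ChainStep φ f T ε) p q → p.2 - δ ≤ q.2 := by
  by_contra hno
  push Not at hno
  -- normalised bad pairs lie in a compact set
  set K : Set (M × ℝ) := liftSet f ∩ (univ ×ˢ Icc (-(δ + 1)) 2) with hK
  have hKc : IsCompact K := (isCompact_univ.prod isCompact_Icc).inter_left isClosed_liftSet
  have hbad : ∀ ε : ℝ, 0 < ε → ε ≤ 1 → ∃ z : (M × ℝ) × (M × ℝ), z ∈ K ×ˢ K ∧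
      Relation.TransGen (ChainStep φ f T ε) z.1 z.2 ∧ z.2.2 ≤ z.1.2 - δ := by
    intro ε hε hε1
    obtain ⟨p, hp, q, hpq, hlt⟩ := hno ε hε
    set n : ℤ := -⌊p.2⌋
    have hpq' : Relation.ReflTransGen (ChainStep φ f T ε) (shiftLift n p) (shiftLift n q) :=
      hpq.lift (shiftLift n) fun a b hab => hab.shift n
    have hp' : shiftLift n p ∈ liftSet f := shiftLift_mem hp n
    have hp0 : 0 ≤ (shiftLift n p).2 := by
      simp only [shiftLift, n]; push_cast; linarith [Int.floor_le p.2]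
    have hp1 : (shiftLift n p).2 < 1 := by
      simp only [shiftLift, n]; push_cast; linarith [Int.lt_floor_add_one p.2]
    have hlt' : (shiftLift n q).2 < (shiftLift n p).2 - δ := by
      simp only [shiftLift]; linarith
    obtain ⟨q', hpq1, hq1, hq2⟩ := h.truncate_end hT hpq' (a := (shiftLift n p).2 - δ)
      (by linarith) hlt'
    obtain ⟨p', hp'1, hpq2, hp2, hp3⟩ := h.truncate_start hT hp' hpq1 (a := (shiftLift n p).2)
      le_rfl (by linarith)
    refine ⟨(p', q'), ⟨⟨hp'1, mem_univ _, ?_, ?_⟩, ⟨chain_mem hp' hpq1, mem_univ _, ?_, ?_⟩⟩,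
      ?_, ?_⟩ <;> try (simp only; linarith)
    rcases Relation.reflTransGen_iff_eq_or_transGen.1 hpq2 with e | e
    · rw [e] at hq1; linarith
    · exact e
  have hpos : ∀ j : ℕ, (0 : ℝ) < 1 / (j + 1) := fun j => by positivity
  choose z hz hzt hzl using fun j : ℕ => hbad (1 / ((j : ℝ) + 1)) (hpos j) (by
    rw [div_le_one (by positivity)]; linarith [(Nat.cast_nonneg j : (0 : ℝ) ≤ j)])
  obtain ⟨⟨a, b⟩, ⟨⟨haL, -⟩, ⟨hbL, -⟩⟩, θ, hθ, hlim⟩ := (hKc.prod hKc).tendsto_subseq hz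
  have hapx : ∀ η > 0, ∃ p q, p ∈ liftSet f ∧ dist p a < η ∧ dist q b < η ∧
      Relation.TransGen (ChainStep φ f T η) p q ∧ q.2 ≤ p.2 - δ := by
    intro η hη
    have e1 := (Metric.tendsto_nhds.1 hlim) η hη
    have e2 := (tendsto_one_div_add_atTop_nhds_zero_nat (𝕜 := ℝ)).eventually (gt_mem_nhds hη)
    have e3 := hθ.tendsto_atTop.eventually e2
    obtain ⟨j, hj1, hj3⟩ := (e1.and e3).exists
    refine ⟨(z (θ j)).1, (z (θ j)).2, (hz (θ j)).1.1, (le_max_left _ _).trans_lt hj1,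
      (le_max_right _ _).trans_lt hj1, ?_, hzl _⟩
    exact transGen_chain_mono hj3.le (hzt (θ j))
  have hab : b.2 ≤ a.2 - δ := by
    refine le_of_forall_pos_le_add fun η hη => ?_
    obtain ⟨p, q, -, hp, hq, -, hl⟩ := hapx (η / 2) (by positivity)
    have h1 := (abs_lt.1 ((abs_sub_snd_le _ _).trans_lt hp)).2
    have h2 := (abs_lt.1 ((abs_sub_snd_le _ _).trans_lt hq)).1
    linarith
  have hle : a.2 ≤ b.2 := by
    refine h.le_of_chain haL fun ε hε => ?_
    -- Pseudo-orbits must end with an arc arriving exactly at b, so chains are redirected to a point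
    -- slightly before b on its orbit.
    obtain ⟨τ, hτ, hτb⟩ : ∃ τ > 0, dist b (liftFlow φ f (-τ) b) < ε / 3 := by
      have hc : ContinuousAt (fun s => dist b (liftFlow φ f s b)) 0 :=
        (continuous_const.dist (flow_orbit_continuous (liftFlow φ f) b)).continuousAt
      have := eventually_abs_lt_of_continuousAt hc
        (by simp [(liftFlow φ f).map_zero_apply]) (by positivity : 0 < ε / 3)
      obtain ⟨r, hr, hr'⟩ := exists_pos_of_eventually this
      exact ⟨r, hr, lt_of_abs_lt (hr' (-r) (by rw [abs_neg, abs_of_pos hr]))⟩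
    have hclose : ∀ᶠ p in 𝓝 a, ∀ s ∈ Icc T (2 * T),
        dist (liftFlow φ f s a) (liftFlow φ f s p) < ε / 6 := by
      refine isCompact_Icc.eventually_forall_of_forall_eventually fun s _ => ?_
      have hc : Continuous fun z : (M × ℝ) × ℝ =>
          dist (liftFlow φ f z.2 a) (liftFlow φ f z.2 z.1) :=
        ((liftFlow φ f).continuous continuous_snd continuous_const).dist
          ((liftFlow φ f).continuous continuous_snd continuous_fst)
      filter_upwards [eventually_abs_lt_of_continuousAt (x := (a, s)) hc.continuousAt (by simp)
        (by positivity : 0 < ε / 6)] with z hz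
      exact lt_of_abs_lt hz
    obtain ⟨η, hη, hηc⟩ := Metric.eventually_nhds_iff.1 hclose
    obtain ⟨p, q, hpL, hp, hq, hpq, -⟩ := hapx (min η (ε / 6)) (by positivity)
    have hrL := liftFlow_mem (φ := φ) hbL (-τ)
    have hqr : dist q (liftFlow φ f (-τ) b) < ε / 2 := by
      have := hq.trans_le (min_le_right _ _)
      linarith [dist_triangle q b (liftFlow φ f (-τ) b)]
    have c1 := transGen_change_end (by positivity : 0 < ε / 2) hrL hqr hpq
    have c2 := transGen_change_start (by positivity : 0 < ε / 6) hT (by positivity) hpL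
      (hηc (hp.trans_le (min_le_left _ _))) c1
    refine ⟨_, (transGen_chain_mono ?_ c2).to_reflTransGen, τ, hτ, ?_⟩
    · linarith [min_le_right η (ε / 6)]
    · rw [← (liftFlow φ f).map_add]; simp
  linarith

end Chains

/-! ### Recurrent points do not move up -/

section RecurrentPoints

variable {M : Type*} [MetricSpace M] {φ : Flow ℝ M} {f : C(M, UnitAddCircle)} {T ε : ℝ}

theorem IsPreLyapunov.orbitVar_mono (h : IsPreLyapunov φ T (-f)) (x : M) {s t : ℝ} (hst : s ≤ t) :
    orbitVar φ f x s ≤ orbitVar φ f x t := by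
  have := h.snd_mono (x, 0) hst
  simpa only [liftFlow_apply, zero_add] using this

theorem reflTransGen_of_le {X : Type*} {r : X → X → Prop} {P : ℕ → X} (h : ∀ j, r (P j) (P (j + 1)))
    {i j : ℕ} (hij : i ≤ j) : Relation.ReflTransGen r (P i) (P j) := by
  induction j, hij using Nat.le_induction with
  | base => exact .refl
  | succ j _ ih => exact ih.tail (h j)

theorem sum_range_add_period {a : ℕ → ℝ} {k : ℕ} (ha : ∀ j, a (j + k) = a j)
    (h0 : ∑ i ∈ Finset.range k, a i = 0) (j : ℕ) :
    ∑ i ∈ Finset.range (j + k), a i = ∑ i ∈ Finset.range j, a i := by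
  induction j with
  | zero => simpa using h0
  | succ j ih => rw [add_right_comm, Finset.sum_range_succ, Finset.sum_range_succ, ih, ha]

/-- A periodic pseudo-orbit with pairing zero lifts to a periodic chain in the covering. -/
theorem PeriodicPseudoOrbit.exists_chain {T' : ℝ} {α : H1 M} (γ : PeriodicPseudoOrbit φ ε T')
    (hγ : γ.HasPairing α 0) (hα : classOf f = α) {η : ℝ}
    (hvar : ∀ {x y : M} (c : Path x y) (z : M), range c ⊆ Metric.ball z ε →
      ∀ a, HasVariation f c a → |a| < η) :
    ∃ (P : ℕ → M × ℝ) (τ : ℕ → ℝ), (∀ j, P j ∈ liftSet f) ∧ (∀ j, P (j + γ.k) = P j) ∧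
      (∀ j < γ.k, (P j).1 = γ.pt j ∧ τ j = γ.time j) ∧
      ∀ j, T' ≤ τ j ∧ dist (φ (τ j) (P j).1) (P (j + 1)).1 < ε ∧
        |(P j).2 + orbitVar φ f (P j).1 (τ j) - (P (j + 1)).2| < η := by
  obtain ⟨b, hb, hsum⟩ := hγ.exists_of_classOf hα
  have hmod : ∀ j, j % γ.k < γ.k := fun j => Nat.mod_lt _ γ.k_pos
  have hpt : ∀ j, γ.pt ((j + 1) % γ.k) = γ.pt (j % γ.k + 1) := by
    intro j
    rcases (Nat.succ_le_of_lt (hmod j)).eq_or_lt with h | h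
    · rw [← Nat.mod_add_mod, ← Nat.succ_eq_add_one (j % γ.k), h, Nat.mod_self, γ.closed]
    · congr 1
      rw [← Nat.mod_add_mod, Nat.mod_eq_of_lt h]
  obtain ⟨w, hw⟩ := QuotientAddGroup.mk_surjective (f (γ.pt 0))
  -- The pseudo-orbit is unrolled periodically, so that later one can go round it several times.
  -- Zero pairing makes the partial sums periodic too.
  set a : ℕ → ℝ := fun j => orbitVar φ f (γ.pt (j % γ.k)) (γ.time (j % γ.k)) + b (j % γ.k) with ha
  have hW := sum_range_add_period (a := a) (k := γ.k) (fun j => by simp [ha]) (by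
    rw [← hsum]
    refine Finset.sum_congr rfl fun i hi => ?_
    simp only [ha, Nat.mod_eq_of_lt (Finset.mem_range.1 hi)])
  refine ⟨fun j => (γ.pt (j % γ.k), w + ∑ i ∈ Finset.range j, a i), fun j => γ.time (j % γ.k),
    fun j => ?_, fun j => by simp only [hW, Nat.add_mod_right], fun j hj => by
      simp only [Nat.mod_eq_of_lt hj, and_self], fun j => ⟨γ.le_time _ (hmod j), ?_, ?_⟩⟩
  · induction j with
    | zero => simpa [liftSet] using hw
    | succ j ih =>
      obtain ⟨c, -, hc⟩ := hb _ (hmod j)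
      have h1 := coe_add_orbitVar (φ := φ) _ ih (γ.time (j % γ.k))
      have h2 := hc.coe_sub
      change ((w + ∑ i ∈ Finset.range (j + 1), a i : ℝ) : UnitAddCircle) = f (γ.pt ((j + 1) % γ.k))
      rw [Finset.sum_range_succ, hpt, ← add_assoc, ha]
      simp only
      rw [← add_assoc, AddCircle.coe_add, h1, h2]
      abel
  · simp only [hpt]; exact γ.jump_lt _ (hmod j)
  · obtain ⟨c, ⟨z, hz⟩, hc⟩ := hb _ (hmod j)
    rw [← abs_neg]
    convert hvar c z hz _ hc using 2
    simp only [Finset.sum_range_succ, ha]; ring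

variable [CompactSpace M]

theorem exists_orbitVar_close (φ : Flow ℝ M) (f : C(M, UnitAddCircle)) (t : ℝ) {η : ℝ}
    (hη : 0 < η) : ∃ ε > 0, ∀ y z, dist y z < ε → ∀ s ∈ Icc 0 t,
      |orbitVar φ f y s - orbitVar φ f z s| < η := by
  have hK : IsCompact (univ ×ˢ Icc 0 t : Set (M × ℝ)) := isCompact_univ.prod isCompact_Icc
  have hu := hK.uniformContinuousOn_of_continuous (continuous_orbitVar φ f).continuousOn
  obtain ⟨ε, hε, h⟩ := Metric.uniformContinuousOn_iff.1 hu η hη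
  refine ⟨ε, hε, fun y z hyz s hs => ?_⟩
  have := h (y, s) ⟨mem_univ _, hs⟩ (z, s) ⟨mem_univ _, hs⟩ (by
    rw [Prod.dist_eq, dist_self]; exact max_lt hyz hε)
  rwa [Real.dist_eq] at this

/-- A gain c along the orbit of x would have to be lost again on the closed lifted chain, but chains
with small jumps lose at most c/8. -/
theorem IsPLMap.orbitVar_eq_zero {α : H1 M} (h : IsPLMap φ T α f) (hT : 0 < T) {x : M}
    (hx : x ∈ alphaRec φ α) {t : ℝ} (ht : 0 ≤ t) : orbitVar φ f x t = 0 := by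
  obtain ⟨hα, -, h⟩ := h
  refine le_antisymm (not_lt.1 fun hc => ?_) (h.orbitVar_nonneg x ht)
  set c := orbitVar φ f x t with hcdef
  obtain ⟨ε₁, hε₁, hchain⟩ := h.exists_chain_bound hT (by positivity : 0 < c / 8)
  obtain ⟨η, hη, hη1, hη2, hη3⟩ : ∃ η > 0, η ≤ 1 / 2 ∧ η ≤ c / 16 ∧ η ≤ ε₁ :=
    ⟨min (1 / 4) (min (c / 16) ε₁), by positivity, (min_le_left _ _).trans (by norm_num),
      (min_le_right _ _).trans (min_le_left _ _), (min_le_right _ _).trans (min_le_right _ _)⟩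
  obtain ⟨ε₂, hε₂, hvar⟩ := exists_forall_hasVariation_lt f hη hη1
  obtain ⟨ε₃, hε₃, hclose⟩ := exists_orbitVar_close φ f t (by positivity : 0 < c / 16)
  obtain ⟨ε, hε, h1, h2, h3⟩ : ∃ ε > 0, ε ≤ ε₁ ∧ ε ≤ ε₂ ∧ ε ≤ ε₃ :=
    ⟨min ε₁ (min ε₂ ε₃), by positivity, min_le_left _ _,
      (min_le_right _ _).trans (min_le_left _ _), (min_le_right _ _).trans (min_le_right _ _)⟩
  -- Arcs of length at least t ensure that following γ from x for time t meets at most one jump.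
  obtain ⟨γ, ⟨i, hi, s, hs, hsx⟩, hγ⟩ := hx ε hε (max T t) (lt_max_of_lt_left hT)
  obtain ⟨P, τ, hP, hper, hPγ, hstep⟩ := γ.exists_chain hγ hα
    (fun {x y} c z hz a ha => hvar c a ⟨z, hz.trans (Metric.ball_subset_ball h2)⟩ ha)
  have hcs : ∀ j, ChainStep φ f T ε₁ (P j) (P (j + 1)) := fun j =>
    ⟨hP _, τ j, (le_max_left _ _).trans (hstep j).1, by
      rw [Prod.dist_eq, Real.dist_eq]
      exact max_lt ((hstep j).2.1.trans_le h1) ((hstep j).2.2.trans_le hη3)⟩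
  obtain ⟨e1, e2⟩ := hPγ i hi
  rw [← e1] at hsx
  rw [← e2] at hs
  have hx0 := h.orbitVar_nonneg (P i).1 hs.1
  have hloop : ∀ j, j ≤ i + 2 → i ≤ j → (P j).2 ≤ (P i).2 + c / 8 := by
    intro j hj hij
    -- Two turns are needed: when k = 1, the index i + 2 lies beyond the first turn.
    have : P (i + γ.k + γ.k) = P i := by rw [hper, hper]
    have hk := γ.k_pos
    have := hchain _ (hP j) _ (this ▸ reflTransGen_of_le hcs (by omega : j ≤ i + γ.k + γ.k))
    linarith
  have hadd := orbitVar_add (φ := φ) (f := f) (P i).1 s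
  have s1 := abs_lt.1 (hstep i).2.2
  have s2 := abs_lt.1 (hstep (i + 1)).2.2
  rcases le_or_gt t (τ i - s) with hts | hts
  · have m1 := h.orbitVar_mono (P i).1 (by linarith : s + t ≤ τ i)
    have := hadd t
    rw [hsx] at this
    have := hloop (i + 1) (by omega) (by omega)
    linarith
  · have a1 := hadd (τ i - s)
    rw [hsx, add_sub_cancel] at a1
    have a2 := orbitVar_add (φ := φ) (f := f) x (τ i - s) (t - (τ i - s))
    rw [add_sub_cancel] at a2
    have e3 : φ (τ i - s) x = φ (τ i) (P i).1 := by
      rw [← hsx, ← φ.map_add, sub_add_cancel]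
    rw [e3] at a2
    have a3 := (abs_lt.1 (hclose _ _ ((hstep i).2.1.trans_le h3) (t - (τ i - s))
      ⟨by linarith, by linarith [hs.2]⟩)).2
    have m1 := h.orbitVar_mono (P (i + 1)).1
      (by linarith [(le_max_right T t).trans (hstep (i + 1)).1, hs.2] :
        t - (τ i - s) ≤ τ (i + 1))
    have := hloop (i + 2) (by omega) (by omega)
    have s3 := s2.2
    rw [add_assoc i 1 1] at s3
    norm_num at s3
    linarith

end RecurrentPoints

/-! ### Smoothing a function along a flow -/

section Smoothing

variable {X : Type*} [TopologicalSpace X]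

/-- The largest value of `ρ` on the backward orbit segment of length `T`. -/
noncomputable def pastSup (ψ : Flow ℝ X) (T : ℝ) (ρ : X → ℝ) (p : X) : ℝ :=
  sSup ((fun t => ρ (ψ (-t) p)) '' Icc 0 T)

/-- The mean value of `pastSup ψ T ρ` on the forward orbit segment of length `T`. -/
noncomputable def orbitMean (ψ : Flow ℝ X) (T : ℝ) (ρ : X → ℝ) (p : X) : ℝ :=
  T⁻¹ * ∫ t in (0 : ℝ)..T, pastSup ψ T ρ (ψ t p)

/-- On `L`, a positive value of `ρ` is followed by the value `1` after time `T`. -/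
structure Absorbing (ψ : Flow ℝ X) (T : ℝ) (L : Set X) (ρ : X → ℝ) : Prop where
  continuous : Continuous ρ
  nonneg : ∀ p, 0 ≤ ρ p
  le_one : ∀ p, ρ p ≤ 1
  mem_flow : ∀ p ∈ L, ∀ t, ψ t p ∈ L
  eq_one : ∀ p ∈ L, 0 < ρ p → ∀ t, T ≤ t → ρ (ψ t p) = 1

namespace Absorbing

variable {ψ : Flow ℝ X} {T : ℝ} {L : Set X} {ρ : X → ℝ}

theorem pastSup_mem (h : Absorbing ψ T L ρ) (hT : 0 < T) (p : X) :
    ∃ t ∈ Icc 0 T, ρ (ψ (-t) p) = pastSup ψ T ρ p ∧ ∀ s ∈ Icc 0 T, ρ (ψ (-s) p) ≤ ρ (ψ (-t) p) := by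
  have hc : Continuous fun t => ρ (ψ (-t) p) :=
    h.continuous.comp ((flow_orbit_continuous ψ p).comp continuous_neg)
  exact isCompact_Icc.exists_sSup_image_eq_and_ge (nonempty_Icc.2 hT.le) hc.continuousOn |>.imp
    fun t ht => ⟨ht.1, ht.2.1.symm, ht.2.2⟩

theorem le_pastSup (h : Absorbing ψ T L ρ) (hT : 0 < T) (p : X) {s : ℝ} (hs : s ∈ Icc 0 T) :
    ρ (ψ (-s) p) ≤ pastSup ψ T ρ p := by
  obtain ⟨t, -, ht, hle⟩ := h.pastSup_mem hT p
  exact ht ▸ hle s hs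

theorem pastSup_nonneg (h : Absorbing ψ T L ρ) (hT : 0 < T) (p : X) : 0 ≤ pastSup ψ T ρ p := by
  obtain ⟨t, -, ht, -⟩ := h.pastSup_mem hT p
  exact ht ▸ h.nonneg _

theorem pastSup_le_one (h : Absorbing ψ T L ρ) (hT : 0 < T) (p : X) : pastSup ψ T ρ p ≤ 1 := by
  obtain ⟨t, -, ht, -⟩ := h.pastSup_mem hT p
  exact ht ▸ h.le_one _

theorem continuous_pastSup (h : Absorbing ψ T L ρ) : Continuous (pastSup ψ T ρ) := by
  refine isCompact_Icc.continuous_sSup (f := fun p t => ρ (ψ (-t) p)) ?_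
  exact h.continuous.comp (ψ.continuous (continuous_snd.neg) continuous_fst)

theorem pastSup_flow_eq_one (h : Absorbing ψ T L ρ) (hT : 0 < T) {p : X} (hp : p ∈ L)
    (h0 : 0 < pastSup ψ T ρ p) {s : ℝ} (hs : T ≤ s) : pastSup ψ T ρ (ψ s p) = 1 := by
  obtain ⟨t, ht, htp, -⟩ := h.pastSup_mem hT p
  refine le_antisymm (h.pastSup_le_one hT _) ?_
  have h1 := h.eq_one _ (h.mem_flow p hp (-t)) (htp ▸ h0) (s + t) (by linarith [ht.1])
  rw [← ψ.map_add, add_neg_cancel_right] at h1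
  have := h.le_pastSup hT (ψ s p) (left_mem_Icc.2 hT.le)
  rwa [neg_zero, ψ.map_zero_apply, h1] at this

/-- Either the point realising the maximum is still in the past window of length T, or it lies more
than T back, and then absorption gives the value 1 now. -/
theorem pastSup_le_flow (h : Absorbing ψ T L ρ) (hT : 0 < T) {p : X} (hp : p ∈ L) {s : ℝ}
    (hs : 0 ≤ s) : pastSup ψ T ρ p ≤ pastSup ψ T ρ (ψ s p) := by
  obtain ⟨t, ht, htp, -⟩ := h.pastSup_mem hT p
  rcases (h.pastSup_nonneg hT p).eq_or_lt with h0 | h0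
  · rw [← h0]; exact h.pastSup_nonneg hT _
  rcases le_or_gt (s + t) T with hst | hst
  · have := h.le_pastSup hT (ψ s p) (s := s + t) ⟨by linarith [ht.1], hst⟩
    rwa [← ψ.map_add, neg_add, neg_add_cancel_comm, htp] at this
  · refine (h.pastSup_le_one hT _).trans ?_
    have h1 := h.eq_one _ (h.mem_flow p hp (-t)) (htp ▸ h0) (s + t) hst.le
    rw [← ψ.map_add, add_neg_cancel_right] at h1
    have := h.le_pastSup hT (ψ s p) (left_mem_Icc.2 hT.le)
    rwa [neg_zero, ψ.map_zero_apply, h1] at this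

theorem monotone_pastSup (h : Absorbing ψ T L ρ) (hT : 0 < T) {p : X} (hp : p ∈ L) :
    Monotone fun t => pastSup ψ T ρ (ψ t p) := by
  intro s t hst
  have := h.pastSup_le_flow hT (h.mem_flow p hp s) (sub_nonneg.2 hst)
  rwa [← ψ.map_add, sub_add_cancel] at this

theorem continuous_pastSup_flow (h : Absorbing ψ T L ρ) (p : X) :
    Continuous fun t => pastSup ψ T ρ (ψ t p) :=
  h.continuous_pastSup.comp (flow_orbit_continuous ψ p)

theorem continuous_orbitMean [FirstCountableTopology X] (h : Absorbing ψ T L ρ) :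
    Continuous (orbitMean ψ T ρ) := by
  refine continuous_const.mul ?_
  refine intervalIntegral.continuous_parametric_intervalIntegral_of_continuous' ?_ 0 T
  exact h.continuous_pastSup.comp (ψ.continuous continuous_snd continuous_fst)

theorem orbitMean_nonneg (h : Absorbing ψ T L ρ) (hT : 0 < T) (p : X) : 0 ≤ orbitMean ψ T ρ p :=
  mul_nonneg (inv_nonneg.2 hT.le)
    (intervalIntegral.integral_nonneg hT.le fun _ _ => h.pastSup_nonneg hT _)

theorem orbitMean_le_one (h : Absorbing ψ T L ρ) (hT : 0 < T) (p : X) : orbitMean ψ T ρ p ≤ 1 := by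
  rw [orbitMean, inv_mul_le_iff₀ hT]
  have : ∫ t in (0 : ℝ)..T, pastSup ψ T ρ (ψ t p) ≤ ∫ t in (0 : ℝ)..T, (1 : ℝ) :=
    intervalIntegral.integral_mono_on hT.le
      ((h.continuous_pastSup_flow p).intervalIntegrable 0 T)
      (continuous_const.intervalIntegrable 0 T) fun t _ => h.pastSup_le_one hT (ψ t p)
  simpa using this

theorem orbitMean_eq_one (h : Absorbing ψ T L ρ) (hT : 0 < T) {p : X}
    (hp : ∀ t ∈ Icc 0 T, ρ (ψ t p) = 1) : orbitMean ψ T ρ p = 1 := by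
  have : ∀ t ∈ uIcc 0 T, pastSup ψ T ρ (ψ t p) = 1 := fun t ht => by
    rw [uIcc_of_le hT.le] at ht
    refine le_antisymm (h.pastSup_le_one hT _) ?_
    have := h.le_pastSup hT (ψ t p) (left_mem_Icc.2 hT.le)
    rwa [neg_zero, ψ.map_zero_apply, hp t ht] at this
  rw [orbitMean, intervalIntegral.integral_congr this]
  simp [hT.ne']

theorem orbitMean_eq_zero (h : Absorbing ψ T L ρ) (hT : 0 < T) {p : X}
    (hp : ∀ t ∈ Icc (-T) T, ρ (ψ t p) = 0) : orbitMean ψ T ρ p = 0 := by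
  have : ∀ t ∈ uIcc 0 T, pastSup ψ T ρ (ψ t p) = 0 := fun t ht => by
    rw [uIcc_of_le hT.le] at ht
    obtain ⟨s, hs, hsp, -⟩ := h.pastSup_mem hT (ψ t p)
    rw [← hsp, ← ψ.map_add, hp _ ⟨by linarith [ht.1, hs.2], by linarith [ht.2, hs.1]⟩]
  rw [orbitMean, intervalIntegral.integral_congr this]
  simp

theorem orbitMean_flow (h : Absorbing ψ T L ρ) (p : X) (s : ℝ) :
    orbitMean ψ T ρ (ψ s p) - orbitMean ψ T ρ p =
      T⁻¹ * ((∫ t in T..(T + s), pastSup ψ T ρ (ψ t p)) -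
        ∫ t in (0 : ℝ)..s, pastSup ψ T ρ (ψ t p)) := by
  have hi := fun a b =>
    (h.continuous_pastSup_flow p).intervalIntegrable (μ := MeasureTheory.volume) a b
  have h1 : ∫ t in (0 : ℝ)..T, pastSup ψ T ρ (ψ t (ψ s p)) =
      ∫ t in (0 + s)..(T + s), pastSup ψ T ρ (ψ t p) := by
    rw [← intervalIntegral.integral_comp_add_right (fun t => pastSup ψ T ρ (ψ t p))]
    simp only [ψ.map_add]
  rw [orbitMean, orbitMean, h1, zero_add, ← mul_sub]
  congr 1
  rw [← intervalIntegral.integral_add_adjacent_intervals (hi s 0) (hi 0 (T + s)),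
    ← intervalIntegral.integral_add_adjacent_intervals (hi 0 T) (hi T (T + s)),
    intervalIntegral.integral_symm 0 s]
  ring

theorem orbitMean_le_flow (h : Absorbing ψ T L ρ) (hT : 0 < T) {p : X} (hp : p ∈ L) {s : ℝ}
    (hs : 0 ≤ s) : orbitMean ψ T ρ p ≤ orbitMean ψ T ρ (ψ s p) := by
  refine mul_le_mul_of_nonneg_left ?_ (inv_nonneg.2 hT.le)
  refine intervalIntegral.integral_mono_on hT.le
    ((h.continuous_pastSup_flow p).intervalIntegrable 0 T)
    ((h.continuous_pastSup_flow _).intervalIntegrable 0 T) fun t _ => ?_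
  rw [← ψ.map_add]
  exact h.monotone_pastSup hT hp (by linarith)

/-- The mean over a moving window of the monotone function r grows strictly when r(0) < r(T).
Equality would make r identically 0 or 1 on [0,T], because a positive r(0) forces r(T) = 1, and the
mean would be 0 or 1. -/
theorem orbitMean_lt_flow (h : Absorbing ψ T L ρ) (hT : 0 < T) {p : X} (hp : p ∈ L)
    (h0 : 0 < orbitMean ψ T ρ p) (h1 : orbitMean ψ T ρ p < 1) {s : ℝ} (hs : 0 < s) :
    orbitMean ψ T ρ p < orbitMean ψ T ρ (ψ s p) := by
  have hmono := h.monotone_pastSup hT hp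
  have hcont := h.continuous_pastSup_flow p
  set r := fun t => pastSup ψ T ρ (ψ t p) with hr
  have hi := fun a b => hcont.intervalIntegrable (μ := MeasureTheory.volume) a b
  have hr0 : r 0 = pastSup ψ T ρ p := by simp only [hr, ψ.map_zero_apply]
  have hrT : 0 < r T := by
    by_contra hle
    have : ∫ t in (0 : ℝ)..T, r t ≤ ∫ t in (0 : ℝ)..T, (0 : ℝ) :=
      intervalIntegral.integral_mono_on hT.le (hi _ _) (continuous_const.intervalIntegrable 0 T)
        fun t ht => (hmono ht.2).trans (not_lt.1 hle)
    simp only [intervalIntegral.integral_zero] at this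
    exact absurd h0 (not_lt.2 (mul_nonpos_of_nonneg_of_nonpos (inv_nonneg.2 hT.le) this))
  have hlt : r 0 < r T := by
    rcases (h.pastSup_nonneg hT p).eq_or_lt with e | e
    · rwa [hr0, ← e]
    · have e1 : r T = 1 := h.pastSup_flow_eq_one hT hp e le_rfl
      refine lt_of_le_of_ne (hmono hT.le) fun e2 => ?_
      have : ∫ t in (0 : ℝ)..T, (1 : ℝ) ≤ ∫ t in (0 : ℝ)..T, r t :=
        intervalIntegral.integral_mono_on hT.le (continuous_const.intervalIntegrable 0 T) (hi _ _)
          fun t ht => (e1.symm.trans e2.symm).le.trans (hmono ht.1)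
      rw [orbitMean, inv_mul_lt_iff₀ hT] at h1
      simp only [intervalIntegral.integral_const, smul_eq_mul, sub_zero, mul_one] at this h1
      linarith
  obtain ⟨s', hs', hs's, hlt'⟩ : ∃ s' > 0, s' ≤ s ∧ r s' < r T := by
    have hev : ∀ᶠ t in 𝓝[>] (0 : ℝ), r t < r T :=
      (hcont.continuousAt.eventually (gt_mem_nhds hlt)).filter_mono nhdsWithin_le_nhds
    obtain ⟨s', ⟨h1, h2⟩, h3⟩ := ((hev.and (Ioc_mem_nhdsGT hs)).and self_mem_nhdsWithin).exists
    exact ⟨s', h3, h2.2, h1⟩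
  refine lt_of_lt_of_le ?_ (?_ : orbitMean ψ T ρ (ψ s' p) ≤ _)
  · rw [← sub_pos, h.orbitMean_flow]
    refine mul_pos (inv_pos.2 hT) (sub_pos.2 ?_)
    have i1 : ∫ t in (0 : ℝ)..s', r t ≤ ∫ t in (0 : ℝ)..s', r s' :=
      intervalIntegral.integral_mono_on hs'.le (hi _ _) (continuous_const.intervalIntegrable _ _)
        fun t ht => hmono ht.2
    have i2 : ∫ t in T..(T + s'), r T ≤ ∫ t in T..(T + s'), r t :=
      intervalIntegral.integral_mono_on (by linarith) (continuous_const.intervalIntegrable _ _)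
        (hi _ _) fun t ht => hmono ht.1
    simp only [intervalIntegral.integral_const, smul_eq_mul, sub_zero, add_sub_cancel_left] at i1 i2
    have := mul_lt_mul_of_pos_left hlt' hs'
    linarith
  · have := h.orbitMean_le_flow hT (h.mem_flow p hp s') (sub_nonneg.2 hs's)
    rwa [← ψ.map_add, sub_add_cancel] at this

end Absorbing

end Smoothing

/-! ### Improving a pre-Lyapunov map -/

section Improving

variable {M : Type*} [MetricSpace M] [CompactSpace M] {φ : Flow ℝ M} {f : C(M, UnitAddCircle)}
  {T : ℝ}

/-- A function on the covering of a pre-Lyapunov map that is absorbing for the lifted flow and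
separates the levels `0` and `1`. -/
theorem IsPreLyapunov.exists_absorbing [Nonempty M] (h : IsPreLyapunov φ T (-f)) (hT : 0 < T) :
    ∃ ρ : M × ℝ → ℝ, Absorbing (liftFlow φ f) T (liftSet f) ρ ∧ (∀ p, 1 ≤ p.2 → ρ p = 1) ∧
      ∀ p, p.2 ≤ 0 → ρ p = 0 := by
  obtain ⟨ε₀, hε₀, hchain⟩ := h.exists_chain_bound hT (by norm_num : (0 : ℝ) < 1 / 3)
  obtain ⟨ε, hε, hεε₀, hε6⟩ : ∃ ε > 0, ε ≤ ε₀ ∧ ε ≤ 1 / 6 :=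
    ⟨min ε₀ (1 / 6), by positivity, min_le_left _ _, min_le_right _ _⟩
  -- Chains lose at most 1/3, so A and its forward flow stay above 1/3. With ε ≤ 1/6, the
  -- ε-neighbourhood of B lies above 0, and that of {height ≥ 1} lies above 2/3.
  set A : Set (M × ℝ) := {q | ∃ p ∈ liftSet f, 2 / 3 ≤ p.2 ∧
    Relation.ReflTransGen (ChainStep φ f T ε) p q} with hA
  have hAlow : ∀ q ∈ A, 1 / 3 ≤ q.2 := by
    rintro q ⟨p, hp, hp2, hpq⟩
    linarith [hchain p hp q (reflTransGen_chain_mono hεε₀ hpq)]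
  set B : Set (M × ℝ) := {b | 1 ≤ b.2 ∨ ∃ q ∈ A, ∃ t ≥ T, liftFlow φ f t q = b} with hB
  have hBlow : ∀ b ∈ B, 1 / 3 ≤ b.2 := by
    rintro b (hb | ⟨q, hq, t, ht, rfl⟩)
    · linarith
    · have := h.snd_mono q (hT.le.trans ht)
      rw [(liftFlow φ f).map_zero_apply] at this
      exact (hAlow q hq).trans this
  obtain ⟨x₀⟩ := ‹Nonempty M›
  have hBne : B.Nonempty := ⟨(x₀, 1), Or.inl le_rfl⟩
  have hone : ∀ b ∈ B, max 0 (1 - Metric.infDist b B / ε) = 1 := fun b hb => by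
    rw [Metric.infDist_zero_of_mem hb]; norm_num
  have hclose : ∀ p, 0 < max 0 (1 - Metric.infDist p B / ε) → ∃ b ∈ B, dist b p < ε := by
    intro p hp
    have h1 := (lt_max_iff.1 hp).resolve_left (lt_irrefl 0)
    rw [sub_pos, div_lt_one hε, Metric.infDist_lt_iff hBne] at h1
    obtain ⟨b, hb, hd⟩ := h1
    exact ⟨b, hb, by rwa [dist_comm]⟩
  refine ⟨fun p => max 0 (1 - Metric.infDist p B / ε), ⟨?_, fun p => le_max_left _ _, fun p => ?_,
    fun p hp t => liftFlow_mem hp t, fun p hp hp0 t ht => ?_⟩, fun p hp => hone p (Or.inl hp),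
    fun p hp => ?_⟩
  · exact continuous_const.max (continuous_const.sub ((Metric.continuous_infDist_pt B).div_const ε))
  · refine max_le zero_le_one (sub_le_self _ (div_nonneg Metric.infDist_nonneg hε.le))
  -- A point within ε of B is itself in A, either by its height or as the end of one more jump; an
  -- arc of length at least T then lands in B.
  · refine hone _ (Or.inr ⟨p, ?_, t, ht, rfl⟩)
    obtain ⟨b, hb | ⟨q, ⟨p', hp', hp'2, hpq⟩, s, hs, rfl⟩, hd⟩ := hclose p hp0
    · refine ⟨p, hp, ?_, .refl⟩
      linarith [(abs_lt.1 ((abs_sub_snd_le _ _).trans_lt hd)).2]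
    · exact ⟨p', hp', hp'2, hpq.tail ⟨hp, s, hs, hd⟩⟩
  · by_contra hne
    obtain ⟨b, hb, hd⟩ := hclose p (lt_of_le_of_ne (le_max_left _ _) (Ne.symm hne))
    linarith [(abs_lt.1 ((abs_sub_snd_le _ _).trans_lt hd)).2, hBlow b hb]

theorem sum_range_sub_shift (g : ℝ → ℝ) (v K : ℝ) (n : ℕ) :
    ∑ j ∈ Finset.range n, g (v + 1 + K - j) - ∑ j ∈ Finset.range n, g (v + K - j) =
      g (v + 1 + K) - g (v + 1 + K - n) := by
  induction n with
  | zero => simp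
  | succ n ih =>
    rw [Finset.sum_range_succ, Finset.sum_range_succ, add_sub_add_comm, ih]
    have : v + K - (n : ℝ) = v + 1 + K - ((n + 1 : ℕ) : ℝ) := by push_cast; ring
    rw [this]; ring

/-- A real-valued function on the covering that is equivariant near the level `0`, vanishes on
recurrent points at that level, and increases along the flow off the integers. -/
theorem IsPLMap.exists_equivariant [Nonempty M] {α : H1 M} (h : IsPLMap φ T α f) (hT : 0 < T) :
    ∃ Ψ : M × ℝ → ℝ, Continuous Ψ ∧
      (∀ x, ∀ v ∈ Icc (-1 : ℝ) 0, Ψ (x, v + 1) = Ψ (x, v) + 1) ∧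
      (∀ x ∈ alphaRec φ α, Ψ (x, 0) = 0) ∧
      ∀ p ∈ liftSet f, (Ψ p : UnitAddCircle) ≠ 0 → ∀ t > 0, Ψ p < Ψ (liftFlow φ f t p) := by
  obtain ⟨ρ, hρ, hρ1, hρ0⟩ := h.2.2.exists_absorbing hT
  set ψ := liftFlow φ f
  have hsnd : ∀ (p : M × ℝ) t, (ψ t p).2 = p.2 + orbitVar φ f p.1 t := fun p t => rfl
  obtain ⟨C, hC⟩ : ∃ C : ℝ, ∀ x, orbitVar φ f x T ≤ C := by
    have hc : Continuous fun x => orbitVar φ f x T :=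
      (continuous_orbitVar φ f).comp (by fun_prop : Continuous fun x : M => (x, T))
    obtain ⟨C, hC⟩ := (isCompact_range hc).bddAbove
    exact ⟨C, fun x => hC ⟨x, rfl⟩⟩
  -- G is 1 above height 1 and 0 below -C. With 2K translates the telescoping sum over v in [-1,0]
  -- therefore has end values 1 and 0.
  obtain ⟨K, hK⟩ := exists_nat_ge (C + 1)
  have hC0 : 0 ≤ C := (h.2.2.orbitVar_nonneg (Classical.arbitrary M) hT.le).trans (hC _)
  set G := orbitMean ψ T ρ with hG
  have hGc : Continuous G := hρ.continuous_orbitMean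
  have hG1 : ∀ p, 1 ≤ p.2 → G p = 1 := fun p hp => hρ.orbitMean_eq_one hT fun t ht =>
    hρ1 _ (by rw [hsnd]; linarith [h.2.2.orbitVar_nonneg p.1 ht.1])
  have hG0 : ∀ p, p.2 + orbitVar φ f p.1 T ≤ 0 → G p = 0 := fun p hp =>
    hρ.orbitMean_eq_zero hT fun t ht =>
      hρ0 _ (by rw [hsnd]; linarith [h.2.2.orbitVar_mono p.1 ht.2])
  refine ⟨fun p => ∑ j ∈ Finset.range (2 * K), G (p.1, p.2 + K - j) - K, ?_, ?_, ?_, ?_⟩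
  · refine (continuous_finsetSum _ fun j _ => hGc.comp ?_).sub continuous_const
    fun_prop
  · intro x v hv
    have := sum_range_sub_shift (fun v => G (x, v)) v K (2 * K)
    rw [hG1 (x, v + 1 + K) (by simp only; linarith [hv.1]), hG0 (x, v + 1 + K - (2 * K : ℕ)) (by
      simp only; push_cast; linarith [hv.2, hC x])] at this
    simp only at this ⊢
    linarith
  · intro x hx
    have hz := h.orbitVar_eq_zero hT hx hT.le
    have : ∀ j ∈ Finset.range (2 * K), G (x, 0 + K - j) = if j < K then 1 else 0 := by
      intro j _
      split_ifs with hj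
      · refine hG1 _ ?_
        have : (j + 1 : ℝ) ≤ K := by exact_mod_cast hj
        simp only; linarith
      · refine hG0 _ ?_
        have : (K : ℝ) ≤ j := by exact_mod_cast not_lt.1 hj
        simp only [hz]; linarith
    simp only
    rw [Finset.sum_congr rfl this, Finset.sum_ite, Finset.sum_const_zero, add_zero,
      Finset.sum_const, sub_eq_zero]
    have : (Finset.range (2 * K)).filter (· < K) = Finset.range K := by
      ext j; simp only [Finset.mem_filter, Finset.mem_range]; omega
    rw [this]; simp
  · intro p hp hne t ht
    have hmem : ∀ j : ℕ, (p.1, p.2 + K - j) ∈ liftSet f := fun j => by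
      have := shiftLift_mem hp ((K : ℤ) - j)
      simp only [shiftLift] at this
      convert this using 2
      push_cast; ring
    have hflow : ∀ j : ℕ, ((ψ t p).1, (ψ t p).2 + K - j) = ψ t (p.1, p.2 + K - j) := fun j =>
      Prod.ext rfl (by simp only [hsnd]; ring)
    simp only [hflow]
    refine sub_lt_sub_right (Finset.sum_lt_sum
      (fun j _ => hρ.orbitMean_le_flow hT (hmem j) ht.le) ?_) _
    -- If no summand increased, each would be 0 or 1 and the sum would be an integer.
    by_contra hno
    push Not at hno
    have hint : ∀ j ∈ Finset.range (2 * K), ∃ m : ℤ, G (p.1, p.2 + K - j) = m := by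
      intro j hj
      rcases (hρ.orbitMean_nonneg hT (p.1, p.2 + K - j)).eq_or_lt with e | e
      · exact ⟨0, by rw [hG, ← e]; simp⟩
      rcases (hρ.orbitMean_le_one hT (p.1, p.2 + K - j)).eq_or_lt with e' | e'
      · exact ⟨1, by rw [hG, e']; simp⟩
      exact absurd (hρ.orbitMean_lt_flow hT (hmem j) e e' ht) (not_lt.2 (hno j hj))
    choose! m hm using hint
    apply hne
    simp only
    rw [Finset.sum_congr rfl hm]
    have : ∑ j ∈ Finset.range (2 * K), (m j : ℝ) - K =
        ((∑ j ∈ Finset.range (2 * K), m j - K : ℤ) : ℝ) := by push_cast; rfl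
    rw [this, coe_circle_int]

/-- Every pre-Lyapunov map is homotopic, relative to the recurrent set, to a map that increases
along the flow off its zero set. -/
theorem IsPLMap.exists_increasesOffZero [Nonempty M] {α : H1 M} (h : IsPLMap φ T α f)
    (hT : 0 < T) : ∃ (u : C(M, ℝ)) (g : C(M, UnitAddCircle)), (∀ x ∈ alphaRec φ α, u x = 0) ∧
      (∀ x, g x = f x + (u x : UnitAddCircle)) ∧ IncreasesOffZero φ g := by
  obtain ⟨Ψ, hΨ, hadd, hrec, hinc⟩ := h.exists_equivariant hT
  -- Equivariance makes Ψ(x,v) - v independent of the lift v, so it descends to a function on M,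
  -- continuous because f has continuous local lifts with values in [-1,1].
  have hlift : ∀ x, ∀ v ∈ Icc (-1 : ℝ) 1, (v : UnitAddCircle) = f x →
      Ψ (x, v) - v = Ψ (x, signedRep (f x)) - signedRep (f x) := by
    intro x v hv hvx
    have hr := signedRep_mem (f x)
    obtain ⟨m, hm⟩ := coe_circle_eq_iff.1 (hvx.trans (coe_signedRep (f x)).symm)
    set r := signedRep (f x)
    have h1 : (-2 : ℝ) < m := by linarith [hv.1, hr.2]
    have h2 : (m : ℝ) < 2 := by linarith [hv.2, hr.1]
    have h1' : -2 < m := by exact_mod_cast h1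
    have h2' : m < 2 := by exact_mod_cast h2
    rw [hm] at hv ⊢
    obtain rfl | rfl | rfl : m = -1 ∨ m = 0 ∨ m = 1 := by omega
    · push_cast at hv ⊢
      have := hadd x (r + -1) ⟨hv.1, by linarith [hr.2]⟩
      rw [neg_add_cancel_right] at this
      linarith
    · simp
    · push_cast at hv ⊢
      linarith [hadd x r ⟨by linarith [hr.1], by linarith [hv.2]⟩]
  have hcont : Continuous fun x => Ψ (x, signedRep (f x)) - signedRep (f x) := by
    refine continuous_iff_continuousAt.2 fun x₀ => ?_
    set v : M → ℝ := fun x => signedRep (f x₀) + signedRep (f x - f x₀) with hv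
    have hvc : ContinuousAt v x₀ := by
      refine continuousAt_const.add (ContinuousAt.comp (g := signedRep) ?_
        (f.continuous.sub continuous_const).continuousAt)
      rw [sub_self]; exact continuousAt_signedRep_zero
    have he : (fun x => Ψ (x, signedRep (f x)) - signedRep (f x)) = fun x => Ψ (x, v x) - v x := by
      ext x
      have h1 := signedRep_mem (f x₀)
      have h2 := signedRep_mem (f x - f x₀)
      refine (hlift x _ ⟨by linarith [h1.1, h2.1], by linarith [h1.2, h2.2]⟩ ?_).symm
      rw [AddCircle.coe_add, coe_signedRep, coe_signedRep]; abel
    rw [he]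
    exact (ContinuousAt.comp (g := Ψ) hΨ.continuousAt (continuousAt_id.prodMk hvc)).sub hvc
  set u : C(M, ℝ) := ⟨_, hcont⟩ with hu
  have hux : ∀ x, u x = Ψ (x, signedRep (f x)) - signedRep (f x) := fun x => rfl
  set g : C(M, UnitAddCircle) := ⟨fun x => f x + (u x : UnitAddCircle),
    f.continuous.add (continuous_coe_circle.comp u.continuous)⟩ with hg
  have hgx : ∀ x, g x = f x + (u x : UnitAddCircle) := fun x => rfl
  refine ⟨u, g, fun x hx => ?_, hgx, fun x hx δ hδ => ?_⟩
  · rw [hux, h.2.1 x hx, signedRep_zero, hrec x hx, sub_zero]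
  · set r := signedRep (f x) with hr
    have hrf : (r : UnitAddCircle) = f x := coe_signedRep _
    have hrI := signedRep_mem (f x)
    have hcV : ContinuousAt (fun t => orbitVar φ f x t) 0 :=
      (continuous_orbitVar_right φ f x).continuousAt
    obtain ⟨s, hs, hsV⟩ := exists_pos_of_eventually
      (eventually_abs_lt_of_continuousAt hcV (orbitVar_zero ..) (by norm_num : (0 : ℝ) < 1 / 2))
    obtain ⟨t, ht0, htδ, hts⟩ : ∃ t > 0, t < δ ∧ t ≤ s :=
      ⟨min (δ / 2) s, by positivity, (min_le_left _ _).trans_lt (by linarith), min_le_right _ _⟩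
    refine ⟨t, ht0, htδ, ?_⟩
    have hV := abs_lt.1 (hsV t (by rwa [abs_of_pos ht0]))
    rw [orbitVar_add_real hgx]
    have h1 := hlift (φ t x) (r + orbitVar φ f x t)
      ⟨by linarith [hrI.1], by linarith [hrI.2]⟩ (coe_add_orbitVar x hrf t)
    have h2 := hinc (x, r) hrf (fun h0 => hx ?_) t ht0
    · rw [liftFlow_apply] at h2
      rw [hux, hux, ← h1]
      linarith
    · rw [hgx, hux, AddCircle.coe_sub, ← hr, h0, hrf]; abel

end Improving

/-! ### The level set of a map that increases off its zero set -/

section HalfLevel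

variable {M : Type*} [TopologicalSpace M] {φ : Flow ℝ M} {f : C(M, UnitAddCircle)}

theorem coe_half_eq_neg : ((1 / 2 : ℝ) : UnitAddCircle) = -((1 / 2 : ℝ) : UnitAddCircle) := by
  rw [← AddCircle.coe_neg, coe_circle_eq_iff]
  exact ⟨1, by norm_num⟩

theorem continuousAt_signedRep_of_ne {c : UnitAddCircle} (hc : c ≠ ((1 / 2 : ℝ) : UnitAddCircle)) :
    ContinuousAt signedRep c := by
  refine continuousAt_subtype_val.comp (AddCircle.continuousAt_equivIco 1 _ ?_)
  rwa [AddCircle.coe_neg, ← coe_half_eq_neg]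

/-- The level set `1/2` of a circle-valued map. -/
def halfLevel (f : C(M, UnitAddCircle)) : Set M := {x | f x = ((1 / 2 : ℝ) : UnitAddCircle)}

theorem isClosed_halfLevel : IsClosed (halfLevel f) := isClosed_eq f.continuous continuous_const

theorem ne_zero_of_mem_halfLevel {x : M} (hx : x ∈ halfLevel f) : f x ≠ 0 := by
  rw [(hx : f x = _)]; exact half_ne_zero_circle

theorem IncreasesOffZero.crossesPositively (h : IncreasesOffZero φ f) :
    CrossesPositively φ (halfLevel f)
      (f + ContinuousMap.const M ((1 / 2 : ℝ) : UnitAddCircle)) := by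
  refine ⟨?_, fun x hx => ?_⟩
  · ext x
    change f x + ((1 / 2 : ℝ) : UnitAddCircle) = 0 ↔ f x = _
    rw [add_eq_zero_iff_eq_neg, ← coe_half_eq_neg]
  · have hx0 := ne_zero_of_mem_halfLevel hx
    obtain ⟨δ, hδ, hV⟩ := exists_pos_of_eventually (eventually_abs_lt_of_continuousAt
      (continuous_orbitVar_right φ f x).continuousAt (orbitVar_zero φ f x)
      (by norm_num : (0 : ℝ) < 1 / 2))
    have hval : ∀ s, (f + ContinuousMap.const M ((1 / 2 : ℝ) : UnitAddCircle)) (φ s x) =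
        (orbitVar φ f x s : UnitAddCircle) := fun s => by
      rw [coe_orbitVar, (hx : f x = _), sub_eq_add_neg, ← coe_half_eq_neg]; rfl
    refine ⟨δ, hδ, fun s hs => ⟨_, ⟨h.orbitVar_pos hx0 hs.1, ?_⟩, hval s⟩,
      fun s hs => ⟨_, ⟨?_, h.orbitVar_neg hx0 hs.2⟩, hval s⟩⟩
    · exact (abs_lt.1 (hV s (by rw [abs_of_pos hs.1]; exact hs.2.le))).2
    · exact (abs_lt.1 (hV s (by rw [abs_of_neg hs.2]; linarith [hs.1]))).1

/-- The variation between two points of the level set is an integer, hence 0 when small; strict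
increase then forces the time to be 0. -/
theorem IncreasesOffZero.isTransverse (h : IncreasesOffZero φ f) :
    IsTransverse φ (halfLevel f) := by
  intro x hx
  have hc : ContinuousAt (fun z : M × ℝ => orbitVar φ f z.1 z.2) (x, 0) :=
    (continuous_orbitVar φ f).continuousAt
  have hev := eventually_abs_lt_of_continuousAt hc (orbitVar_zero φ f x) one_pos
  rw [nhds_prod_eq] at hev
  obtain ⟨P, hP, Q, hQ, hPQ⟩ := Filter.eventually_prod_iff.1 hev
  obtain ⟨t, ht, htQ⟩ := exists_pos_of_eventually hQ
  refine ⟨t, ht, {y | P y} ∩ halfLevel f, inter_subset_right,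
    Filter.inter_mem (mem_nhdsWithin_of_mem_nhds hP) self_mem_nhdsWithin,
    fun y hy s hs hys => ?_⟩
  have h0 : orbitVar φ f y s = 0 := by
    refine eq_zero_of_abs_lt_one ?_ (hPQ hy.1 (htQ s (abs_le.2 hs)))
    rw [coe_orbitVar, (hys.2 : f _ = _), (hy.2 : f y = _), sub_self]
  have hy0 := ne_zero_of_mem_halfLevel hy.2
  rcases lt_trichotomy s 0 with hs0 | hs0 | hs0
  · exact absurd h0 (h.orbitVar_neg hy0 hs0).ne
  · exact hs0
  · exact absurd h0 (h.orbitVar_pos hy0 hs0).ne'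

theorem IsTransverse.exists_ne {S : Set M} (h : IsTransverse φ S) {x : M} (hx : x ∈ S) :
    ∃ t : ℝ, φ t x ≠ x := by
  obtain ⟨t, ht, U, hUS, hU, hUt⟩ := h x hx
  have hxU : x ∈ U := mem_of_mem_nhdsWithin hx hU
  refine ⟨t, fun heq => ht.ne' ?_⟩
  exact hUt x hxU t ⟨by linarith, le_rfl⟩ (by rwa [heq])

/-- A real lift of a map that does not take the value `1/2`. -/
theorem exists_lift_of_halfLevel_eq_empty (h : halfLevel f = ∅) :
    ∃ w : C(M, ℝ), (∀ x, f x = (w x : UnitAddCircle)) ∧ ∀ x, f x = 0 → w x = 0 := by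
  have hne : ∀ x, f x ≠ ((1 / 2 : ℝ) : UnitAddCircle) := fun x hx =>
    (h ▸ (show x ∈ halfLevel f from hx) : x ∈ (∅ : Set M))
  refine ⟨⟨fun x => signedRep (f x), continuous_iff_continuousAt.2 fun x =>
    ContinuousAt.comp (g := signedRep) (continuousAt_signedRep_of_ne (hne x))
      f.continuous.continuousAt⟩,
    fun x => (coe_signedRep _).symm, fun x hx => ?_⟩
  change signedRep (f x) = 0
  rw [hx, signedRep_zero]

/-- Near a point of the level set, the orbits through a transversal meet the level set once, at a
time that depends continuously on the starting point. -/
theorem IncreasesOffZero.exists_hitting_time (h : IncreasesOffZero φ f) {Y : Type*}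
    [TopologicalSpace Y] {σ : Y → M} (hσ : Continuous σ) {y₀ : Y} (hy₀ : σ y₀ ∈ halfLevel f)
    {δ : ℝ} (hδ : 0 < δ) :
    ∃ (W : Set Y) (η : ℝ) (τ : W → ℝ), IsOpen W ∧ y₀ ∈ W ∧ 0 < η ∧ η < δ ∧ Continuous τ ∧
      (∀ v, |τ v| < η) ∧
      ∀ (v : W) (s : ℝ), |s| < η → (φ s (σ v) ∈ halfLevel f ↔ s = τ v) := by
  set k : Y → UnitAddCircle := fun y => f (σ y) - ((1 / 2 : ℝ) : UnitAddCircle) with hk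
  have hkc : Continuous k := (f.continuous.comp hσ).sub continuous_const
  have hk0 : k y₀ = 0 := by rw [hk]; simp only; rw [(hy₀ : f _ = _), sub_self]
  -- G is a local lift of f - 1/2 along the orbits; near (y₀, 0) it is smaller than 1 in absolute
  -- value, so there its zeros are exactly the hits of the level set.
  set G : Y × ℝ → ℝ := fun z => signedRep (k z.1) + orbitVar φ f (σ z.1) z.2 with hG
  have hVc : Continuous fun z : Y × ℝ => orbitVar φ f (σ z.1) z.2 :=
    (continuous_orbitVar φ f).comp ((hσ.comp continuous_fst).prodMk continuous_snd)
  have hGcoe : ∀ y s, (G (y, s) : UnitAddCircle) =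
      f (φ s (σ y)) - ((1 / 2 : ℝ) : UnitAddCircle) := fun y s => by
    simp only [hG, hk, AddCircle.coe_add, coe_signedRep, coe_orbitVar]; abel
  have hGc : ∀ z : Y × ℝ, k z.1 ≠ ((1 / 2 : ℝ) : UnitAddCircle) → ContinuousAt G z := fun z hz =>
    (ContinuousAt.comp (g := signedRep) (f := fun z : Y × ℝ => k z.1)
      (continuousAt_signedRep_of_ne hz) (hkc.comp continuous_fst).continuousAt).add
      hVc.continuousAt
  have hk0' : k y₀ ≠ ((1 / 2 : ℝ) : UnitAddCircle) := by
    rw [hk0]; exact half_ne_zero_circle.symm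
  have hev := eventually_abs_lt_of_continuousAt (hGc (y₀, 0) hk0')
    (by simp [hG, hk0, signedRep_zero, orbitVar_zero]) one_pos
  rw [nhds_prod_eq] at hev
  obtain ⟨P, hP, Q, hQ, hPQ⟩ := Filter.eventually_prod_iff.1 hev
  obtain ⟨t, ht, htQ⟩ := exists_pos_of_eventually hQ
  obtain ⟨η, hη, hηδ, hηt⟩ : ∃ η > 0, η < δ ∧ η ≤ t :=
    ⟨min (δ / 2) t, by positivity, (min_le_left _ _).trans_lt (by linarith), min_le_right _ _⟩
  have hy0 := ne_zero_of_mem_halfLevel hy₀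
  have hGc' : ∀ s, ContinuousAt (fun y => G (y, s)) y₀ := fun s =>
    ContinuousAt.comp (g := G) (hGc (y₀, s) hk0') (by fun_prop)
  have e1 : ∀ᶠ y in 𝓝 y₀, 0 < G (y, η) := (hGc' η).eventually (lt_mem_nhds (by
    simp only [hG, hk0, signedRep_zero, zero_add]; exact h.orbitVar_pos hy0 hη))
  have e2 : ∀ᶠ y in 𝓝 y₀, G (y, -η) < 0 := (hGc' (-η)).eventually (gt_mem_nhds (by
    simp only [hG, hk0, signedRep_zero, zero_add]; exact h.orbitVar_neg hy0 (by linarith)))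
  have e3 : ∀ᶠ y in 𝓝 y₀, k y ≠ ((1 / 2 : ℝ) : UnitAddCircle) :=
    hkc.continuousAt.eventually_ne hk0'
  obtain ⟨W, hW, hWo, hyW⟩ := mem_nhds_iff.1 (((hP.and e1).and (e2.and e3)))
  have hex : ∀ v : W, ∃ s, |s| < η ∧ G (v, s) = 0 := fun v => by
    obtain ⟨⟨-, h1⟩, h2, h3⟩ := hW v.2
    have hc : Continuous fun s => G (v, s) :=
      (continuous_const (y := signedRep (k v))).add (continuous_orbitVar_right φ f (σ v))
    obtain ⟨s, hs, hs0⟩ := intermediate_value_Ioo (by linarith : -η ≤ η) hc.continuousOn ⟨h2, h1⟩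
    exact ⟨s, abs_lt.2 hs, hs0⟩
  choose τ hτ hτ0 using hex
  have hmem : ∀ v : W, φ (τ v) (σ v) ∈ halfLevel f := fun v => by
    have := hGcoe v (τ v)
    rw [hτ0, AddCircle.coe_zero] at this
    exact sub_eq_zero.1 this.symm
  have hadd : ∀ (v : W) s, G (v, s) = orbitVar φ f (φ (τ v) (σ v)) (s - τ v) := fun v s => by
    have h1 := orbitVar_add (φ := φ) (f := f) (σ v) (τ v) (s - τ v)
    rw [add_sub_cancel] at h1
    have h2 := hτ0 v
    simp only [hG] at h2 ⊢
    linarith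
  have hneg : ∀ (v : W) s, s < τ v → G (v, s) < 0 := fun v s hs => by
    rw [hadd]; exact h.orbitVar_neg (ne_zero_of_mem_halfLevel (hmem v)) (by linarith)
  have hpos : ∀ (v : W) s, τ v < s → 0 < G (v, s) := fun v s hs => by
    rw [hadd]; exact h.orbitVar_pos (ne_zero_of_mem_halfLevel (hmem v)) (by linarith)
  refine ⟨W, η, τ, hWo, hyW, hη, hηδ, ?_, hτ, fun v s hs => ⟨fun hmem' => ?_, ?_⟩⟩
  · refine continuous_of_sign_change (g := fun z : W × ℝ => G (z.1, z.2)) ?_ hτ0 hneg hpos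
    refine continuous_iff_continuousAt.2 fun z => ?_
    exact ContinuousAt.comp (g := G) (hGc _ (hW z.1.2).2.2)
      (by fun_prop : ContinuousAt (fun z : W × ℝ => ((z.1 : Y), z.2)) z)
  · have h0 : G (v, s) = 0 := by
      refine eq_zero_of_abs_lt_one ?_ (hPQ (hW v.2).1.1 (htQ s (hs.le.trans hηt)))
      rw [hGcoe, (hmem' : f _ = _), sub_self]
    rcases lt_trichotomy s (τ v) with hl | hl | hl
    · exact absurd h0 (hneg v s hl).ne
    · exact hl
    · exact absurd h0 (hpos v s hl).ne'
  · rintro rfl; exact hmem v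

end HalfLevel

/-- The constant map `0` is pre-Lyapunov. -/
theorem isPreLyapunov_zero {M : Type*} [MetricSpace M] {φ : Flow ℝ M} {T : ℝ} :
    IsPreLyapunov φ T (-(0 : C(M, UnitAddCircle))) := by
  intro p q hpq
  have hV : ∀ x t, orbitVar φ (-(0 : C(M, UnitAddCircle))) x t = 0 := fun x t => by
    have := orbitVar_eq_of_lift (φ := φ) (f := -(0 : C(M, UnitAddCircle))) (x := x)
      isPreconnected_univ (mem_univ 0) (u := fun _ => 0) continuousOn_const (by simp) (mem_univ t)
    simpa using this
  obtain ⟨r, hr, t, -, hrq⟩ := hpq 1 one_pos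
  rw [liftedFlow_iff, hV, add_zero] at hrq
  rw [hrq.2]
  refine le_of_eq ?_
  clear hrq
  induction hr with
  | refl => rfl
  | @tail a b _ hs ih =>
    obtain ⟨s, -, c, hc, hd⟩ := hs
    rw [liftedFlow_iff, hV, add_zero] at hc
    have h1 : ((b.1.2 - c.1.2 : ℝ) : UnitAddCircle) = 0 := by
      rw [AddCircle.coe_sub, ← b.2, ← c.2]; simp
    have h2 := eq_zero_of_abs_lt_one h1 (by
      rw [abs_sub_comm]; exact (abs_sub_le_dist_cover c b).trans_lt hd)
    linarith [hc.2]

/-! ### Charts of the level set -/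

section Charts

theorem exists_chart_of_isOpenEmbedding {W X Y : Type*} [TopologicalSpace W] [TopologicalSpace X]
    [TopologicalSpace Y] {j : W → X} {i : W → Y} (hj : IsOpenEmbedding j) (hi : IsOpenEmbedding i)
    (w : W) : ∃ e : OpenPartialHomeomorph X Y, j w ∈ e.source ∧ e (j w) = i w := by
  have : Nonempty W := ⟨w⟩
  refine ⟨(hj.toOpenPartialHomeomorph j).symm.trans (hi.toOpenPartialHomeomorph i), ?_, ?_⟩
  · simp
  · simp only [OpenPartialHomeomorph.coe_trans, Function.comp_apply,
      hj.toOpenPartialHomeomorph_left_inv, hi.toOpenPartialHomeomorph_apply]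

/-- Points of the half-space off the hyperplane have a Euclidean chart. -/
theorem exists_euclidean_chart_halfSpace {d : ℕ} {v : HalfSpace d}
    (hv : ∀ i : Fin d, i.val = 0 → 0 < (v : EuclideanSpace ℝ (Fin d)) i) :
    ∃ e : OpenPartialHomeomorph (HalfSpace d) (EuclideanSpace ℝ (Fin d)), v ∈ e.source := by
  set O : Set (EuclideanSpace ℝ (Fin d)) := {x | ∀ i : Fin d, i.val = 0 → 0 < x i} with hO
  have hOo : IsOpen O := by
    have : O = ⋂ i : Fin d, {x | i.val = 0 → 0 < x i} := by ext x; simp [hO]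
    rw [this]
    refine isOpen_iInter_of_finite fun i => ?_
    by_cases hi : i.val = 0
    · simp only [hi, forall_const]
      exact isOpen_lt continuous_const (by fun_prop)
    · simp [hi]
  set j : O → HalfSpace d := fun x => ⟨x, fun i hi => (x.2 i hi).le⟩ with hj
  have hjc : Continuous j := continuous_subtype_val.subtype_mk _
  have hje : IsOpenEmbedding j := by
    refine ⟨IsEmbedding.of_comp hjc continuous_subtype_val IsEmbedding.subtypeVal, ?_⟩
    have : range j = Subtype.val ⁻¹' O := by
      ext y
      exact ⟨by rintro ⟨x, rfl⟩; exact x.2, fun hy => ⟨⟨y, hy⟩, rfl⟩⟩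
    rw [this]; exact hOo.preimage continuous_subtype_val
  obtain ⟨e, he, -⟩ := exists_chart_of_isOpenEmbedding hje hOo.isOpenEmbedding_subtypeVal ⟨v, hv⟩
  exact ⟨e, he⟩

variable {M : Type*} [TopologicalSpace M] {φ : Flow ℝ M} {f : C(M, UnitAddCircle)} {d : ℕ}
  {V : Set (HalfSpace d)} {σ : V → M} {δ : ℝ}

/-- A flow box gives a chart of the level set. -/
theorem IncreasesOffZero.exists_chart (h : IncreasesOffZero φ f) (hV : IsOpen V) (hδ : 0 < δ)
    (hB : IsOpenEmbedding fun p : V × Ioo (-δ) δ => φ p.2 (σ p.1)) (v₀ : V)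
    (hv₀ : σ v₀ ∈ halfLevel f) :
    ∃ e : OpenPartialHomeomorph (halfLevel f) (HalfSpace d),
      (⟨σ v₀, hv₀⟩ : halfLevel f) ∈ e.source ∧
      e ⟨σ v₀, hv₀⟩ = v₀ := by
  have hσ : Continuous σ := by
    have : Continuous fun v : V => ((v, ⟨0, by simp [hδ]⟩) : V × Ioo (-δ) δ) := by fun_prop
    exact (hB.continuous.comp this).congr fun v => φ.map_zero_apply _
  obtain ⟨W, η, τ, hWo, hvW, hη, hηδ, hτc, hτη, hτ⟩ := h.exists_hitting_time hσ hv₀ hδ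
  have hmem : ∀ v : W, φ (τ v) (σ v) ∈ halfLevel f := fun v => (hτ v _ (hτη v)).2 rfl
  have hτ0 : τ ⟨v₀, hvW⟩ = 0 :=
    ((hτ ⟨v₀, hvW⟩ 0 (by rwa [abs_zero])).1 (by rwa [φ.map_zero_apply])).symm
  set j : W → halfLevel f := fun v => ⟨φ (τ v) (σ v), hmem v⟩ with hj
  set γ : W → V × Ioo (-δ) δ := fun v => (v, ⟨τ v, by
    have := abs_lt.1 (hτη v); constructor <;> linarith⟩) with hγ
  have hγc : Continuous γ := continuous_subtype_val.prodMk (hτc.subtype_mk _)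
  have hγe : IsEmbedding γ := IsEmbedding.of_comp hγc continuous_fst IsEmbedding.subtypeVal
  have hBγ := hB.isEmbedding.comp hγe
  have hjc : Continuous j := hBγ.continuous.subtype_mk _
  have hje : IsOpenEmbedding j := by
    refine ⟨IsEmbedding.of_comp hjc continuous_subtype_val hBγ, ?_⟩
    have hO : IsOpen {p : V × Ioo (-δ) δ | p.1 ∈ W ∧ |(p.2 : ℝ)| < η} :=
      (hWo.preimage continuous_fst).inter
        (isOpen_lt (by fun_prop : Continuous fun p : V × Ioo (-δ) δ => |(p.2 : ℝ)|)
          continuous_const)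
    -- By uniqueness of the hitting time, the graph of τ is all of the level set inside a smaller
    -- open flow box.
    have : range j = Subtype.val ⁻¹' ((fun p : V × Ioo (-δ) δ => φ p.2 (σ p.1)) ''
        {p : V × Ioo (-δ) δ | p.1 ∈ W ∧ |(p.2 : ℝ)| < η}) := by
      ext y
      constructor
      · rintro ⟨v, rfl⟩
        exact ⟨γ v, ⟨v.2, hτη v⟩, rfl⟩
      · rintro ⟨⟨v, s⟩, ⟨hv, hs⟩, hy⟩
        refine ⟨⟨v, hv⟩, Subtype.ext ?_⟩
        change φ (τ ⟨v, hv⟩) (σ v) = y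
        rw [← (hτ ⟨v, hv⟩ s hs).1 (by simp only at hy; rw [hy]; exact y.2)]
        exact hy
    rw [this]
    exact (hB.isOpenMap _ hO).preimage continuous_subtype_val
  obtain ⟨e, he, hev⟩ := exists_chart_of_isOpenEmbedding hje
    (hV.isOpenEmbedding_subtypeVal.comp hWo.isOpenEmbedding_subtypeVal) ⟨v₀, hvW⟩
  have hjv : j ⟨v₀, hvW⟩ = ⟨σ v₀, hv₀⟩ := Subtype.ext (by
    change φ (τ ⟨v₀, hvW⟩) (σ v₀) = σ v₀
    rw [hτ0, φ.map_zero_apply])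
  rw [hjv] at he hev
  exact ⟨e, he, hev⟩

/-- A flow box based at a point of the hyperplane consists of boundary points. -/
theorem mem_topBoundary_of_flowBox (hV : IsOpen V) (hδ : 0 < δ)
    (hB : IsOpenEmbedding fun p : V × Ioo (-δ) δ => φ p.2 (σ p.1)) (v₀ : V) {i : Fin d}
    (hi : i.val = 0) (h0 : ((v₀ : HalfSpace d) : EuclideanSpace ℝ (Fin d)) i = 0) (n : ℕ) :
    σ v₀ ∈ topBoundary n M := by
  rintro ⟨e, he⟩
  have hI : IsOpenEmbedding fun p : V × Ioo (-δ) δ => ((p.1 : HalfSpace d), (p.2 : ℝ)) :=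
    hV.isOpenEmbedding_subtypeVal.prodMap isOpen_Ioo.isOpenEmbedding_subtypeVal
  obtain ⟨χ, hχ, hχ0⟩ := exists_chart_of_isOpenEmbedding hI hB (v₀, ⟨0, by simp [hδ]⟩)
  simp only [φ.map_zero_apply] at hχ hχ0
  refine false_of_euclidean_chart (χ.trans e) (p₀ := (v₀, 0)) ?_ hi h0
  rw [OpenPartialHomeomorph.trans_source]
  exact ⟨hχ, by rw [mem_preimage, hχ0]; exact he⟩

/-- Transversality excludes fixed points, so flow boxes exist along the level set and give its
charts. A point over the interior of the half-space is interior to the level set; a point over the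
hyperplane lies in ∂M. -/
theorem IncreasesOffZero.isPartialCrossSection [CompactSpace M] (h : IncreasesOffZero φ f) {n : ℕ}
    (hM : IsTopManifold n M) (hbox : HasFlowBoxes φ n) (hne : (halfLevel f).Nonempty) :
    IsPartialCrossSection φ n (halfLevel f) := by
  have htr := h.isTransverse
  obtain ⟨hT2, hSC, -⟩ := hM
  refine ⟨hne, isClosed_halfLevel.isCompact, ?_, htr⟩
  obtain ⟨x₀, hx₀⟩ := hne
  obtain ⟨d, hd, -⟩ := hbox x₀ (htr.exists_ne hx₀)
  have hchart : ∀ x : halfLevel f, ∃ (V : Set (HalfSpace d)) (σ : V → M) (δ : ℝ), IsOpen V ∧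
      0 < δ ∧ IsOpenEmbedding (fun p : V × Ioo (-δ) δ => φ p.2 (σ p.1)) ∧ ∃ v : V, σ v = x := by
    intro x
    obtain ⟨d', hd', hx⟩ := hbox x (htr.exists_ne x.2)
    obtain rfl : d' = d := by omega
    exact hx
  refine ⟨d, hd, ⟨inferInstance, inferInstance, fun x => ?_⟩, fun x hx => ?_⟩
  · obtain ⟨V, σ, δ, hV, hδ, hB, v, hv⟩ := hchart x
    obtain ⟨x, hxS⟩ := x
    simp only at hv
    subst hv
    obtain ⟨e, he, -⟩ := h.exists_chart hV hδ hB v hxS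
    exact ⟨e, he⟩
  · obtain ⟨V, σ, δ, hV, hδ, hB, v, hv⟩ := hchart x
    obtain ⟨x, hxS⟩ := x
    simp only at hv
    subst hv
    by_cases hpos : ∀ i : Fin d, i.val = 0 → 0 < ((v : HalfSpace d) : EuclideanSpace ℝ (Fin d)) i
    · obtain ⟨e, he, hev⟩ := h.exists_chart hV hδ hB v hxS
      obtain ⟨e', he'⟩ := exists_euclidean_chart_halfSpace hpos
      refine absurd ⟨e.trans e', ?_⟩ hx
      rw [OpenPartialHomeomorph.trans_source]
      exact ⟨he, by rw [mem_preimage, hev]; exact he'⟩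
    · push Not at hpos
      obtain ⟨i, hi, hle⟩ := hpos
      exact mem_topBoundary_of_flowBox hV hδ hB v hi (le_antisymm hle ((v : HalfSpace d).2 i hi)) n

end Charts

/-! ### Surjectivity: realising a class of pre-Lyapunov maps by a section -/

section Realisation

variable {M : Type*} [MetricSpace M] [CompactSpace M] [Nonempty M] {φ : Flow ℝ M} {T : ℝ}
  {α : H1 M} {f : C(M, UnitAddCircle)}

/-- With flow boxes, a non-zero class of pre-Lyapunov maps is the class of a box map. -/
theorem IsPLMap.exists_crossSection (h : IsPLMap φ T α f) (hT : 0 < T) {n : ℕ}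
    (hM : IsTopManifold n M) (hbox : HasFlowBoxes φ n)
    (hne : ¬ ContinuousMap.HomotopicWith f 0 (IsPLMap φ T α)) :
    ∃ S, IsPartialCrossSection φ n S ∧ HasClass φ S α ∧ ∀ ε > 0, ∀ F, IsBoxMap φ S ε F →
      IsPLMap φ T α F → ContinuousMap.HomotopicWith F f (IsPLMap φ T α) := by
  obtain ⟨u, g, hu, hg, hinc⟩ := h.exists_increasesOffZero hT
  have hgα : classOf g = α := (classOf_eq_iff.2 ⟨u, hg⟩).symm.trans h.1
  -- If g avoids 1/2, it lifts to a real function vanishing on Rec_α, so f would be homotopic to 0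
  -- in X_α.
  have hSne : (halfLevel g).Nonempty := by
    rw [nonempty_iff_ne_empty]
    intro hS
    obtain ⟨w, hw, hw0⟩ := exists_lift_of_halfLevel_eq_empty hS
    have hf0 : ∀ x, (0 : C(M, UnitAddCircle)) x = f x + ((u - w) x : UnitAddCircle) := fun x => by
      have := hg x
      rw [hw] at this
      rw [ContinuousMap.sub_apply, AddCircle.coe_sub, this]
      simp
    have hPL : IsPLMap φ T α 0 :=
      ⟨(classOf_eq_iff.2 ⟨u - w, hf0⟩).symm.trans h.1, fun _ _ => rfl, isPreLyapunov_zero⟩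
    refine hne (h.homotopicWith hPL hf0 fun x hx => ?_)
    rw [ContinuousMap.sub_apply, hu x hx, hw0 x (by rw [hg, h.2.1 x hx, hu x hx]; simp), sub_zero]
  have hS := hinc.isPartialCrossSection hM hbox hSne
  have hcross := hinc.crossesPositively
  refine ⟨halfLevel g, hS, ⟨_, (classOf_add_const g _).trans hgα, hcross⟩, fun ε hε F hF hPL => ?_⟩
  obtain ⟨r, hr, hn⟩ := exists_noReturn hS.2.1 hS.2.2.2
  obtain ⟨w, hw, hw0⟩ := (hF.crossesPositively hε).exists_real hcross hS.2.1 hr hn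
  have hw' : ∀ x, g x = F x + (w x : UnitAddCircle) := fun x => by
    have := hw x
    simp only [ContinuousMap.add_apply, ContinuousMap.const_apply] at this
    rwa [add_right_comm, add_left_inj] at this
  -- Here g = F + w = f + u. The function w vanishes where F = g, in particular on the recurrent
  -- set, where both are 0.
  refine hPL.homotopicWith h (u := w - u) (fun x => ?_) fun x hx => ?_
  · have h1 := hw' x
    rw [hg] at h1
    rw [ContinuousMap.sub_apply, AddCircle.coe_sub, add_sub_assoc', ← h1, add_sub_cancel_right]
  · rw [ContinuousMap.sub_apply, hu x hx, hw0 x, sub_zero]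
    simp only [ContinuousMap.add_apply]
    rw [hPL.2.1 x hx, hg, h.2.1 x hx, hu x hx]; simp

end Realisation

end PartialCrossSections

namespace PartialCrossSections

/-! ### The induced map on isotopy classes -/

section BoxClass

variable {M : Type*} [MetricSpace M] {φ : Flow ℝ M} {n : ℕ} {T : ℝ} {α : H1 M}

theorem HasClass.isLocalSection {S : Set M} (h : HasClass φ S α) : IsLocalSection φ S :=
  let ⟨_, _, hf⟩ := h
  CrossesPositively.isLocalSection hf

theorem CrossSection.exists_radius (S : CrossSection φ n α) :
    ∃ ε > 0, NoReturn φ S.1 (2 * ε) := by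
  obtain ⟨r, hr, hn⟩ := exists_noReturn S.2.1.2.1 S.2.1.2.2.2
  exact ⟨r / 2, half_pos hr, hn.mono (by linarith)⟩

variable [CompactSpace M]

/-- Every embedded box of a cross-section of class `α` has a box map, which is a pre-Lyapunov map
of class `α`. -/
theorem CrossSection.exists_plMap (S : CrossSection φ n α) (hT : 0 < T) {ε : ℝ} (hε : 0 < ε)
    (hn : NoReturn φ S.1 (2 * ε)) : ∃ F : PLMap φ T α, IsBoxMap φ S.1 ε F.1 := by
  have hS := S.2.1.2.1
  obtain ⟨F, hF⟩ := exists_boxMap hS hε hn S.2.2.isLocalSection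
  exact ⟨⟨F, hF.isPLMap hε hT (hF.classOf_eq S.2.2 hS hε hn)⟩, hF⟩

/-- A box map of some embedded box of `S`. -/
noncomputable def boxPLMap (hT : 0 < T) (S : CrossSection φ n α) : PLMap φ T α :=
  (S.exists_plMap hT S.exists_radius.choose_spec.1 S.exists_radius.choose_spec.2).choose

theorem boxPLMap_spec (hT : 0 < T) (S : CrossSection φ n α) :
    ∃ ε > 0, NoReturn φ S.1 (2 * ε) ∧ IsBoxMap φ S.1 ε (boxPLMap hT S).1 :=
  ⟨_, S.exists_radius.choose_spec.1, S.exists_radius.choose_spec.2,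
    (S.exists_plMap hT S.exists_radius.choose_spec.1 S.exists_radius.choose_spec.2).choose_spec⟩

theorem boxPLMap_equiv (hT : 0 < T) (S : CrossSection φ n α) {ε : ℝ} (hε : 0 < ε)
    (hn : NoReturn φ S.1 (2 * ε)) (F : PLMap φ T α) (hF : IsBoxMap φ S.1 ε F.1) :
    (plSetoid φ T α) (boxPLMap hT S) F := by
  obtain ⟨ε', hε', hn', hF'⟩ := boxPLMap_spec hT S
  have := hF'.homotopicWith S.2.1.2.1 S.2.2.isLocalSection hε' hε hn' hn hF hT
  rwa [(boxPLMap hT S).2.1] at this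

theorem boxPLMap_equiv_of_isotopic (hT : 0 < T) {S₀ S₁ : CrossSection φ n α}
    (h : IsotopicAlongFlow φ S₀.1 S₁.1) :
    (plSetoid φ T α) (boxPLMap hT S₀) (boxPLMap hT S₁) := by
  obtain ⟨r, hr, hn⟩ := exists_noReturn S₀.2.1.2.1 S₀.2.1.2.2.2
  obtain ⟨ε, hε, hn₀, hn₁, F₀, F₁, hF₀, hF₁, hom⟩ :=
    h.exists_homotopicWith S₀.2.1.2.1 S₀.2.2.isLocalSection hr hn hT
  have hα₀ := hF₀.classOf_eq S₀.2.2 S₀.2.1.2.1 hε hn₀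
  have hα₁ := hF₁.classOf_eq S₁.2.2 S₁.2.1.2.1 hε hn₁
  rw [hα₀] at hom
  have e₀ := boxPLMap_equiv hT S₀ hε hn₀ ⟨F₀, hF₀.isPLMap hε hT hα₀⟩ hF₀
  have e₁ := boxPLMap_equiv hT S₁ hε hn₁ ⟨F₁, hF₁.isPLMap hε hT hα₁⟩ hF₁
  exact (e₀.trans hom).trans e₁.symm

variable [LocallyPathConnectedSpace M]

theorem boxPLMap_ne_zero (hT : 0 < T) (S : CrossSection φ n α) (f : PLMap φ T α)
    (h : (plSetoid φ T α) f (boxPLMap hT S)) : f.1 ≠ 0 := by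
  intro h0
  obtain ⟨ε, hε, -, hF⟩ := boxPLMap_spec hT S
  refine hF.not_homotopicWith_zero hε S.2.1.1 (T := T) ?_
  rw [(boxPLMap hT S).2.1, ← h0]
  exact ContinuousMap.HomotopicWith.symm h

/-- The map `[F]` from cross-sections up to isotopy along the flow to classes of pre-Lyapunov
maps. -/
noncomputable def boxClass (hT : 0 < T) : PS φ n α → PL φ T α :=
  Quot.lift (fun S => ⟨Quotient.mk _ (boxPLMap hT S), fun f hf =>
    boxPLMap_ne_zero hT S f (Quotient.exact hf)⟩)
    fun _ _ h => Subtype.ext (Quotient.sound (boxPLMap_equiv_of_isotopic hT h))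

theorem boxClass_injective (hT : 0 < T) :
    Function.Injective (boxClass hT : PS φ n α → PL φ T α) := by
  rintro ⟨S₀⟩ ⟨S₁⟩ h
  have h' : (plSetoid φ T α) (boxPLMap hT S₀) (boxPLMap hT S₁) :=
    Quotient.exact (congrArg Subtype.val h)
  obtain ⟨ε₀, hε₀, -, hF₀⟩ := boxPLMap_spec hT S₀
  obtain ⟨ε₁, hε₁, -, hF₁⟩ := boxPLMap_spec hT S₁
  refine Quot.sound (hF₀.isotopicAlongFlow S₀.2.1.2.1 hε₀ hε₁ hF₁ (T := T) ?_)
  rw [(boxPLMap hT S₀).2.1]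
  exact h'

theorem boxClass_surjective [Nonempty M] (hT : 0 < T) (hM : IsTopManifold n M)
    (hbox : HasFlowBoxes φ n) : Function.Surjective (boxClass hT : PS φ n α → PL φ T α) := by
  rintro ⟨⟨f⟩, hf⟩
  obtain ⟨S, hS, hSα, hF⟩ := f.2.exists_crossSection hT hM hbox fun hom => by
    obtain ⟨H⟩ := hom
    have h0 : IsPLMap φ T α 0 := by
      have := H.prop 1
      convert this using 1
      ext x; simp
    exact hf ⟨0, h0⟩ (Quotient.sound (s := plSetoid φ T α)
      (ContinuousMap.HomotopicWith.symm ⟨H⟩)) rfl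
  refine ⟨Quot.mk _ ⟨S, hS, hSα⟩, Subtype.ext (Quotient.sound (s := plSetoid φ T α) ?_)⟩
  obtain ⟨ε, hε, -, hFb⟩ := boxPLMap_spec (T := T) hT ⟨S, hS, hSα⟩
  exact hF ε hε _ hFb (boxPLMap hT _).2

end BoxClass

end PartialCrossSections

theorem mainTheorem5 {M : Type*} [MetricSpace M] [CompactSpace M] [ConnectedSpace M]
    (n : ℕ) (hM : PartialCrossSections.IsTopManifold n M) (φ : Flow ℝ M)
    (T : ℝ) (hT : 0 < T) (α : PartialCrossSections.H1 M) :
    ∃ Φ : PartialCrossSections.PS φ n α → PartialCrossSections.PL φ T α,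
      (∀ S : PartialCrossSections.CrossSection φ n α,
        (∃ ε : ℝ, 0 < ε ∧ PartialCrossSections.IsEmbeddedBox φ S.1 ε) ∧
        ∀ ε : ℝ, 0 < ε → PartialCrossSections.IsEmbeddedBox φ S.1 ε →
          ∃ F : PartialCrossSections.PLMap φ T α,
            PartialCrossSections.IsBoxMap φ S.1 ε F.1 ∧
            (Φ (Quot.mk _ S)).1 = Quotient.mk (PartialCrossSections.plSetoid φ T α) F) ∧
      Function.Injective Φ ∧
      (PartialCrossSections.HasFlowBoxes φ n → Function.Bijective Φ) := by
  open PartialCrossSections in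
  -- The manifold charts enter here to make orbit limit points recurrent in the sense that requires
  -- paths for the jumps.
  have := hM.locallyPathConnectedSpace
  refine ⟨boxClass hT, fun S => ⟨?_, fun ε hε he => ?_⟩, boxClass_injective hT,
    fun hbox => ⟨boxClass_injective hT, boxClass_surjective hT hM hbox⟩⟩
  · obtain ⟨ε, hε, hn⟩ := S.exists_radius
    exact ⟨ε, hε, (isEmbeddedBox_iff S.2.1.2.1).2 hn⟩
  · have hn := (isEmbeddedBox_iff S.2.1.2.1).1 he
    obtain ⟨F, hF⟩ := S.exists_plMap hT hε hn
    exact ⟨F, hF, Quotient.sound (boxPLMap_equiv hT S hε hn F hF)⟩
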